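/- **Setting.** Let $D\subset\mathbb R^d$ be compact, $H=L^2(D)$ with Lebesgue measure, $(\Omega,\mathcal A,P)$ a probability space, and $v_p(X)=(E\|X\|^p)^{1/p}$ for $H$-valued $X$. Two independent samples satisfy $$X_{t,T_1}=m_1(t/T_1,\cdot)+v_{t,T_1}\ (1\le t\le T_1),\qquad Y_{t,T_2}=m_2(t/T_2,\cdot)+w_{t,T_2}\ (1\le t\le T_2),$$ where $m_1,m_2:[0,1]\to H$ are Lipschitz continuous and each of the error arrays $v,w$ satisfies the following condition, stated for $v$. All $v_{t,T}$ are in $L^4_H$, and for every $u\in[0,1]$ there is a strictly stationary process $\{v_t^{(u)}\}_{t\in\mathbb Z}$ in $L^4_H$ with $E[v_t^{(u)}]=0$ such that * $\|v_{t,T}-v_t^{(u)}\|\le(|t/T-u|+1/T)\,U_{t,T}^{(u)}$ a.s. for $1\le t\le T$, with positive random variables $U_{t,T}^{(u)}$ such that $E[(U_{t,T}^{(u)})^4]<C$ for some $C<\infty$ independent of $u,t,T$; * $v_t^{(u)}=f_u(\varepsilon_t,\varepsilon_{t-1},\dots)$ with i.i.d. innovations $\varepsilon_j$ in a measurable space and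 $f_u$ measurable, and $\sum_{m\ge1}v_4(v_t^{(u)}-v_{m,t}^{(u)})<\infty$, where $v_{m,t}^{(u)}$ is obtained from $v_t^{(u)}$ by replacing $\varepsilon_{t-m},\varepsilon_{t-m-1},\dots$ by an independent copy. Fix $u\in(0,1)$ and assume $\lim_{m\to\infty}m\,v_2(v_0^{(u)}-v_{m,0}^{(u)})=0$, and the same for $w$. **Kernels and bandwidths.** $K_1:\mathbb R\to\mathbb R$ is symmetric, bounded, Lipschitz and compactly supported with $\int K_1=1$. $K_2:\mathbb R\to\mathbb R$ is bounded, compactly supported, continuous at $0$, and $K_2(0)=1$. Along a sequence of sample sizes with $T_1\wedge T_2\to\infty$ and $T_1/(T_1+T_2)\to\theta\in(0,1)$, the $i$-th sample ($i=1,2$) uses bandwidths $h_i,b_i>0$ (which may coincide for the two samples) with $\min\{T_ih_i,\ 1/(T_ih_i^3),\ b_i,\ T_ih_i/b_i\}\to\infty$. **Long-run covariances.** Let $$c_{1,u}(s_1,s_2)=E[v_0^{(u)}(s_1)v_0^{(u)}(s_2)]+\sum_{t\ge1}E[v_0^{(u)}(s_1)v_t^{(u)}(s_2)]+\sum_{t\ge1}E[v_0^{(u)}(s_2)v_t^{(u)}(s_1)]$$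 (in $L^2(D\times D)$), let $c_{2,u}$ be the analogous kernel for $w$, and let $\phi^{(u)}=(1-\theta)c_{1,u}+\theta c_{2,u}$. The estimator of $c_{1,u}$, with $T=T_1$, $h=h_1$, $b=b_1$, is $$\hat c_{1,u}(s_1,s_2)=\hat\gamma_0(s_1,s_2)+\sum_{t=1}^{T-1}K_2(t/b)\{\hat\gamma_t(s_1,s_2)+\hat\gamma_t(s_2,s_1)\},$$ $$\hat\gamma_t(s_1,s_2)=\frac1{Th}\sum_{j=t+1}^{T}K_1\Big(\frac{u-j/T}{h}\Big)(X_{j,T}-\bar X)(s_1)\,(X_{j-t,T}-\bar X)(s_2),\qquad \bar X=\frac1{Th}\sum_{t=1}^{T}K_1\Big(\frac{u-t/T}{h}\Big)X_{t,T},$$ $\hat c_{2,u}$ is defined analogously from $Y$, and $\hat\phi^{(u)}=(1-\hat\theta)\hat c_{1,u}+\hat\theta\hat c_{2,u}$ with $\hat\theta=T_1/(T_1+T_2)$. Let $\eta_{u,j}$ and $\hat\eta_{u,j}$ be the $j$-th largest eigenvalues, counted with multiplicity, of the integral operators on $H$ with kernels $\phi^{(u)}$ and $\hat\phi^{(u)}$.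 **Estimator.** Let $\varepsilon_0>0$, let $\hat r_j=\hat\eta_{u,j}/\hat\eta_{u,1}$ if $|\hat\eta_{u,j}/\hat\eta_{u,1}|\ge\varepsilon_0$ and $\hat r_j=0$ otherwise, and let $\hat q_0\in\arg\min_{1\le j\le\bar q}\hat r_{j+1}/\hat r_j$, with the convention $0/0=1$ and ties broken arbitrarily. **Claim.** If $q_0\ge1$, $\eta_{u,q_0}>\eta_{u,q_0+1}=0$, $\bar q\ge q_0$ and $0<\varepsilon_0<\eta_{u,q_0}/\eta_{u,1}$, then $\hat q_0\to q_0$ in probability. -/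

import Mathlib

open MeasureTheory ProbabilityTheory Filter Topology
open scoped ENNReal

noncomputable section

namespace LSFTS

/-! ### The space `L²(μ)`, tensor-product kernels and integral operators -/

section Kernels

variable {α : Type*} [MeasurableSpace α] {μ : Measure α}

/-- Real square-integrable functions (modulo a.e. equality). -/
abbrev L2 (μ : Measure α) := Lp ℝ 2 μ

/-- `L²(μ)` carries its Borel σ-algebra. -/
instance instMeasurableSpaceL2 : MeasurableSpace (L2 μ) := borel _

instance instBorelSpaceL2 : BorelSpace (L2 μ) := ⟨rfl⟩

lemma memLp_tensor (x y : L2 μ) :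
    MemLp (fun s : α × α => x s.1 * y s.2) 2 (μ.prod μ) := by
  have hx := Lp.memLp x
  have hy := Lp.memLp y
  have hm : AEStronglyMeasurable (fun s : α × α => x s.1 * y s.2) (μ.prod μ) :=
    (hx.1.comp_fst).mul (hy.1.comp_snd)
  rw [memLp_two_iff_integrable_sq hm]
  have h := ((memLp_two_iff_integrable_sq hx.1).1 hx).mul_prod
    ((memLp_two_iff_integrable_sq hy.1).1 hy)
  refine h.congr (Eventually.of_forall fun s => ?_)
  simp only [mul_pow]

/-- The kernel `(s₁, s₂) ↦ x s₁ * y s₂`, an element of `L²(μ ⊗ μ)`. -/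
def tensor (x y : L2 μ) : L2 (μ.prod μ) := (memLp_tensor x y).toLp _

variable [SFinite μ]

/-- The transposed kernel `(s₁, s₂) ↦ k (s₂, s₁)`. -/
def transposeKernel (k : L2 (μ.prod μ)) : L2 (μ.prod μ) :=
  Lp.compMeasurePreserving Prod.swap Measure.measurePreserving_swap k

lemma ae_memLp_slice (k : L2 (μ.prod μ)) : ∀ᵐ s ∂μ, MemLp (fun r => k (s, r)) 2 μ := by
  have hk := Lp.memLp k
  have hi := (memLp_two_iff_integrable_sq hk.1).1 hk
  filter_upwards [hi.prod_right_ae, hk.1.prodMk_left] with s h1 h2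
  exact (memLp_two_iff_integrable_sq h2).2 h1

lemma ae_integrable_slice_mul (k : L2 (μ.prod μ)) (x : L2 μ) :
    ∀ᵐ s ∂μ, Integrable (fun r => k (s, r) * x r) μ := by
  filter_upwards [ae_memLp_slice k] with s hs
  exact hs.integrable_mul (Lp.memLp x)

lemma memLp_integralOperator (k : L2 (μ.prod μ)) (x : L2 μ) :
    MemLp (fun s => ∫ r, k (s, r) * x r ∂μ) 2 μ := by
  have hk := Lp.memLp k
  have hx := Lp.memLp x
  have hki := (memLp_two_iff_integrable_sq hk.1).1 hk
  have hxi := (memLp_two_iff_integrable_sq hx.1).1 hx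
  have hm : AEStronglyMeasurable (fun s => ∫ r, k (s, r) * x r ∂μ) μ :=
    (hk.1.mul (hx.1.comp_snd)).integral_prod_right'
  rw [memLp_two_iff_integrable_sq hm]
  refine ((hki.integral_prod_left).mul_const (∫ r, x r ^ 2 ∂μ)).mono' (hm.pow 2) ?_
  filter_upwards [ae_memLp_slice k] with s hs
  have hsi := (memLp_two_iff_integrable_sq hs.1).1 hs
  have hp : Integrable (fun r => k (s, r) * x r) μ := hs.integrable_mul hx
  have hB : 0 ≤ ∫ r, x r ^ 2 ∂μ := integral_nonneg fun r => sq_nonneg _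
  have hA : 0 ≤ ∫ r, k (s, r) ^ 2 ∂μ := integral_nonneg fun r => sq_nonneg _
  have key : ∀ a b : ℝ, 0 ≤ a ^ 2 * (∫ r, k (s, r) ^ 2 ∂μ)
      + 2 * a * b * (∫ r, k (s, r) * x r ∂μ) + b ^ 2 * ∫ r, x r ^ 2 ∂μ := by
    intro a b
    have h0 : 0 ≤ ∫ r, (a * k (s, r) + b * x r) ^ 2 ∂μ := integral_nonneg fun r => sq_nonneg _
    have h1 : (fun r => (a * k (s, r) + b * x r) ^ 2)
        = fun r => (a ^ 2 * k (s, r) ^ 2 + 2 * a * b * (k (s, r) * x r)) + b ^ 2 * x r ^ 2 := by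
      funext r; ring
    have i1 : Integrable (fun r => a ^ 2 * k (s, r) ^ 2 + 2 * a * b * (k (s, r) * x r)) μ :=
      (hsi.const_mul _).add (hp.const_mul _)
    rw [h1, integral_add i1 (hxi.const_mul _),
      integral_add (hsi.const_mul _) (hp.const_mul _), integral_const_mul, integral_const_mul,
      integral_const_mul] at h0
    exact h0
  rw [Real.norm_of_nonneg (sq_nonneg _)]
  set A := ∫ r, k (s, r) ^ 2 ∂μ
  set B := ∫ r, x r ^ 2 ∂μ
  set c := ∫ r, k (s, r) * x r ∂μ
  rcases hB.eq_or_lt with h | h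
  · rw [← h]
    by_contra! hc
    have hc' : c ^ 2 ≠ 0 := by intro h'; rw [h'] at hc; simp at hc
    have h3 := key 1 (-(A + 1) / (2 * c))
    have hc0 : c ≠ 0 := by intro h'; apply hc'; rw [h']; ring
    rw [← h] at h3
    have h4 : 2 * 1 * (-(A + 1) / (2 * c)) * c = -(A + 1) := by field_simp
    rw [h4] at h3
    linarith
  · have h3 := key B (-c)
    have h4 : 0 ≤ B * (A * B - c ^ 2) := by nlinarith
    have := nonneg_of_mul_nonneg_right h4 h
    linarith

/-- The integral operator `x ↦ ∫ k(·, r) x(r) dμ(r)` on `L²(μ)` with kernel `k ∈ L²(μ ⊗ μ)`. -/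
def integralOperator (k : L2 (μ.prod μ)) : L2 μ →ₗ[ℝ] L2 μ where
  toFun x := (memLp_integralOperator k x).toLp _
  map_add' x y := by
    rw [← MemLp.toLp_add]
    refine MemLp.toLp_congr _ _ ?_
    filter_upwards [ae_integrable_slice_mul k x, ae_integrable_slice_mul k y] with s h1 h2
    rw [Pi.add_apply, ← integral_add h1 h2]
    refine integral_congr_ae ?_
    filter_upwards [Lp.coeFn_add x y] with r hr
    rw [hr, Pi.add_apply, mul_add]
  map_smul' c x := by
    rw [RingHom.id_apply, ← MemLp.toLp_const_smul]
    refine MemLp.toLp_congr _ _ (Eventually.of_forall fun s => ?_)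
    rw [Pi.smul_apply, smul_eq_mul, ← integral_const_mul]
    refine integral_congr_ae ?_
    filter_upwards [Lp.coeFn_smul c x] with r hr
    rw [hr, Pi.smul_apply, smul_eq_mul]
    ring

end Kernels

/-- The `j`-th largest eigenvalue (`j ≥ 1`), counted with multiplicity: the supremum of the
levels `a` such that the eigenvalues `≥ a` have total multiplicity at least `j`. For a compact
self-adjoint operator on an infinite-dimensional space, the positive eigenvalues come first, in
decreasing order, followed by zeros if there are finitely many of them. -/
def eigenvalue {H : Type*} [AddCommGroup H] [Module ℝ H] (A : H →ₗ[ℝ] H) (j : ℕ) : ℝ :=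
  sSup {a : ℝ | (j : Cardinal) ≤
    Module.rank ℝ (⨆ l ∈ Set.Ici a, Module.End.eigenspace A l : Submodule ℝ H)}

/-! ### Local stationarity and `L^p`-`m`-approximability -/

section Processes

variable {Ω H S : Type*} [MeasurableSpace Ω] [NormedAddCommGroup H] [NormedSpace ℝ H]
  [MeasurableSpace H] [MeasurableSpace S]

/-- Strict stationarity: the law of the whole process is invariant under time shifts. -/
def StrictlyStationary (P : Measure Ω) (Y : ℤ → Ω → H) : Prop :=
  ∀ k : ℤ, IdentDistrib (fun ω (t : ℤ) => Y (t + k) ω) (fun ω (t : ℤ) => Y t ω) P P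

/-- The triangular array `X T t`, `1 ≤ t ≤ T`, in `L^p_H` is locally stationary, with associated
stationary processes `Xs u`, `u ∈ [0,1]`, in `L^p_H` and with moment exponent `ρ`. -/
structure IsLocallyStationary (P : Measure Ω) (p : ℝ≥0∞) (ρ : ℝ)
    (X : ℕ → ℕ → Ω → H) (Xs : ℝ → ℤ → Ω → H) : Prop where
  memLp_array : ∀ T t : ℕ, 1 ≤ t → t ≤ T → MemLp (X T t) p P
  memLp_stationary : ∀ u ∈ Set.Icc (0 : ℝ) 1, ∀ t : ℤ, MemLp (Xs u t) p P
  stationary : ∀ u ∈ Set.Icc (0 : ℝ) 1, StrictlyStationary P (Xs u)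
  approx : ∃ (U : ℝ → ℕ → ℕ → Ω → ℝ) (C : ℝ), ∀ u ∈ Set.Icc (0 : ℝ) 1, ∀ T t : ℕ, 1 ≤ t → t ≤ T →
    (∀ ω, 0 < U u T t ω) ∧ AEStronglyMeasurable (U u T t) P ∧
    Integrable (fun ω => U u T t ω ^ ρ) P ∧ ∫ ω, U u T t ω ^ ρ ∂P < C ∧
    ∀ᵐ ω ∂P, ‖X T t ω - Xs u (t : ℤ) ω‖ ≤ (|(t : ℝ) / T - u| + 1 / T) * U u T t ω

/-- `v_p(Y_t - Y_{m,t})` for `Y_t = f(ε_t, ε_{t-1}, …)` and its approximation `Y_{m,t}`, in which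
`ε_{t-m}, ε_{t-m-1}, …` are replaced by an independent copy. The copy is realized on the second
factor of the product space `Ω × Ω`. -/
def couplingError (P : Measure Ω) (p : ℝ≥0∞) (ε : ℤ → Ω → S) (f : (ℕ → S) → H)
    (t : ℤ) (m : ℕ) : ℝ≥0∞ :=
  eLpNorm (fun z : Ω × Ω => f (fun k : ℕ => ε (t - k) z.1)
    - f (fun k : ℕ => if k < m then ε (t - k) z.1 else ε (t - k) z.2)) p (P.prod P)

/-- `Y` is `L^p`-`m`-approximable, with i.i.d. innovations `ε` and representing function `f`. -/
structure IsLpMApproximable (P : Measure Ω) (p : ℝ≥0∞) (ε : ℤ → Ω → S) (f : (ℕ → S) → H)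
    (Y : ℤ → Ω → H) : Prop where
  measurable_innov : ∀ j, Measurable (ε j)
  indep_innov : iIndepFun ε P
  identDistrib_innov : ∀ j, IdentDistrib (ε j) (ε 0) P P
  measurable_repr : StronglyMeasurable f
  memLp : ∀ t, MemLp (Y t) p P
  repr : ∀ t, ∀ᵐ ω ∂P, Y t ω = f (fun k : ℕ => ε (t - k) ω)
  summable : ∀ t, ∑' m : ℕ, couplingError P p ε f t (m + 1) < ∞

/-- The moment, local stationarity and dependence assumption on a zero-mean functional time series
`X` in `L⁴_H`, with exponent `ρ` and associated stationary processes
`Xs u t = f u (ε_t, ε_{t-1}, …)`. -/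
structure ProcessAssumption (P : Measure Ω) (ρ : ℝ) (ε : ℤ → Ω → S) (f : ℝ → (ℕ → S) → H)
    (X : ℕ → ℕ → Ω → H) (Xs : ℝ → ℤ → Ω → H) : Prop where
  locallyStationary : IsLocallyStationary P 4 ρ X Xs
  approximable : ∀ u ∈ Set.Icc (0 : ℝ) 1, IsLpMApproximable P 4 ε (f u) (Xs u)
  mean_zero : ∀ u ∈ Set.Icc (0 : ℝ) 1, ∀ t : ℤ, ∫ ω, Xs u t ω ∂P = 0

end Processes

/-! ### Kernels, bandwidths, means -/

/-- Assumption on the kernel used for localization in time. -/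
structure IsLocalizationKernel (K : ℝ → ℝ) : Prop where
  symm : ∀ z, K (-z) = K z
  bounded : ∃ M : ℝ, ∀ z, |K z| ≤ M
  compactSupport : ∃ C : ℝ, ∀ z, C < |z| → K z = 0
  integral_eq_one : ∫ z, K z = 1
  lipschitz : ∃ L : ℝ, ∀ y z, |K y - K z| ≤ L * |y - z|

/-- Assumption on the kernel used for weighting the lags. -/
structure IsLagKernel (K : ℝ → ℝ) : Prop where
  bounded : ∃ M : ℝ, ∀ z, |K z| ≤ M
  compactSupport : ∃ C : ℝ, 0 < C ∧ ∀ z, C < |z| → K z = 0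
  apply_zero : K 0 = 1
  continuousAt_zero : ContinuousAt K 0

/-- `min {T h, 1 / (T h³), b, T h / b} → ∞` along a sequence of sample sizes `T n`, with positive
bandwidths `h n` and `b n`. -/
structure BandwidthCondition (T : ℕ → ℕ) (h b : ℕ → ℝ) : Prop where
  h_pos : ∀ n, 0 < h n
  b_pos : ∀ n, 0 < b n
  tendsto_min : Tendsto (fun n => min (min ((T n : ℝ) * h n) (1 / ((T n : ℝ) * h n ^ 3)))
    (min (b n) ((T n : ℝ) * h n / b n))) atTop atTop

/-- Lipschitz continuity on `[0,1]` of a time-varying mean function. -/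
def LipschitzMean {H : Type*} [NormedAddCommGroup H] (m : ℝ → H) : Prop :=
  ∃ C : ℝ, 0 < C ∧ ∀ u ∈ Set.Icc (0 : ℝ) 1, ∀ v ∈ Set.Icc (0 : ℝ) 1, ‖m v - m u‖ ≤ C * |u - v|

/-! ### Long-run covariance kernels and their estimators -/

section LongRun

variable {α : Type*} [MeasurableSpace α] {μ : Measure α} [SFinite μ]

/-- `c(s₁,s₂) = E[Y₀(s₁)Y₀(s₂)] + ∑_{t ≥ 1} E[Y₀(s₁)Y_t(s₂)] + ∑_{t ≥ 1} E[Y₀(s₂)Y_t(s₁)]`, with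
expectations and series taken in `L²(μ ⊗ μ)`. -/
def longRunKernel {Ω : Type*} [MeasurableSpace Ω] (P : Measure Ω) (Y : ℤ → Ω → L2 μ) :
    L2 (μ.prod μ) :=
  (∫ ω, tensor (Y 0 ω) (Y 0 ω) ∂P)
    + (∑' t : ℕ, ∫ ω, tensor (Y 0 ω) (Y ((t : ℤ) + 1) ω) ∂P)
    + ∑' t : ℕ, transposeKernel (∫ ω, tensor (Y 0 ω) (Y ((t : ℤ) + 1) ω) ∂P)

/-- `(T h)⁻¹ ∑_{t=1}^T K₁((u - t/T)/h) x_t`. -/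
def localMean (K₁ : ℝ → ℝ) (h u : ℝ) (T : ℕ) (x : ℕ → L2 μ) : L2 μ :=
  (1 / ((T : ℝ) * h)) • ∑ t ∈ Finset.Icc 1 T, K₁ ((u - (t : ℝ) / T) / h) • x t

/-- The local lag-`t` autocovariance kernel estimator
`(T h)⁻¹ ∑_{j=t+1}^T K₁((u - j/T)/h) (x_j(s₁) - x̄(s₁)) (x_{j-t}(s₂) - x̄(s₂))`. -/
def gammaHat (K₁ : ℝ → ℝ) (h u : ℝ) (T : ℕ) (x : ℕ → L2 μ) (t : ℕ) : L2 (μ.prod μ) :=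
  (1 / ((T : ℝ) * h)) • ∑ j ∈ Finset.Icc (t + 1) T, K₁ ((u - (j : ℝ) / T) / h) •
    tensor (x j - localMean K₁ h u T x) (x (j - t) - localMean K₁ h u T x)

/-- The long-run local covariance kernel estimator computed from a sample `x_1, …, x_T`. -/
def longRunEstimator (K₁ K₂ : ℝ → ℝ) (h b u : ℝ) (T : ℕ) (x : ℕ → L2 μ) : L2 (μ.prod μ) :=
  gammaHat K₁ h u T x 0 + ∑ t ∈ Finset.Icc 1 (T - 1), K₂ ((t : ℝ) / b) •
    (gammaHat K₁ h u T x t + transposeKernel (gammaHat K₁ h u T x t))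

/-- The pooled kernel `(1 - θ) c₁ + θ c₂`. -/
def pooledKernel (θ : ℝ) (c₁ c₂ : L2 (μ.prod μ)) : L2 (μ.prod μ) := (1 - θ) • c₁ + θ • c₂

end LongRun

/-! ### The eigenvalue-ratio estimator -/

/-- Division with the convention `0 / 0 = 1`. -/
def ratio (a b : ℝ) : ℝ := if a = 0 ∧ b = 0 then 1 else a / b

/-- The normalized value `η j / η 1`, set to zero if it is smaller than `ε₀` in absolute value. -/
def normalizedEigenvalue (ε₀ : ℝ) (η : ℕ → ℝ) (j : ℕ) : ℝ :=
  if |ratio (η j) (η 1)| < ε₀ then 0 else ratio (η j) (η 1)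

/-- The ratio of the consecutive (thresholded) eigenvalues `j + 1` and `j`. -/
def eigenvalueRatio (ε₀ : ℝ) (η : ℕ → ℝ) (j : ℕ) : ℝ :=
  ratio (normalizedEigenvalue ε₀ η (j + 1)) (normalizedEigenvalue ε₀ η j)

/-- `q` is a minimizer over `1 ≤ j ≤ qbar` of the thresholded eigenvalue ratio. -/
def IsRatioEstimate (ε₀ : ℝ) (qbar : ℕ) (η : ℕ → ℝ) (q : ℕ) : Prop :=
  q ∈ Finset.Icc 1 qbar ∧
    ∀ j ∈ Finset.Icc 1 qbar, eigenvalueRatio ε₀ η q ≤ eigenvalueRatio ε₀ η j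

end LSFTS

end

set_option linter.unusedSectionVars false

/-! Stability of the estimator is a deterministic matter. Weyl's inequality moves the positive part
of each eigenvalue by at most the operator norm of the perturbation, which the L² norm of the kernel
dominates. The estimated operator has finite rank; on an infinite-dimensional space its kernel then
supplies the eigenvalue 0 with infinite multiplicity, so none of its ordered eigenvalues is
negative. If the estimated kernel is close enough to the true one, the first q₀ eigenvalues
therefore pass the threshold and the later ones are set to zero. The ratio vanishes at q₀, is
positive before it, and equals 0/0 = 1 after it, so q₀ is the only minimizer
(`IsRatioEstimate.eq_of_separated`, `exists_perturbation_radius`). What remains is convergence in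
probability of the estimated kernel (`tendstoInMeasure_longRunEstimator`).

The one-sided part of the estimator is a quadratic form ∑ κ_j λ_{j-i} z_j ⊗ z_i in the locally
centered sample z. On the window of times that enter it, z differs in L⁴ from the stationary process
at u by at most a multiple of ρ = h + (Th)^(-1/2) (`exists_norm_centeredLp_sub_le`). Substitution
leaves the quadratic form of the stationary process and three error terms, of order √b ρ and b ρ².
They vanish because b h² is the product of b/(Th) and Th³.

For the stationary process, the mean of the form converges by dominated convergence over the lags,
the autocovariances being summable. The fluctuation is handled by a martingale expansion v_j = ∑_k
a_{k,j}, where a_{k,j} is the difference of the conditional expectations of v_j given the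
innovations from j-k on and from j-k+1 on. For fixed k these are reverse martingale differences in
j, and their L⁴ norms are bounded by summable coupling errors. In a product of a_{k,j} and a_{l,i},
compare the times j-k and i-l of the oldest innovations. If they differ, the sum is a martingale
transform with L² norm of order α_k α_l √∑A², which is of order √(b/(Th)) relative to α_k α_l. If
they agree, then i = j-k+l and the centered products are finitely dependent, hence small for fixed
(k, l), and uniformly bounded by a multiple of α_k α_l. Dominated convergence over (k, l) gives
`MartingaleExpansion.tendsto_center_quadForm`, and `MartingaleExpansion.tendsto_norm_quadForm_sub`
assembles mean, fluctuation and errors. -/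

noncomputable section

namespace LSFTS

/-! ### Tensor kernels, transposition and integral operators as bounded maps. -/

section KernelLemmas

variable {α : Type*} [MeasurableSpace α] {μ : Measure α}

lemma coeFn_tensor (x y : L2 μ) :
    tensor x y =ᵐ[μ.prod μ] fun s : α × α => x s.1 * y s.2 :=
  MemLp.coeFn_toLp _

variable [SFinite μ]

lemma inner_tensor_tensor (x y x' y' : L2 μ) :
    inner ℝ (tensor x y) (tensor x' y') = inner ℝ x x' * inner ℝ y y' := by
  rw [L2.inner_def, L2.inner_def, L2.inner_def, ← integral_prod_mul]
  refine integral_congr_ae ?_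
  filter_upwards [coeFn_tensor x y, coeFn_tensor x' y'] with s h1 h2
  rw [h1, h2]
  simp only [Real.inner_apply]
  ring

lemma norm_tensor (x y : L2 μ) : ‖tensor x y‖ = ‖x‖ * ‖y‖ := by
  have h : ‖tensor x y‖ ^ 2 = (‖x‖ * ‖y‖) ^ 2 := by
    rw [← real_inner_self_eq_norm_sq, inner_tensor_tensor, real_inner_self_eq_norm_sq,
      real_inner_self_eq_norm_sq, mul_pow]
  exact (pow_left_inj₀ (norm_nonneg _) (by positivity) two_ne_zero).1 h

/-- The tensor product of square-integrable functions as a continuous bilinear map. -/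
def tensorL (μ : Measure α) [SFinite μ] : L2 μ →L[ℝ] L2 μ →L[ℝ] L2 (μ.prod μ) :=
  LinearMap.mkContinuous₂ (LinearMap.mk₂ ℝ tensor
    (fun x x' y => by
      rw [tensor, tensor, tensor, ← MemLp.toLp_add]
      refine MemLp.toLp_congr _ _ ?_
      filter_upwards [Measure.quasiMeasurePreserving_fst.ae (Lp.coeFn_add x x')] with s hs
      simp only [hs, Pi.add_apply, add_mul])
    (fun c x y => by
      rw [tensor, tensor, ← MemLp.toLp_const_smul]
      refine MemLp.toLp_congr _ _ ?_
      filter_upwards [Measure.quasiMeasurePreserving_fst.ae (Lp.coeFn_smul c x)] with s hs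
      simp only [hs, Pi.smul_apply, smul_eq_mul, mul_assoc])
    (fun x y y' => by
      rw [tensor, tensor, tensor, ← MemLp.toLp_add]
      refine MemLp.toLp_congr _ _ ?_
      filter_upwards [Measure.quasiMeasurePreserving_snd.ae (Lp.coeFn_add y y')] with s hs
      simp only [hs, Pi.add_apply, mul_add])
    (fun c x y => by
      rw [tensor, tensor, ← MemLp.toLp_const_smul]
      refine MemLp.toLp_congr _ _ ?_
      filter_upwards [Measure.quasiMeasurePreserving_snd.ae (Lp.coeFn_smul c y)] with s hs
      simp only [hs, Pi.smul_apply, smul_eq_mul]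
      ring)) 1
    (fun x y => by rw [LinearMap.mk₂_apply, norm_tensor, one_mul])

@[simp] lemma tensorL_apply (x y : L2 μ) : tensorL μ x y = tensor x y := rfl

lemma norm_tensorL_le : ‖tensorL μ‖ ≤ 1 :=
  LinearMap.mkContinuous₂_norm_le _ zero_le_one _

lemma coeFn_transposeKernel (k : L2 (μ.prod μ)) :
    transposeKernel k =ᵐ[μ.prod μ] fun s => k s.swap :=
  Lp.coeFn_compMeasurePreserving k Measure.measurePreserving_swap

/-- Transposition of kernels as a linear isometry. -/
def transposeL (μ : Measure α) [SFinite μ] : L2 (μ.prod μ) →ₗᵢ[ℝ] L2 (μ.prod μ) :=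
  Lp.compMeasurePreservingₗᵢ ℝ Prod.swap Measure.measurePreserving_swap

@[simp] lemma transposeL_apply (k : L2 (μ.prod μ)) : transposeL μ k = transposeKernel k := rfl

@[simp] lemma transposeKernel_transposeKernel (k : L2 (μ.prod μ)) :
    transposeKernel (transposeKernel k) = k := by
  refine Lp.ext ?_
  filter_upwards [coeFn_transposeKernel (transposeKernel k),
    (Measure.measurePreserving_swap (μ := μ) (ν := μ)).quasiMeasurePreserving.ae
      (coeFn_transposeKernel k)] with s h1 h2
  rw [h1, h2, Prod.swap_swap]

@[simp] lemma transposeKernel_tensor (x y : L2 μ) :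
    transposeKernel (tensor x y) = tensor y x := by
  refine Lp.ext ?_
  filter_upwards [coeFn_transposeKernel (tensor x y), coeFn_tensor y x,
    (Measure.measurePreserving_swap (μ := μ) (ν := μ)).quasiMeasurePreserving.ae
      (coeFn_tensor x y)] with s h1 h2 h3
  rw [h1, h2, h3, Prod.fst_swap, Prod.snd_swap, mul_comm]

lemma inner_transposeKernel_left (k l : L2 (μ.prod μ)) :
    inner ℝ (transposeKernel k) l = inner ℝ k (transposeKernel l) := by
  have := (transposeL μ).inner_map_map k (transposeKernel l)
  rwa [transposeL_apply, transposeL_apply, transposeKernel_transposeKernel] at this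

/-- Fubini. This weak description determines the operator, so linearity in the kernel, symmetry, the
norm bound and the rank-one formula are all read off from it without pointwise arguments. -/
lemma inner_integralOperator (k : L2 (μ.prod μ)) (x y : L2 μ) :
    inner ℝ (integralOperator k x) y = inner ℝ k (tensor y x) := by
  rw [L2.inner_def, L2.inner_def, integral_prod]
  · refine integral_congr_ae ?_
    have h1 : integralOperator k x =ᵐ[μ] fun s => ∫ r, k (s, r) * x r ∂μ :=
      MemLp.coeFn_toLp (memLp_integralOperator k x)
    filter_upwards [h1, Measure.ae_ae_of_ae_prod (coeFn_tensor y x)] with s hs ht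
    rw [hs, Real.inner_apply, ← integral_mul_const]
    refine integral_congr_ae ?_
    filter_upwards [ht] with r hr
    rw [hr, Real.inner_apply]
    ring
  · exact L2.integrable_inner k (tensor y x)

/-- Cauchy–Schwarz in the weak description with the image itself as test function, followed by
cancelling one factor: the Hilbert–Schmidt norm dominates the operator norm. -/
lemma norm_integralOperator_le (k : L2 (μ.prod μ)) (x : L2 μ) :
    ‖integralOperator k x‖ ≤ ‖k‖ * ‖x‖ := by
  have h : ‖integralOperator k x‖ * ‖integralOperator k x‖
      ≤ ‖k‖ * ‖x‖ * ‖integralOperator k x‖ := by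
    rw [← real_inner_self_eq_norm_mul_norm, inner_integralOperator]
    refine (real_inner_le_norm _ _).trans_eq ?_
    rw [norm_tensor]
    ring
  rcases (norm_nonneg (integralOperator k x)).eq_or_lt with h0 | h0
  · rw [← h0]; positivity
  · exact le_of_mul_le_mul_right h h0

/-- The integral operator, as a continuous linear function of its kernel. -/
def integralOperatorL (μ : Measure α) [SFinite μ] : L2 (μ.prod μ) →L[ℝ] L2 μ →L[ℝ] L2 μ :=
  LinearMap.mkContinuous₂ (LinearMap.mk₂ ℝ (fun k x => integralOperator k x)
    (fun k k' x => ext_inner_right ℝ fun y => by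
      simp only [inner_add_left, inner_integralOperator])
    (fun c k x => ext_inner_right ℝ fun y => by
      simp only [real_inner_smul_left, inner_integralOperator])
    (fun k x y => map_add _ _ _)
    (fun c k x => map_smul _ _ _)) 1
    (fun k x => by
      rw [LinearMap.mk₂_apply, one_mul]
      exact norm_integralOperator_le k x)

lemma integralOperatorL_apply (k : L2 (μ.prod μ)) (x : L2 μ) :
    integralOperatorL μ k x = integralOperator k x := rfl

lemma isSymmetric_integralOperator {k : L2 (μ.prod μ)} (hk : transposeKernel k = k) :
    (integralOperator k).IsSymmetric := by
  intro x y
  rw [inner_integralOperator, real_inner_comm (integralOperator k y) x, inner_integralOperator,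
    ← transposeKernel_tensor, ← inner_transposeKernel_left, hk]

lemma integralOperator_tensor_apply (a b x : L2 μ) :
    integralOperator (tensor a b) x = inner ℝ b x • a := by
  refine ext_inner_right ℝ fun y => ?_
  rw [inner_integralOperator, inner_tensor_tensor, real_inner_smul_left, mul_comm]

/-- The kernels whose integral operator is compact. -/
def compactKernels (μ : Measure α) [SFinite μ] : Submodule ℝ (L2 (μ.prod μ)) :=
  (compactOperator (RingHom.id ℝ) (L2 μ) (L2 μ)).comap (integralOperatorL μ).toLinearMap

lemma mem_compactKernels {k : L2 (μ.prod μ)} :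
    k ∈ compactKernels μ ↔ IsCompactOperator (integralOperatorL μ k) := Iff.rfl

/-- Norm limits of compact operators are compact. Closedness is what lets Bochner integrals and
infinite series of rank-one kernels stay in this subspace. -/
lemma isClosed_compactKernels : IsClosed (compactKernels μ : Set (L2 (μ.prod μ))) :=
  isClosed_setOfPred_isCompactOperator.preimage (integralOperatorL μ).continuous

/-- The kernels whose integral operator has finite rank. -/
def finiteRankKernels (μ : Measure α) [SFinite μ] : Submodule ℝ (L2 (μ.prod μ)) where
  carrier := {k | FiniteDimensional ℝ (LinearMap.range (integralOperator k))}
  add_mem' {k l} hk hl := by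
    have hk' : FiniteDimensional ℝ (LinearMap.range (integralOperator k)) := hk
    have hl' : FiniteDimensional ℝ (LinearMap.range (integralOperator l)) := hl
    refine Submodule.finiteDimensional_of_le (S₂ := LinearMap.range (integralOperator k) ⊔
      LinearMap.range (integralOperator l)) ?_
    rintro _ ⟨x, rfl⟩
    have : integralOperator (k + l) x = integralOperator k x + integralOperator l x := by
      simp only [← integralOperatorL_apply, map_add, _root_.add_apply]
    rw [this]
    exact Submodule.add_mem_sup ⟨x, rfl⟩ ⟨x, rfl⟩
  zero_mem' := by
    refine Submodule.finiteDimensional_of_le (S₂ := ⊥) ?_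
    rintro _ ⟨x, rfl⟩
    simp only [← integralOperatorL_apply, map_zero, _root_.zero_apply,
      Submodule.zero_mem]
  smul_mem' c k hk := by
    have hk' : FiniteDimensional ℝ (LinearMap.range (integralOperator k)) := hk
    refine Submodule.finiteDimensional_of_le (S₂ := LinearMap.range (integralOperator k)) ?_
    rintro _ ⟨x, rfl⟩
    have : integralOperator (c • k) x = integralOperator k (c • x) := by
      simp only [← integralOperatorL_apply, map_smul, _root_.smul_apply]
    rw [this]
    exact ⟨_, rfl⟩

lemma tensor_mem_finiteRankKernels (a b : L2 μ) : tensor a b ∈ finiteRankKernels μ := by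
  refine Submodule.finiteDimensional_of_le (S₂ := Submodule.span ℝ {a}) ?_
  rintro _ ⟨x, rfl⟩
  rw [integralOperator_tensor_apply]
  exact Submodule.smul_mem _ _ (Submodule.mem_span_singleton_self a)

/-- The operator factors through its range, and bounded sets in a finite-dimensional space are
relatively compact. -/
lemma finiteRankKernels_le_compactKernels : finiteRankKernels μ ≤ compactKernels μ := by
  intro k hk
  have hk' : FiniteDimensional ℝ (LinearMap.range (integralOperator k)) := hk
  rw [mem_compactKernels]
  let g : L2 μ →L[ℝ] LinearMap.range (integralOperator k) :=
    (integralOperatorL μ k).codRestrict _ fun x => ⟨x, rfl⟩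
  have hg : IsCompactOperator g := by
    refine ⟨g '' Metric.closedBall 0 1 |> closure, ?_, ?_⟩
    · exact (g.lipschitz.isBounded_image Metric.isBounded_closedBall).isCompact_closure
    · exact mem_of_superset (Metric.closedBall_mem_nhds _ one_pos)
        (fun x hx => subset_closure ⟨x, hx, rfl⟩)
  exact hg.clm_comp (LinearMap.range (integralOperator k)).subtypeL

end KernelLemmas

/-! ### Eigenvalues of compact symmetric operators: Courant–Fischer and Weyl. -/

section Eigenvalues

variable {H : Type*} [NormedAddCommGroup H] [InnerProductSpace ℝ H]

/-- The span of the eigenvectors of `A` with eigenvalues in `S`. -/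
def spectralSpan (A : H →ₗ[ℝ] H) (S : Set ℝ) : Submodule ℝ H :=
  ⨆ l ∈ S, Module.End.eigenspace A l

lemma eigenspace_le_spectralSpan (A : H →ₗ[ℝ] H) {S : Set ℝ} {l : ℝ} (hl : l ∈ S) :
    Module.End.eigenspace A l ≤ spectralSpan A S :=
  le_biSup (fun l => Module.End.eigenspace A l) hl

/-- Eigenspaces of a symmetric operator are orthogonal, so Pythagoras applies to the finite
eigenvector decomposition of `x`; `c l` is the squared norm of the component in the eigenspace of
`l`. -/
lemma exists_sum_of_mem_spectralSpan {A : H →ₗ[ℝ] H} (hA : A.IsSymmetric) {S : Set ℝ} {x : H}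
    (hx : x ∈ spectralSpan A S) :
    ∃ (s : Finset S) (c : S → ℝ), (∀ l, 0 ≤ c l) ∧ ‖x‖ ^ 2 = ∑ l ∈ s, c l ∧
      inner ℝ (A x) x = ∑ l ∈ s, (l : ℝ) * c l := by
  classical
  rw [spectralSpan, iSup_subtype', Submodule.mem_iSup_iff_exists_dfinsupp'] at hx
  obtain ⟨f, rfl⟩ := hx
  have hO : OrthogonalFamily ℝ (fun l : S => Module.End.eigenspace A (l : ℝ))
      (fun l => (Module.End.eigenspace A (l : ℝ)).subtypeₗᵢ) :=
    hA.orthogonalFamily_eigenspaces.comp Subtype.val_injective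
  refine ⟨f.support, fun l => ‖f l‖ ^ 2, fun l => by positivity, ?_, ?_⟩
  · exact hO.norm_sum (fun l => f l) f.support
  · have h1 : A (f.sum fun i xi => (xi : H))
        = ∑ l ∈ f.support, (((l : ℝ) • f l : Module.End.eigenspace A (l : ℝ)) : H) := by
      rw [DFinsupp.sum, map_sum]
      refine Finset.sum_congr rfl fun l _ => ?_
      exact Module.End.mem_eigenspace_iff.1 (f l).2
    rw [h1, DFinsupp.sum]
    refine (hO.inner_sum (fun l => (l : ℝ) • f l) (fun l => f l) f.support).trans ?_
    refine Finset.sum_congr rfl fun l _ => ?_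
    rw [real_inner_smul_left, real_inner_self_eq_norm_sq]

lemma le_inner_of_mem_spectralSpan {A : H →ₗ[ℝ] H} (hA : A.IsSymmetric) {S : Set ℝ} {a : ℝ}
    (hS : ∀ l ∈ S, a ≤ l) {x : H} (hx : x ∈ spectralSpan A S) :
    a * ‖x‖ ^ 2 ≤ inner ℝ (A x) x := by
  obtain ⟨s, c, hc, h1, h2⟩ := exists_sum_of_mem_spectralSpan hA hx
  rw [h1, h2, Finset.mul_sum]
  exact Finset.sum_le_sum fun l _ => mul_le_mul_of_nonneg_right (hS l l.2) (hc l)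

lemma inner_le_of_mem_spectralSpan {A : H →ₗ[ℝ] H} (hA : A.IsSymmetric) {S : Set ℝ} {a : ℝ}
    (hS : ∀ l ∈ S, l ≤ a) {x : H} (hx : x ∈ spectralSpan A S) :
    inner ℝ (A x) x ≤ a * ‖x‖ ^ 2 := by
  obtain ⟨s, c, hc, h1, h2⟩ := exists_sum_of_mem_spectralSpan hA hx
  rw [h1, h2, Finset.mul_sum]
  exact Finset.sum_le_sum fun l _ => mul_le_mul_of_nonneg_right (hS l l.2) (hc l)

lemma inner_eq_zero_of_mem_spectralSpan {A : H →ₗ[ℝ] H} (hA : A.IsSymmetric) {S S' : Set ℝ}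
    (hSS : Disjoint S S') {x y : H} (hx : x ∈ spectralSpan A S) (hy : y ∈ spectralSpan A S') :
    inner ℝ x y = 0 := by
  have h1 : spectralSpan A S ⟂ spectralSpan A S' := by
    rw [spectralSpan, spectralSpan]
    simp only [Submodule.isOrtho_iSup_left, Submodule.isOrtho_iSup_right]
    intro l hl l' hl'
    refine hA.orthogonalFamily_eigenspaces.isOrtho fun h => ?_
    subst h
    exact Set.disjoint_left.1 hSS (by assumption) (by assumption)
  exact Submodule.isOrtho_iff_inner_eq.1 h1 x hx y hy

/-- By the spectral theorem the two spectral spans, for levels below `a` and from `a` on, have no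
common orthogonal vector. Hence the complement of the second lies in the closure of the first, to
which the bound on the quadratic form extends by continuity. -/
lemma inner_le_of_mem_orthogonal [CompleteSpace H] {A : H →L[ℝ] H} (hc : IsCompactOperator A)
    (hA : (A : H →ₗ[ℝ] H).IsSymmetric) {a : ℝ} {x : H}
    (hx : x ∈ (spectralSpan (A : H →ₗ[ℝ] H) (Set.Ici a))ᗮ) :
    inner ℝ (A x) x ≤ a * ‖x‖ ^ 2 := by
  set E := spectralSpan (A : H →ₗ[ℝ] H) (Set.Iio a)
  set W := spectralSpan (A : H →ₗ[ℝ] H) (Set.Ici a)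
  have hdisj : Disjoint (Set.Ici a) (Set.Iio a) :=
    Set.disjoint_left.2 fun l h1 h2 => not_lt.2 (Set.mem_Ici.1 h1) h2
  have hbot : Eᗮ ⊓ Wᗮ = ⊥ := by
    rw [Submodule.inf_orthogonal, eq_bot_iff,
      ← A.orthogonalComplement_iSup_eigenspaces_eq_bot hc hA]
    refine Submodule.orthogonal_le (iSup_le fun l => ?_)
    rcases lt_or_ge l a with h | h
    · exact (eigenspace_le_spectralSpan _ (S := Set.Iio a) h).trans le_sup_left
    · exact (eigenspace_le_spectralSpan _ (S := Set.Ici a) h).trans le_sup_right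
  have hEW : E ≤ Wᗮ := fun y hy => (Submodule.mem_orthogonal _ _).2 fun z hz =>
    inner_eq_zero_of_mem_spectralSpan hA hdisj hz hy
  have hxE : x ∈ E.topologicalClosure := by
    obtain ⟨p, hp, q, hq, rfl⟩ :=
      E.topologicalClosure.exists_add_mem_mem_orthogonal x
    have hpW : p ∈ Wᗮ :=
      Submodule.topologicalClosure_minimal _ hEW (Submodule.isClosed_orthogonal W) hp
    have hqW : q ∈ Wᗮ := by simpa using Wᗮ.sub_mem hx hpW
    have hqE : q ∈ Eᗮ := Submodule.orthogonal_le E.le_topologicalClosure hq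
    have : q = 0 := by
      have h := Submodule.mem_inf.2 ⟨hqE, hqW⟩
      rwa [hbot, Submodule.mem_bot] at h
    simpa [this] using hp
  have hcl : IsClosed {y : H | inner ℝ (A y) y ≤ a * ‖y‖ ^ 2} :=
    isClosed_le (A.continuous.inner continuous_id) (by fun_prop)
  have hsub : (E : Set H) ⊆ {y : H | inner ℝ (A y) y ≤ a * ‖y‖ ^ 2} := fun y hy =>
    inner_le_of_mem_spectralSpan hA (fun l hl => le_of_lt hl) hy
  exact closure_minimal hsub hcl hxE

/-- Courant–Fischer: a `j`-dimensional subspace on which the quadratic form of `A` is at least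
`b > a` forces the eigenvalues `≥ a` to have total multiplicity at least `j`. -/
lemma le_rank_spectralSpan [CompleteSpace H] {A : H →L[ℝ] H} (hc : IsCompactOperator A)
    (hA : (A : H →ₗ[ℝ] H).IsSymmetric) {a b : ℝ} (hab : a < b) {j : ℕ} {V : Submodule ℝ H}
    (hV : (j : Cardinal) ≤ Module.rank ℝ V) (hVA : ∀ x ∈ V, b * ‖x‖ ^ 2 ≤ inner ℝ (A x) x) :
    (j : Cardinal) ≤ Module.rank ℝ (spectralSpan (A : H →ₗ[ℝ] H) (Set.Ici a)) := by
  set W := spectralSpan (A : H →ₗ[ℝ] H) (Set.Ici a)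
  by_contra! hlt
  have hfin : FiniteDimensional ℝ W :=
    Module.rank_lt_aleph0_iff.1 (hlt.trans (Cardinal.natCast_lt_aleph0))
  -- A dimension count: `V` is too large to project injectively into `W`. A nonzero vector of `V`
  -- orthogonal to `W` then has quadratic form both at least `b` and at most `a` times its squared
  -- norm.
  have hp : ¬ Function.Injective (W.orthogonalProjectionOnto.toLinearMap ∘ₗ V.subtype) := by
    intro hinj
    exact absurd (hV.trans (LinearMap.rank_le_of_injective _ hinj)) (not_le.2 hlt)
  rw [← LinearMap.ker_eq_bot, Submodule.eq_bot_iff] at hp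
  push Not at hp
  obtain ⟨⟨x, hxV⟩, hx, hx0⟩ := hp
  have hxW : x ∈ Wᗮ := by
    rw [LinearMap.mem_ker] at hx
    exact Submodule.orthogonalProjectionOnto_eq_zero_iff.1 hx
  have hx0' : x ≠ 0 := fun h => hx0 (by simpa using h)
  have h1 := (hVA x hxV).trans (inner_le_of_mem_orthogonal hc hA hxW)
  have h2 : 0 < ‖x‖ ^ 2 := by positivity
  nlinarith

/-- The real supremum of an unbounded set defaults to zero, so this bound is what gives `eigenvalue`
its meaning. For `j = 0` every level qualifies and the bound fails. -/
lemma bddAbove_eigenvalue_levels {A : H →L[ℝ] H} (hA : (A : H →ₗ[ℝ] H).IsSymmetric) {j : ℕ}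
    (hj : 1 ≤ j) :
    BddAbove {a : ℝ | (j : Cardinal) ≤
      Module.rank ℝ (spectralSpan (A : H →ₗ[ℝ] H) (Set.Ici a))} := by
  refine ⟨‖A‖, fun a ha => ?_⟩
  have hpos : 0 < Module.rank ℝ (spectralSpan (A : H →ₗ[ℝ] H) (Set.Ici a)) :=
    lt_of_lt_of_le (Nat.cast_pos.2 hj) ha
  rw [rank_pos_iff_exists_ne_zero] at hpos
  obtain ⟨⟨x, hx⟩, hx0⟩ := hpos
  have hx0' : x ≠ 0 := fun h => hx0 (by simpa using h)
  have h1 := le_inner_of_mem_spectralSpan hA (fun l hl => hl) hx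
  have h2 : inner ℝ (A x) x ≤ ‖A‖ * ‖x‖ ^ 2 := by
    refine (real_inner_le_norm _ _).trans ?_
    rw [pow_two, ← mul_assoc]
    exact mul_le_mul_of_nonneg_right (A.le_opNorm x) (norm_nonneg _)
  have h3 : 0 < ‖x‖ ^ 2 := by positivity
  exact le_of_mul_le_mul_right (h1.trans h2) h3

lemma le_eigenvalue {A : H →L[ℝ] H} (hA : (A : H →ₗ[ℝ] H).IsSymmetric) {j : ℕ} (hj : 1 ≤ j)
    {a : ℝ} (ha : (j : Cardinal) ≤ Module.rank ℝ (spectralSpan (A : H →ₗ[ℝ] H) (Set.Ici a))) :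
    a ≤ eigenvalue (A : H →ₗ[ℝ] H) j :=
  le_csSup (bddAbove_eigenvalue_levels hA hj) ha

/-- Weyl's perturbation inequality, for the positive parts of eigenvalues. -/
lemma eigenvalue_le_add [CompleteSpace H] {A B : H →L[ℝ] H} (hc : IsCompactOperator A)
    (hA : (A : H →ₗ[ℝ] H).IsSymmetric) (hB : (B : H →ₗ[ℝ] H).IsSymmetric) {j : ℕ} (hj : 1 ≤ j) :
    eigenvalue (B : H →ₗ[ℝ] H) j ≤ max (eigenvalue (A : H →ₗ[ℝ] H) j) 0 + ‖B - A‖ := by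
  -- The bound must be nonnegative, since the set of levels of `B` may be empty with supremum 0 by
  -- default; the maximum with 0 provides this.
  refine Real.sSup_le (fun a ha => ?_) (by positivity)
  by_contra! hlt
  -- On the span of the eigenvectors of `B` with eigenvalue at least `a`, the form of `A` is at
  -- least `a - ‖B - A‖`. Any `c` strictly below this is a level of `A`, and it can be chosen above
  -- the claimed bound for those levels.
  obtain ⟨c, hc1, hc2⟩ := exists_between (lt_sub_iff_add_lt.2 hlt)
  have h1 : (j : Cardinal) ≤ Module.rank ℝ (spectralSpan (A : H →ₗ[ℝ] H) (Set.Ici c)) := by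
    refine le_rank_spectralSpan hc hA hc2 (V := spectralSpan (B : H →ₗ[ℝ] H) (Set.Ici a)) ha
      fun x hx => ?_
    have h1 := le_inner_of_mem_spectralSpan hB (fun l hl => hl) hx
    have h2 : inner ℝ ((B - A) x) x ≤ ‖B - A‖ * ‖x‖ ^ 2 := by
      refine (real_inner_le_norm _ _).trans ?_
      rw [pow_two, ← mul_assoc]
      exact mul_le_mul_of_nonneg_right ((B - A).le_opNorm x) (norm_nonneg _)
    rw [_root_.sub_apply, inner_sub_left] at h2
    simp only [ContinuousLinearMap.coe_coe] at h1
    nlinarith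
  exact absurd ((le_eigenvalue hA hj h1).trans (le_max_left _ 0)) (not_le.2 hc1)

/-- Rank–nullity: the null space is infinite-dimensional, so 0 is a level of every multiplicity. -/
lemma eigenvalue_nonneg_of_finiteDimensional_range {A : H →L[ℝ] H}
    (hA : (A : H →ₗ[ℝ] H).IsSymmetric)
    (hr : FiniteDimensional ℝ (LinearMap.range (A : H →ₗ[ℝ] H)))
    (hH : ¬ FiniteDimensional ℝ H) {j : ℕ} (hj : 1 ≤ j) :
    0 ≤ eigenvalue (A : H →ₗ[ℝ] H) j := by
  refine le_eigenvalue hA hj ?_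
  have hker : LinearMap.ker (A : H →ₗ[ℝ] H) ≤ spectralSpan (A : H →ₗ[ℝ] H) (Set.Ici 0) := by
    rw [← Module.End.eigenspace_zero]
    exact eigenspace_le_spectralSpan _ (Set.self_mem_Ici)
  refine le_trans ?_ (Submodule.rank_mono hker)
  by_contra! hlt
  have hk : FiniteDimensional ℝ (LinearMap.ker (A : H →ₗ[ℝ] H)) :=
    Module.rank_lt_aleph0_iff.1 (hlt.trans (Cardinal.natCast_lt_aleph0))
  refine hH (Module.rank_lt_aleph0_iff.1 ?_)
  rw [← LinearMap.rank_range_add_rank_ker (A : H →ₗ[ℝ] H)]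
  exact Cardinal.add_lt_aleph0 (Module.rank_lt_aleph0_iff.2 hr) (Module.rank_lt_aleph0_iff.2 hk)

/-- Level sets shrink as the multiplicity grows. The condition `h0` rules out an empty level set,
whose default supremum 0 could exceed genuine negative eigenvalues. -/
lemma eigenvalue_anti {A : H →L[ℝ] H} (hA : (A : H →ₗ[ℝ] H).IsSymmetric) {i j : ℕ} (hi : 1 ≤ i)
    (hij : i ≤ j) (h0 : eigenvalue (A : H →ₗ[ℝ] H) j ≠ 0) :
    eigenvalue (A : H →ₗ[ℝ] H) j ≤ eigenvalue (A : H →ₗ[ℝ] H) i := by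
  refine csSup_le_csSup (bddAbove_eigenvalue_levels hA hi) ?_ fun a ha => ?_
  · by_contra h
    rw [Set.not_nonempty_iff_eq_empty] at h
    exact h0 (by rw [eigenvalue, h, Real.sSup_empty])
  · exact le_trans (Nat.cast_le.2 hij) (show (j : Cardinal) ≤ _ from ha)

lemma eigenvalue_eq_zero_of_rank_lt (A : H →ₗ[ℝ] H) {j : ℕ}
    (h : Module.rank ℝ H < j) : eigenvalue A j = 0 := by
  have : {a : ℝ | (j : Cardinal) ≤ Module.rank ℝ
      (⨆ l ∈ Set.Ici a, Module.End.eigenspace A l : Submodule ℝ H)} = ∅ := by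
    refine Set.eq_empty_of_forall_notMem fun a ha => ?_
    exact absurd ((show (j : Cardinal) ≤ _ from ha).trans (Submodule.rank_le _)) (not_le.2 h)
  rw [eigenvalue, this, Real.sSup_empty]

end Eigenvalues

/-! ### The ratio estimator: separation and stability. -/

section RatioEstimator

lemma ratio_of_ne_zero (a : ℝ) {b : ℝ} (hb : b ≠ 0) : ratio a b = a / b := by
  simp [ratio, hb]

/-- If `η 1, …, η q₀` are bounded away from zero and `η (q₀ + 1), …, η (qbar + 1)` are close to
zero, then the thresholded eigenvalue ratio is minimal at `q₀` only. -/
lemma IsRatioEstimate.eq_of_separated {ε₀ e M δ : ℝ} {η : ℕ → ℝ} {q₀ qbar q : ℕ}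
    (hq : IsRatioEstimate ε₀ qbar η q) (hq₀ : 1 ≤ q₀) (hqbar : q₀ ≤ qbar) (hε₀ : 0 < ε₀)
    (he : 0 < e) (hlow : ∀ j, 1 ≤ j → j ≤ q₀ → e ≤ η j) (hM : η 1 ≤ M) (heM : ε₀ * M ≤ e)
    (hδ : δ < ε₀ * e) (hhigh : ∀ j, q₀ < j → |η j| ≤ δ) : q = q₀ := by
  have h1 : 0 < η 1 := he.trans_le (hlow 1 le_rfl hq₀)
  have hr : ∀ j, 1 ≤ j → j ≤ q₀ → 0 < normalizedEigenvalue ε₀ η j := by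
    intro j hj hjq
    have h2 : 0 < ratio (η j) (η 1) := by
      rw [ratio_of_ne_zero _ h1.ne']
      exact div_pos (he.trans_le (hlow j hj hjq)) h1
    have h3 : ε₀ ≤ ratio (η j) (η 1) := by
      rw [ratio_of_ne_zero _ h1.ne', le_div_iff₀ h1]
      exact (mul_le_mul_of_nonneg_left hM hε₀.le).trans (heM.trans (hlow j hj hjq))
    rw [normalizedEigenvalue, abs_of_pos h2, if_neg (not_lt.2 h3)]
    exact h2
  have hz : ∀ j, q₀ < j → normalizedEigenvalue ε₀ η j = 0 := by
    intro j hj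
    rw [normalizedEigenvalue, if_pos]
    rw [ratio_of_ne_zero _ h1.ne', abs_div, abs_of_pos h1, div_lt_iff₀ h1]
    exact (hhigh j hj).trans_lt (hδ.trans_le
      (mul_le_mul_of_nonneg_left (hlow 1 le_rfl hq₀) hε₀.le))
  have hmin : eigenvalueRatio ε₀ η q₀ = 0 := by
    rw [eigenvalueRatio, hz _ (Nat.lt_succ_self _), ratio_of_ne_zero _ (hr q₀ hq₀ le_rfl).ne',
      zero_div]
  have hle := hq.2 q₀ (Finset.mem_Icc.2 ⟨hq₀, hqbar⟩)
  rw [hmin] at hle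
  have hq1 := (Finset.mem_Icc.1 hq.1).1
  -- Before `q₀` numerator and denominator are both positive; after `q₀` both are thresholded to
  -- zero and the convention 0/0 = 1 applies. Neither is compatible with a ratio at most 0.
  rcases lt_trichotomy q q₀ with h | h | h
  · have hp := hr q hq1 h.le
    have : 0 < eigenvalueRatio ε₀ η q := by
      rw [eigenvalueRatio, ratio_of_ne_zero _ hp.ne']
      exact div_pos (hr (q + 1) (by omega) h) hp
    exact absurd hle (not_le.2 this)
  · exact h
  · have : eigenvalueRatio ε₀ η q = 1 := by
      rw [eigenvalueRatio, hz _ h, hz _ (by omega), ratio, if_pos ⟨rfl, rfl⟩]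
    rw [this] at hle
    exact absurd hle (by norm_num)

/-- Stability of the ratio estimator under perturbations of the operator. -/
lemma exists_perturbation_radius {H : Type*} [NormedAddCommGroup H] [InnerProductSpace ℝ H]
    [CompleteSpace H] (hH : ¬ FiniteDimensional ℝ H ∨ Module.rank ℝ H ≤ 1) {A : H →L[ℝ] H}
    (hc : IsCompactOperator A) (hA : (A : H →ₗ[ℝ] H).IsSymmetric) {η : ℕ → ℝ}
    (hη : ∀ j, η j = eigenvalue (A : H →ₗ[ℝ] H) j) {q₀ qbar : ℕ} (hq₀ : 1 ≤ q₀)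
    (hpos : η (q₀ + 1) < η q₀) (hzero : η (q₀ + 1) = 0) (hqbar : q₀ ≤ qbar) {ε₀ : ℝ}
    (hε₀ : 0 < ε₀) (hε₀η : ε₀ < η q₀ / η 1) :
    ∃ δ > 0, ∀ (B : H →L[ℝ] H), (B : H →ₗ[ℝ] H).IsSymmetric →
      FiniteDimensional ℝ (LinearMap.range (B : H →ₗ[ℝ] H)) → ‖B - A‖ < δ →
      ∀ (ηh : ℕ → ℝ), (∀ j, ηh j = eigenvalue (B : H →ₗ[ℝ] H) j) →
      ∀ q, IsRatioEstimate ε₀ qbar ηh q → q = q₀ := by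
  rw [hzero] at hpos
  have hmono : ∀ j, 1 ≤ j → j ≤ q₀ → η q₀ ≤ η j := by
    intro j hj hjq
    rw [hη, hη]
    exact eigenvalue_anti hA hj hjq (by rw [← hη]; exact hpos.ne')
  have hη1 : 0 < η 1 := hpos.trans_le (hmono 1 le_rfl hq₀)
  have hhigh : ∀ j, q₀ < j → η j ≤ 0 := by
    intro j hj
    by_contra! h
    have := eigenvalue_anti hA (i := q₀ + 1) (j := j) (by omega) (by omega)
      (by rw [← hη]; exact h.ne')
    rw [← hη, ← hη, hzero] at this
    exact absurd this (not_le.2 h)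
  rw [lt_div_iff₀ hη1] at hε₀η
  -- With `e = η q₀ - δ` and `M = η 1 + δ`, the requirements `ε₀ * M ≤ e` and `δ < ε₀ * e` become
  -- upper bounds on `δ * (1 + ε₀)`, namely `η q₀ - ε₀ * η 1` and, strictly, `ε₀ * η q₀`. The half
  -- provides the strictness.
  set δ : ℝ := min (η q₀ - ε₀ * η 1) (ε₀ * η q₀ / 2) / (1 + ε₀)
  have hδ : 0 < δ := by
    refine div_pos (lt_min (by linarith) (by positivity)) (by positivity)
  have hδ' : δ * (1 + ε₀) = min (η q₀ - ε₀ * η 1) (ε₀ * η q₀ / 2) :=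
    div_mul_cancel₀ _ (by positivity)
  have hδ1 : δ * (1 + ε₀) ≤ η q₀ - ε₀ * η 1 := hδ'.trans_le (min_le_left _ _)
  have hδ2 : δ * (1 + ε₀) ≤ ε₀ * η q₀ / 2 := hδ'.trans_le (min_le_right _ _)
  have hδ3 : 0 < ε₀ * η q₀ := by positivity
  have hδ4 : 0 < ε₀ * η 1 := by positivity
  refine ⟨δ, hδ, fun B hB hBr hBA ηh hηh q hq => ?_⟩
  have hBc : IsCompactOperator B := by
    let g : H →L[ℝ] LinearMap.range (B : H →ₗ[ℝ] H) := B.codRestrict _ fun x => ⟨x, rfl⟩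
    have hg : IsCompactOperator g := by
      refine ⟨g '' Metric.closedBall 0 1 |> closure, ?_, ?_⟩
      · exact (g.lipschitz.isBounded_image Metric.isBounded_closedBall).isCompact_closure
      · exact mem_of_superset (Metric.closedBall_mem_nhds _ one_pos)
          (fun x hx => subset_closure ⟨x, hx, rfl⟩)
    exact hg.clm_comp (LinearMap.range (B : H →ₗ[ℝ] H)).subtypeL
  refine hq.eq_of_separated (e := η q₀ - δ) (M := η 1 + δ) (δ := δ) hq₀ hqbar hε₀
    (by nlinarith) (fun j hj hjq => ?_) ?_ (by nlinarith) (by nlinarith) (fun j hj => ?_)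
  · have h := eigenvalue_le_add hBc hB hA hj
    rw [← hη, ← hηh, norm_sub_rev] at h
    have h2 := hmono j hj hjq
    rcases le_total (ηh j) 0 with h0 | h0
    · rw [max_eq_right h0] at h
      nlinarith
    · rw [max_eq_left h0] at h
      linarith
  · have h := eigenvalue_le_add hc hA hB le_rfl
    rw [← hη, ← hηh, max_eq_left hη1.le] at h
    linarith
  · have hj1 : 1 ≤ j := by omega
    have h := eigenvalue_le_add hc hA hB hj1
    rw [← hη, ← hηh, max_eq_right (hhigh j hj), zero_add] at h
    -- The perturbation bound controls `ηh j` only from above. The lower bound comes from finite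
    -- rank in infinite dimension; in dimension at most one there is no level at all, because `j ≥
    -- 2`.
    have h0 : 0 ≤ ηh j := by
      rcases hH with hH | hH
      · rw [hηh]
        exact eigenvalue_nonneg_of_finiteDimensional_range hB hBr hH hj1
      · rw [hηh, eigenvalue_eq_zero_of_rank_lt]
        refine hH.trans_lt ?_
        exact Nat.one_lt_cast.2 (by omega)
    rw [abs_of_nonneg h0]
    linarith

end RatioEstimator

/-! ### The dimension of the L² space of a compact set. -/

section Dimension

lemma volume_coordinate_hyperplane {d : ℕ} (i : Fin d) (r : ℝ) :
    volume {x : EuclideanSpace ℝ (Fin d) | x i = r} = 0 := by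
  have h := (PiLp.volume_preserving_ofLp (Fin d)).measure_preimage
    (s := {f : Fin d → ℝ | f i = r})
    (measurableSet_eq_fun (measurable_pi_apply i) measurable_const).nullMeasurableSet
  rw [volume_pi, Measure.pi_hyperplane] at h
  exact h

/-- `L²` of a compact subset of a Euclidean space has infinite dimension or dimension at most
one. -/
lemma not_finiteDimensional_or_rank_le_one {d : ℕ} {D : Set (EuclideanSpace ℝ (Fin d))}
    (hD : IsCompact D) :
    ¬ FiniteDimensional ℝ (L2 (volume.restrict D)) ∨
      Module.rank ℝ (L2 (volume.restrict D)) ≤ 1 := by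
  have hfin : IsFiniteMeasure (volume.restrict D) :=
    ⟨by rw [Measure.restrict_apply_univ]; exact hD.measure_lt_top⟩
  -- Two degenerate cases have dimension at most one: a Euclidean space with a single point, and a
  -- null set `D`.
  rcases Nat.eq_zero_or_pos d with rfl | hd
  · right
    rw [rank_le_one_iff]
    refine ⟨Lp.const 2 _ (1 : ℝ), fun v => ⟨v 0, Lp.ext ?_⟩⟩
    filter_upwards [Lp.coeFn_smul (v 0) (Lp.const 2 (volume.restrict D) (1 : ℝ)),
      Lp.coeFn_const 2 (volume.restrict D) (1 : ℝ)] with x h1 h2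
    rw [h1, Pi.smul_apply, h2, Function.const_apply, smul_eq_mul, mul_one, Subsingleton.elim x 0]
  by_cases hD0 : volume D = 0
  · right
    have h0 : volume.restrict D = 0 := Measure.restrict_eq_zero.2 hD0
    have hall : ∀ p : EuclideanSpace ℝ (Fin d) → Prop, ∀ᵐ x ∂(volume.restrict D), p x := by
      intro p
      rw [h0, ae_zero]
      exact Filter.eventually_bot
    rw [rank_le_one_iff]
    exact ⟨0, fun v => ⟨0, Lp.ext (hall _)⟩⟩
  left
  intro hf
  let i : Fin d := ⟨0, hd⟩
  -- Polynomials in one coordinate embed into L²: a nonzero one vanishes only on finitely many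
  -- hyperplanes, which are null, while `D` has positive measure.
  have hmem : ∀ p : Polynomial ℝ, MemLp (fun x : EuclideanSpace ℝ (Fin d) => p.eval (x i)) 2
      (volume.restrict D) := by
    intro p
    have hcont : Continuous fun x : EuclideanSpace ℝ (Fin d) => p.eval (x i) :=
      p.continuous.comp (by fun_prop)
    obtain ⟨C, hC⟩ := hD.exists_bound_of_continuousOn hcont.continuousOn
    refine MemLp.of_bound hcont.aestronglyMeasurable C ?_
    filter_upwards [ae_restrict_mem hD.measurableSet] with x hx using hC x hx
  let L : Polynomial ℝ →ₗ[ℝ] L2 (volume.restrict D) :=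
    { toFun := fun p => (hmem p).toLp _
      map_add' := fun p q => by
        rw [← MemLp.toLp_add]
        exact MemLp.toLp_congr _ _ (Eventually.of_forall fun x => by simp)
      map_smul' := fun c p => by
        rw [RingHom.id_apply, ← MemLp.toLp_const_smul]
        exact MemLp.toLp_congr _ _ (Eventually.of_forall fun x => by simp) }
  have hinj : Function.Injective L := by
    rw [← LinearMap.ker_eq_bot, Submodule.eq_bot_iff]
    intro p hp
    by_contra hp0
    have h1 : ∀ᵐ x ∂(volume.restrict D), p.eval (x i) = 0 := by
      have h2 : L p =ᵐ[volume.restrict D] fun x => p.eval (x i) := MemLp.coeFn_toLp (hmem p)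
      rw [LinearMap.mem_ker.1 hp] at h2
      filter_upwards [h2, Lp.coeFn_zero ℝ 2 (volume.restrict D)] with x h3 h4
      rw [← h3, h4, Pi.zero_apply]
    have h5 : ∀ᵐ x ∂(volume.restrict D), p.eval (x i) ≠ 0 := by
      refine ae_restrict_of_ae ?_
      have h6 : ∀ r ∈ p.roots.toFinset, ∀ᵐ x : EuclideanSpace ℝ (Fin d), x i ≠ r := by
        intro r _
        rw [ae_iff]
        simpa using volume_coordinate_hyperplane i r
      filter_upwards [(ae_ball_iff p.roots.toFinset.countable_toSet).2 h6] with x hx h0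
      exact hx (x i) (by simpa [hp0] using h0) rfl
    have h7 : ∀ᵐ x ∂(volume.restrict D), False := by
      filter_upwards [h1, h5] with x h8 h9 using h9 h8
    rw [eventually_false_iff_eq_bot, ae_eq_bot, Measure.restrict_eq_zero] at h7
    exact hD0 h7
  have := FiniteDimensional.of_injective L hinj
  exact Polynomial.not_finite this

end Dimension

/-! ### Hölder exponents and the pull-out property of conditional expectations. -/

instance instFactOneLeFour : Fact ((1 : ℝ≥0∞) ≤ 4) := ⟨by norm_num⟩

/-- This makes `ContinuousLinearMap.holder` send two elements of L⁴ to an element of L². -/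
instance instHolderTripleFour : ENNReal.HolderTriple 4 4 2 := ⟨by
  have h4 : (4 : ℝ≥0∞)⁻¹ = 2⁻¹ * 2⁻¹ := by
    rw [← ENNReal.mul_inv (by simp) (by simp)]
    norm_num
  rw [h4, ← mul_add, ENNReal.inv_two_add_inv_two, mul_one]⟩

section PullOut

variable {Ω E F G : Type*} {m mΩ : MeasurableSpace Ω} {P : Measure Ω}
  [NormedAddCommGroup E] [NormedSpace ℝ E] [CompleteSpace E]
  [NormedAddCommGroup F] [NormedSpace ℝ F] [NormedAddCommGroup G] [NormedSpace ℝ G]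
  [CompleteSpace G]

lemma condExp_bilin_eq_zero (L : F →L[ℝ] E →L[ℝ] G) {f : Ω → F} {g : Ω → E}
    (hf : AEStronglyMeasurable[m] f P) (hg : Integrable g P) (hg0 : P[g | m] =ᵐ[P] 0)
    (hfg : Integrable (fun ω => L (f ω) (g ω)) P) :
    P[fun ω => L (f ω) (g ω) | m] =ᵐ[P] 0 := by
  filter_upwards [condExp_bilin_of_aestronglyMeasurable_left L hf hfg hg, hg0] with ω h1 h2
  rw [h1, h2, Pi.zero_apply, map_zero, Pi.zero_apply]

lemma integral_bilin_eq_zero [IsFiniteMeasure P] (hm : m ≤ mΩ) (L : F →L[ℝ] E →L[ℝ] G)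
    {f : Ω → F} {g : Ω → E}
    (hf : AEStronglyMeasurable[m] f P) (hg : Integrable g P) (hg0 : P[g | m] =ᵐ[P] 0)
    (hfg : Integrable (fun ω => L (f ω) (g ω)) P) :
    ∫ ω, L (f ω) (g ω) ∂P = 0 := by
  rw [← integral_condExp hm, integral_congr_ae (condExp_bilin_eq_zero L hf hg hg0 hfg)]
  simp

end PullOut

/-- The real inner product as a continuous bilinear map. -/
def innerBilin (E : Type*) [NormedAddCommGroup E] [InnerProductSpace ℝ E] : E →L[ℝ] E →L[ℝ] ℝ :=
  (isBoundedBilinearMap_inner (𝕜 := ℝ) (E := E)).toContinuousLinearMap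

@[simp] lemma innerBilin_apply {E : Type*} [NormedAddCommGroup E] [InnerProductSpace ℝ E]
    (x y : E) : innerBilin E x y = inner ℝ x y := rfl

/-! ### Reverse martingale differences and their moment inequalities. -/

section MartingaleDifferences

variable {Ω E F G : Type*} {m m' mΩ : MeasurableSpace Ω} {P : Measure Ω} {p : ℝ≥0∞}

/-- Reverse martingale differences in `L^p` with respect to a family `B` of σ-algebras. -/
structure IsReverseMartingaleDiff [NormedAddCommGroup E] [NormedSpace ℝ E] [CompleteSpace E]
    (B : ℤ → MeasurableSpace Ω) (d : ℤ → Lp E p P) : Prop where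
  mem_lpMeas : ∀ j, d j ∈ lpMeas E ℝ (B j) p P
  condExp_eq_zero : ∀ j, P[d j | B (j + 1)] =ᵐ[P] 0

lemma lpMeas_mono [NormedAddCommGroup E] [NormedSpace ℝ E]
    (h : m ≤ m') : lpMeas E ℝ m p P ≤ lpMeas E ℝ m' p P := fun _ hf =>
  mem_lpMeas_iff_aestronglyMeasurable.2 ((mem_lpMeas_iff_aestronglyMeasurable.1 hf).mono h)

variable {B : ℤ → MeasurableSpace Ω}

lemma IsReverseMartingaleDiff.smul [NormedAddCommGroup E] [NormedSpace ℝ E] [CompleteSpace E]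
    {d : ℤ → Lp E p P} (hd : IsReverseMartingaleDiff B d) (c : ℤ → ℝ) :
    IsReverseMartingaleDiff B fun j => c j • d j where
  mem_lpMeas j := Submodule.smul_mem _ _ (hd.mem_lpMeas j)
  condExp_eq_zero j := by
    have h1 : P[⇑(c j • d j) | B (j + 1)] =ᵐ[P] P[c j • ⇑(d j) | B (j + 1)] :=
      condExp_congr_ae (Lp.coeFn_smul _ _)
    filter_upwards [h1, condExp_smul (c j) (⇑(d j)) (B (j + 1)) (μ := P),
      hd.condExp_eq_zero j] with ω h1 h2 h3
    rw [h1, h2, Pi.smul_apply, h3, Pi.zero_apply, smul_zero]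

lemma norm_pow_four_eq_integral {E : Type*} [NormedAddCommGroup E] (f : Lp E 4 P) :
    ‖f‖ ^ 4 = ∫ ω, ‖f ω‖ ^ 4 ∂P := by
  have h := (Lp.memLp f).eLpNorm_eq_integral_rpow_norm (by norm_num) (by norm_num)
  rw [Lp.norm_def, h, ENNReal.toReal_ofReal (by positivity), ← Real.rpow_natCast, ← Real.rpow_mul
    (by positivity)]
  norm_num

lemma integrable_norm_pow_four {E : Type*} [NormedAddCommGroup E] (f : Lp E 4 P) :
    Integrable (fun ω => ‖f ω‖ ^ 4) P :=
  (Lp.memLp f).integrable_norm_pow (p := 4) (by norm_num)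

/-- Expand the square of `‖x‖² + 2⟨x, d⟩ + ‖d‖²`. The term linear in `d` is kept exactly because it
integrates to zero for a martingale difference; Cauchy–Schwarz and 4ab³ ≤ 2a²b² + 2b⁴ handle the
remaining ones. -/
lemma norm_add_pow_four_le [NormedAddCommGroup E] [InnerProductSpace ℝ E] (x d : E) :
    ‖x + d‖ ^ 4 ≤ ‖x‖ ^ 4 + 4 * (‖x‖ ^ 2 * inner ℝ x d) + 8 * (‖x‖ ^ 2 * ‖d‖ ^ 2)
      + 3 * ‖d‖ ^ 4 := by
  have h1 : ‖x + d‖ ^ 4 = (‖x‖ ^ 2 + 2 * inner ℝ x d + ‖d‖ ^ 2) ^ 2 := by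
    rw [← norm_add_sq_real]; ring
  have h2 := abs_real_inner_le_norm x d
  set r : ℝ := inner ℝ x d
  set a := ‖x‖
  set b := ‖d‖
  have ha : 0 ≤ a := norm_nonneg x
  have hb : 0 ≤ b := norm_nonneg d
  have h3 : r ^ 2 ≤ a ^ 2 * b ^ 2 := by
    rw [← mul_pow]
    exact sq_le_sq' (by linarith [neg_abs_le r]) ((le_abs_self r).trans h2)
  have h4 : r * b ^ 2 ≤ a * b * b ^ 2 :=
    mul_le_mul_of_nonneg_right ((le_abs_self r).trans h2) (by positivity)
  have h5 : 0 ≤ 2 * b ^ 2 * (a - b) ^ 2 := by positivity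
  rw [h1]
  nlinarith

lemma integral_sq_mul_sq_le {E : Type*} [NormedAddCommGroup E] (f g : Lp E 4 P) :
    Integrable (fun ω => ‖f ω‖ ^ 2 * ‖g ω‖ ^ 2) P ∧
    ∫ ω, ‖f ω‖ ^ 2 * ‖g ω‖ ^ 2 ∂P ≤ ‖f‖ ^ 2 * ‖g‖ ^ 2 := by
  have hm : ∀ f : Lp E 4 P, MemLp (fun ω => ‖f ω‖ ^ 2) (ENNReal.ofReal 2) P := by
    intro f
    rw [ENNReal.ofReal_ofNat]
    refine (memLp_two_iff_integrable_sq ((Lp.aestronglyMeasurable f).norm.pow 2)).2 ?_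
    refine (integrable_norm_pow_four f).congr (Eventually.of_forall fun ω => ?_)
    simp only [Pi.pow_apply]
    ring
  have hn : ∀ f : Lp E 4 P, (∫ ω, (‖f ω‖ ^ 2) ^ (2 : ℝ) ∂P) ^ (1 / (2 : ℝ)) = ‖f‖ ^ 2 := by
    intro f
    have : ∀ ω, (‖f ω‖ ^ 2) ^ (2 : ℝ) = ‖f ω‖ ^ 4 := fun ω => by
      rw [Real.rpow_ofNat, ← pow_mul]
    simp only [this]
    rw [← norm_pow_four_eq_integral, show ‖f‖ ^ 4 = (‖f‖ ^ 2) ^ 2 by ring, ← Real.sqrt_eq_rpow,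
      Real.sqrt_sq (by positivity)]
  constructor
  · have h1 := hm f
    have h2 := hm g
    rw [ENNReal.ofReal_ofNat] at h1 h2
    exact h1.integrable_mul h2
  · have := integral_mul_le_Lp_mul_Lq_of_nonneg Real.HolderConjugate.two_two
      (Eventually.of_forall fun ω => by positivity) (Eventually.of_forall fun ω => by positivity)
      (hm f) (hm g)
    rwa [hn, hn] at this

variable [IsProbabilityMeasure P]

/-- A martingale transform: `S j` is measurable for the smaller σ-algebra `B (j + 1)`, so it can be
pulled out of the conditional expectation that annihilates `d j`. -/
lemma IsReverseMartingaleDiff.holder [NormedAddCommGroup E] [NormedSpace ℝ E] [CompleteSpace E]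
    [NormedAddCommGroup F] [NormedSpace ℝ F] [NormedAddCommGroup G] [NormedSpace ℝ G]
    [CompleteSpace G] (hB : Antitone B) {d : ℤ → Lp E 4 P} (hd : IsReverseMartingaleDiff B d)
    {S : ℤ → Lp F 4 P} (hS : ∀ j, S j ∈ lpMeas F ℝ (B (j + 1)) 4 P) (L : F →L[ℝ] E →L[ℝ] G) :
    IsReverseMartingaleDiff B fun j => (L.holder 2 (S j) (d j) : Lp G 2 P) where
  mem_lpMeas j := by
    rw [mem_lpMeas_iff_aestronglyMeasurable]
    have h1 := (mem_lpMeas_iff_aestronglyMeasurable.1 (hS j)).mono (hB (Int.le.intro 1 rfl))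
    have h2 := mem_lpMeas_iff_aestronglyMeasurable.1 (hd.mem_lpMeas j)
    exact (L.continuous₂.comp_aestronglyMeasurable (h1.prodMk h2)).congr (L.coeFn_holder (S j) (d j)).symm
  condExp_eq_zero j := by
    refine (condExp_congr_ae (L.coeFn_holder (S j) (d j))).trans ?_
    refine condExp_bilin_eq_zero L (mem_lpMeas_iff_aestronglyMeasurable.1 (hS j))
      ((Lp.memLp (d j)).integrable (by norm_num)) (hd.condExp_eq_zero j) ?_
    exact (L.memLp_of_bilin 2 (Lp.memLp (S j)) (Lp.memLp (d j))).integrable (by norm_num)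

variable [NormedAddCommGroup E] [InnerProductSpace ℝ E] [CompleteSpace E]

lemma inner_eq_zero_of_condExp_eq_zero (hm : m ≤ mΩ) {f g : Lp E 2 P}
    (hf : f ∈ lpMeas E ℝ m 2 P) (hg : P[g | m] =ᵐ[P] 0) : inner ℝ f g = 0 := by
  rw [L2.inner_def]
  exact integral_bilin_eq_zero hm (innerBilin E) (mem_lpMeas_iff_aestronglyMeasurable.1 hf)
    ((Lp.memLp g).integrable (by norm_num)) hg (L2.integrable_inner f g)

/-- Pythagoras. Time runs backwards, so the induction adds the smallest index last: its term is
orthogonal to everything measurable for the next σ-algebra, which includes all terms of larger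
index. -/
lemma IsReverseMartingaleDiff.norm_sum_sq (hB : Antitone B) (hBm : ∀ j, B j ≤ mΩ)
    {d : ℤ → Lp E 2 P} (hd : IsReverseMartingaleDiff B d) (s : Finset ℤ) :
    ‖∑ j ∈ s, d j‖ ^ 2 = ∑ j ∈ s, ‖d j‖ ^ 2 := by
  induction s using Finset.induction_on_min with
  | empty => simp
  | insert a s has ih =>
    have ha : a ∉ s := fun h => lt_irrefl a (has a h)
    rw [Finset.sum_insert ha, Finset.sum_insert ha, ← ih, norm_add_sq_real, real_inner_comm,
      inner_eq_zero_of_condExp_eq_zero (hBm (a + 1)) _ (hd.condExp_eq_zero a)]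
    · ring
    · exact Submodule.sum_mem _ fun j hj => lpMeas_mono (hB (has j hj)) (hd.mem_lpMeas j)

/-- The fourth-moment step of the martingale inequality. -/
lemma norm_add_sq_le_of_orthogonal (hm : m ≤ mΩ) {X D : Lp E 4 P}
    (hX : X ∈ lpMeas E ℝ m 4 P) (hD : P[D | m] =ᵐ[P] 0) :
    ‖X + D‖ ^ 2 ≤ ‖X‖ ^ 2 + 4 * ‖D‖ ^ 2 := by
  obtain ⟨hi, hle⟩ := integral_sq_mul_sq_le X D
  have hXm := mem_lpMeas_iff_aestronglyMeasurable.1 hX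
  have hXX : AEStronglyMeasurable[m] (fun ω => ‖X ω‖ ^ 2 • X ω) P :=
    Continuous.comp_aestronglyMeasurable (g := fun x : E => ‖x‖ ^ 2 • x) (by fun_prop) hXm
  have hint : Integrable (fun ω => innerBilin E (‖X ω‖ ^ 2 • X ω) (D ω)) P := by
    refine (((integrable_norm_pow_four X).add hi)).mono' ?_ ?_
    · exact (innerBilin E).aestronglyMeasurable_comp₂
        (((Lp.aestronglyMeasurable X).norm.pow 2).smul (Lp.aestronglyMeasurable X))
        (Lp.aestronglyMeasurable D)
    · refine Eventually.of_forall fun ω => ?_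
      rw [innerBilin_apply, real_inner_smul_left, norm_mul, Pi.add_apply,
        Real.norm_of_nonneg (by positivity : 0 ≤ ‖X ω‖ ^ 2), Real.norm_eq_abs]
      have h2 := mul_le_mul_of_nonneg_left (abs_real_inner_le_norm (X ω) (D ω))
        (by positivity : 0 ≤ ‖X ω‖ ^ 2)
      have h3 : 0 ≤ ‖X ω‖ ^ 2 * (‖X ω‖ - ‖D ω‖) ^ 2 := by positivity
      have h4 : 0 ≤ ‖X ω‖ ^ 4 := by positivity
      have h5 : 0 ≤ ‖X ω‖ ^ 2 * ‖D ω‖ ^ 2 := by positivity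
      nlinarith
  -- The linear term pairs `D` with `‖X‖² X`, which is measurable for `m`, so it has mean zero.
  have h0 : ∫ ω, innerBilin E (‖X ω‖ ^ 2 • X ω) (D ω) ∂P = 0 :=
    integral_bilin_eq_zero hm (innerBilin E) hXX
      ((Lp.memLp D).integrable (by norm_num)) hD hint
  have h1 : ‖X + D‖ ^ 4 ≤ ‖X‖ ^ 4 + 4 * 0 + 8 * (‖X‖ ^ 2 * ‖D‖ ^ 2) + 3 * ‖D‖ ^ 4 := by
    rw [norm_pow_four_eq_integral (X + D), norm_pow_four_eq_integral X,
      norm_pow_four_eq_integral D, ← h0]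
    have e1 : ∫ ω, ‖(X + D) ω‖ ^ 4 ∂P ≤ ∫ ω, (‖X ω‖ ^ 4
        + 4 * innerBilin E (‖X ω‖ ^ 2 • X ω) (D ω) + 8 * (‖X ω‖ ^ 2 * ‖D ω‖ ^ 2)
        + 3 * ‖D ω‖ ^ 4) ∂P := by
      refine integral_mono_ae (integrable_norm_pow_four _)
        ((((integrable_norm_pow_four X).add (hint.const_mul 4)).add (hi.const_mul 8)).add
          ((integrable_norm_pow_four D).const_mul 3)) ?_
      filter_upwards [Lp.coeFn_add X D] with ω hω
      rw [hω, Pi.add_apply, innerBilin_apply, real_inner_smul_left]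
      exact norm_add_pow_four_le _ _
    have e2 : ∫ ω, (‖X ω‖ ^ 4
        + 4 * innerBilin E (‖X ω‖ ^ 2 • X ω) (D ω) + 8 * (‖X ω‖ ^ 2 * ‖D ω‖ ^ 2)
        + 3 * ‖D ω‖ ^ 4) ∂P = ∫ ω, ‖X ω‖ ^ 4 ∂P
        + 4 * ∫ ω, innerBilin E (‖X ω‖ ^ 2 • X ω) (D ω) ∂P
        + 8 * ∫ ω, ‖X ω‖ ^ 2 * ‖D ω‖ ^ 2 ∂P + 3 * ∫ ω, ‖D ω‖ ^ 4 ∂P := by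
      rw [integral_add, integral_add, integral_add, integral_const_mul, integral_const_mul,
        integral_const_mul]
      · exact integrable_norm_pow_four X
      · exact hint.const_mul 4
      · exact (integrable_norm_pow_four X).add (hint.const_mul 4)
      · exact hi.const_mul 8
      · exact ((integrable_norm_pow_four X).add (hint.const_mul 4)).add (hi.const_mul 8)
      · exact (integrable_norm_pow_four D).const_mul 3
    rw [e2] at e1
    linarith
  -- Completing the square: x⁴ + 8x²d² + 3d⁴ ≤ (x² + 4d²)².
  refine (pow_le_pow_iff_left₀ (by positivity) (by positivity) two_ne_zero).1 ?_
  nlinarith [sq_nonneg (‖D‖ ^ 2)]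

/-- A Burkholder-type inequality in L⁴, obtained by iterating the fourth-moment step from the
largest index downwards. -/
lemma IsReverseMartingaleDiff.norm_sum_sq_le (hB : Antitone B) (hBm : ∀ j, B j ≤ mΩ)
    {d : ℤ → Lp E 4 P} (hd : IsReverseMartingaleDiff B d) (s : Finset ℤ) :
    ‖∑ j ∈ s, d j‖ ^ 2 ≤ 4 * ∑ j ∈ s, ‖d j‖ ^ 2 := by
  induction s using Finset.induction_on_min with
  | empty => simp
  | insert a s has ih =>
    have ha : a ∉ s := fun h => lt_irrefl a (has a h)
    rw [Finset.sum_insert ha, Finset.sum_insert ha, add_comm (d a)]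
    have hm : ∑ j ∈ s, d j ∈ lpMeas E ℝ (B (a + 1)) 4 P :=
      Submodule.sum_mem _ fun j hj => lpMeas_mono (hB (has j hj)) (hd.mem_lpMeas j)
    have := norm_add_sq_le_of_orthogonal (hBm (a + 1)) hm (hd.condExp_eq_zero a)
    linarith

end MartingaleDifferences

/-! ### Expectation and centering as operators on L². -/

section Centering

lemma norm_const_two {Ω G : Type*} {mΩ : MeasurableSpace Ω} {P : Measure Ω}
    [IsProbabilityMeasure P] [NormedAddCommGroup G] (c : G) : ‖Lp.const 2 P c‖ = ‖c‖ := by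
  rw [Lp.norm_const' _ _ _ (by norm_num) (by norm_num)]
  simp

variable {Ω G : Type*} {m m' mΩ : MeasurableSpace Ω} {P : Measure Ω} [IsProbabilityMeasure P]
  [NormedAddCommGroup G] [NormedSpace ℝ G]

/-- The expectation as a continuous linear map on `L²`. -/
def expectationL (P : Measure Ω) [IsProbabilityMeasure P] (G : Type*) [NormedAddCommGroup G]
    [NormedSpace ℝ G] : Lp G 2 P →L[ℝ] G :=
  LinearMap.mkContinuous
    { toFun := fun Z => ∫ ω, Z ω ∂P
      map_add' := fun Z W => by
        rw [integral_congr_ae (Lp.coeFn_add Z W)]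
        exact integral_add ((Lp.memLp Z).integrable (by norm_num))
          ((Lp.memLp W).integrable (by norm_num))
      map_smul' := fun c Z => by
        rw [integral_congr_ae (Lp.coeFn_smul c Z)]
        exact integral_smul c _ } 1
    (fun Z => by
      have h := (Lp.memLp Z).integrable (by norm_num)
      calc ‖∫ ω, Z ω ∂P‖ ≤ ∫ ω, ‖Z ω‖ ∂P := norm_integral_le_integral_norm _
        _ = (eLpNorm Z 1 P).toReal := by
          rw [eLpNorm_one_eq_lintegral_enorm, integral_norm_eq_lintegral_enorm h.1]
        _ ≤ (eLpNorm Z 2 P).toReal := ENNReal.toReal_mono (Lp.eLpNorm_ne_top Z)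
          (eLpNorm_le_eLpNorm_of_exponent_le (by norm_num) h.1)
        _ = 1 * ‖Z‖ := by rw [one_mul, Lp.norm_def])

lemma expectationL_apply (Z : Lp G 2 P) : expectationL P G Z = ∫ ω, Z ω ∂P := rfl

lemma norm_expectationL_apply_le (Z : Lp G 2 P) : ‖expectationL P G Z‖ ≤ ‖Z‖ := by
  have := (expectationL P G).le_of_opNorm_le
    (LinearMap.mkContinuous_norm_le _ zero_le_one _) Z
  rwa [one_mul] at this

/-- The deviation of a square-integrable random variable from its expectation. -/
def centerL (P : Measure Ω) [IsProbabilityMeasure P] (G : Type*) [NormedAddCommGroup G]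
    [NormedSpace ℝ G] : Lp G 2 P →L[ℝ] Lp G 2 P :=
  ContinuousLinearMap.id ℝ _ - (Lp.constL 2 P ℝ).comp (expectationL P G)

lemma centerL_apply (Z : Lp G 2 P) :
    centerL P G Z = Z - Lp.const 2 P (∫ ω, Z ω ∂P) := rfl

lemma norm_centerL_apply_le (Z : Lp G 2 P) : ‖centerL P G Z‖ ≤ 2 * ‖Z‖ := by
  rw [centerL_apply]
  refine (norm_sub_le _ _).trans ?_
  rw [norm_const_two, ← expectationL_apply, two_mul]
  exact add_le_add le_rfl (norm_expectationL_apply_le Z)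

lemma coeFn_centerL (Z : Lp G 2 P) :
    centerL P G Z =ᵐ[P] fun ω => Z ω - ∫ ω, Z ω ∂P := by
  rw [centerL_apply]
  filter_upwards [Lp.coeFn_sub Z (Lp.const 2 P (∫ ω, Z ω ∂P)),
    Lp.coeFn_const 2 P (∫ ω, Z ω ∂P)] with ω h1 h2
  rw [h1, Pi.sub_apply, h2, Function.const_apply]

lemma centerL_mem_lpMeas {Z : Lp G 2 P} (hZ : Z ∈ lpMeas G ℝ m 2 P) :
    centerL P G Z ∈ lpMeas G ℝ m 2 P := by
  rw [mem_lpMeas_iff_aestronglyMeasurable] at hZ ⊢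
  exact (hZ.sub aestronglyMeasurable_const).congr (coeFn_centerL Z).symm

lemma condExp_eq_integral_of_indep [CompleteSpace G] {f : Ω → G} (hm : m ≤ mΩ) (hm' : m' ≤ mΩ)
    (hf : AEStronglyMeasurable[m] f P) (hi : Indep m m' P) :
    P[f | m'] =ᵐ[P] fun _ => ∫ ω, f ω ∂P := by
  refine (condExp_congr_ae hf.ae_eq_mk).trans ?_
  rw [integral_congr_ae hf.ae_eq_mk]
  exact condExp_indep_eq hm hm' hf.stronglyMeasurable_mk hi

lemma condExp_centerL_of_indep [CompleteSpace G] {Z : Lp G 2 P} (hm : m ≤ mΩ) (hm' : m' ≤ mΩ)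
    (hZ : Z ∈ lpMeas G ℝ m 2 P) (hi : Indep m m' P) :
    P[centerL P G Z | m'] =ᵐ[P] 0 := by
  have h := mem_lpMeas_iff_aestronglyMeasurable.1 (centerL_mem_lpMeas hZ)
  refine (condExp_eq_integral_of_indep hm hm' h hi).trans (Eventually.of_forall fun _ => ?_)
  have hZi := (Lp.memLp Z).integrable (q := 2) (by norm_num)
  rw [integral_congr_ae (coeFn_centerL Z), integral_sub hZi (integrable_const _), integral_const]
  simp

end Centering

/-! ### Sums of finitely dependent vectors. -/

section FiniteDependence

/-- Only pairs of indices less than `N` apart contribute to the expanded square. The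
arithmetic–geometric mean inequality separates the two weights, and every index has at most `2 * N`
partners. -/
lemma norm_sum_sq_le_of_finite_dependence {V : Type*} [NormedAddCommGroup V]
    [InnerProductSpace ℝ V] {Z : ℤ → V} {ζ : ℝ} (hZ : ∀ j, ‖Z j‖ ≤ ζ) {N : ℕ}
    (h0 : ∀ i j : ℤ, i + N ≤ j → inner ℝ (Z i) (Z j) = 0) (c : ℤ → ℝ) (s : Finset ℤ) :
    ‖∑ j ∈ s, c j • Z j‖ ^ 2 ≤ 2 * N * ζ ^ 2 * ∑ j ∈ s, c j ^ 2 := by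
  have hζ : 0 ≤ ζ := (norm_nonneg _).trans (hZ 0)
  have hcard : ∀ i : ℤ, ((s.filter fun j => |i - j| < N).card : ℝ) ≤ 2 * N := by
    intro i
    have h1 : (s.filter fun j => |i - j| < N) ⊆ Finset.Ico (i - N) (i + N) := by
      intro j hj
      have := abs_lt.1 (Finset.mem_filter.1 hj).2
      exact Finset.mem_Ico.2 ⟨by linarith, by linarith⟩
    have h2 := Finset.card_le_card h1
    rw [Int.card_Ico] at h2
    have h3 : (i + N - (i - N) : ℤ).toNat = 2 * N := by omega
    rw [h3] at h2
    exact_mod_cast h2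
  have hterm : ∀ i j, inner ℝ (c i • Z i) (c j • Z j)
      ≤ if |i - j| < N then (c i ^ 2 * ζ ^ 2 + c j ^ 2 * ζ ^ 2) / 2 else 0 := by
    intro i j
    split_ifs with hij
    · have h1 : inner ℝ (c i • Z i) (c j • Z j) ≤ ‖c i • Z i‖ * ‖c j • Z j‖ :=
        real_inner_le_norm _ _
      have h2 : ∀ i, ‖c i • Z i‖ ^ 2 ≤ c i ^ 2 * ζ ^ 2 := by
        intro i
        rw [norm_smul, mul_pow, Real.norm_eq_abs, sq_abs]
        exact mul_le_mul_of_nonneg_left (pow_le_pow_left₀ (norm_nonneg _) (hZ i) 2) (sq_nonneg _)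
      nlinarith [h2 i, h2 j, sq_nonneg (‖c i • Z i‖ - ‖c j • Z j‖)]
    · rw [real_inner_smul_left, real_inner_smul_right]
      rw [not_lt, le_abs] at hij
      rcases hij with h | h
      · rw [real_inner_comm, h0 j i (by linarith)]; simp
      · rw [h0 i j (by linarith)]; simp
  rw [← real_inner_self_eq_norm_sq, sum_inner]
  simp_rw [inner_sum]
  calc ∑ i ∈ s, ∑ j ∈ s, inner ℝ (c i • Z i) (c j • Z j)
      ≤ ∑ i ∈ s, ∑ j ∈ s, if |i - j| < N then (c i ^ 2 * ζ ^ 2 + c j ^ 2 * ζ ^ 2) / 2 else 0 :=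
        Finset.sum_le_sum fun i _ => Finset.sum_le_sum fun j _ => hterm i j
    _ = (∑ i ∈ s, ∑ j ∈ s, if |i - j| < N then c i ^ 2 * ζ ^ 2 / 2 else 0)
        + ∑ i ∈ s, ∑ j ∈ s, if |i - j| < N then c j ^ 2 * ζ ^ 2 / 2 else 0 := by
      rw [← Finset.sum_add_distrib]
      refine Finset.sum_congr rfl fun i _ => ?_
      rw [← Finset.sum_add_distrib]
      refine Finset.sum_congr rfl fun j _ => ?_
      split_ifs <;> ring
    _ = 2 * ∑ i ∈ s, ∑ j ∈ s, if |i - j| < N then c i ^ 2 * ζ ^ 2 / 2 else 0 := by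
      rw [Finset.sum_comm (f := fun i j => if |i - j| < (N : ℤ) then c j ^ 2 * ζ ^ 2 / 2 else 0),
        two_mul]
      simp_rw [abs_sub_comm]
    _ ≤ 2 * ∑ i ∈ s, 2 * N * (c i ^ 2 * ζ ^ 2 / 2) := by
      refine mul_le_mul_of_nonneg_left (Finset.sum_le_sum fun i _ => ?_) zero_le_two
      rw [← Finset.sum_filter, Finset.sum_const, nsmul_eq_mul]
      exact mul_le_mul_of_nonneg_right (hcard i) (by positivity)
    _ = 2 * N * ζ ^ 2 * ∑ j ∈ s, c j ^ 2 := by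
      rw [Finset.mul_sum, Finset.mul_sum]
      refine Finset.sum_congr rfl fun i _ => ?_
      ring

end FiniteDependence

/-! ### Bilinear maps applied to sums in L⁴. -/

section HolderSums

variable {Ω E G : Type*} {mΩ : MeasurableSpace Ω} {P : Measure Ω}
  [NormedAddCommGroup E] [NormedSpace ℝ E] [NormedAddCommGroup G] [NormedSpace ℝ G]

lemma norm_holder_le {L : E →L[ℝ] E →L[ℝ] G} (hL : ‖L‖ ≤ 1) (x y : Lp E 4 P) :
    ‖(L.holder 2 x y : Lp G 2 P)‖ ≤ ‖x‖ * ‖y‖ := by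
  refine (L.norm_holder_apply_apply_le x y).trans ?_
  rw [mul_assoc]
  exact mul_le_of_le_one_left (by positivity) hL

lemma holder_flip (L : E →L[ℝ] E →L[ℝ] G) (x y : Lp E 4 P) :
    (L.flip.holder 2 x y : Lp G 2 P) = L.holder 2 y x := rfl

lemma holder_sum_left {ι : Type*} (L : E →L[ℝ] E →L[ℝ] G) (s : Finset ι) (x : ι → Lp E 4 P)
    (y : Lp E 4 P) :
    (L.holder 2 (∑ j ∈ s, x j) y : Lp G 2 P) = ∑ j ∈ s, L.holder 2 (x j) y :=
  map_sum ((L.holderₗ P 4 4 2).flip y) x s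

lemma holder_sum_right {ι : Type*} (L : E →L[ℝ] E →L[ℝ] G) (s : Finset ι) (x : Lp E 4 P)
    (y : ι → Lp E 4 P) :
    (L.holder 2 x (∑ j ∈ s, y j) : Lp G 2 P) = ∑ j ∈ s, L.holder 2 x (y j) :=
  map_sum (L.holderₗ P 4 4 2 x) y s

lemma holder_sum_smul_left {ι : Type*} (L : E →L[ℝ] E →L[ℝ] G) (s : Finset ι) (c : ι → ℝ)
    (x : ι → Lp E 4 P) (y : Lp E 4 P) :
    (L.holder 2 (∑ j ∈ s, c j • x j) y : Lp G 2 P) = ∑ j ∈ s, c j • L.holder 2 (x j) y := by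
  rw [holder_sum_left]
  exact Finset.sum_congr rfl fun j _ => L.holder_smul_left _ _ _

lemma holder_sum_smul_right {ι : Type*} (L : E →L[ℝ] E →L[ℝ] G) (s : Finset ι) (c : ι → ℝ)
    (x : Lp E 4 P) (y : ι → Lp E 4 P) :
    (L.holder 2 x (∑ j ∈ s, c j • y j) : Lp G 2 P) = ∑ j ∈ s, c j • L.holder 2 x (y j) := by
  rw [holder_sum_right]
  exact Finset.sum_congr rfl fun j _ => L.holder_smul_right _ _ _

end HolderSums

/-! ### Martingale expansions and the pieces of a quadratic form. -/

section QuadraticForms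

variable {Ω E G : Type*} {mΩ : MeasurableSpace Ω} {P : Measure Ω} [IsProbabilityMeasure P]
  [NormedAddCommGroup E] [InnerProductSpace ℝ E] [CompleteSpace E]
  [NormedAddCommGroup G] [InnerProductSpace ℝ G] [CompleteSpace G]

/-- A process `v` in `L⁴` is expanded into a series of reverse martingale differences `a k`, with
absolutely summable norms, where `a k j` depends on the innovations at times `j - k, …, j`. -/
structure MartingaleExpansion (sig : Set ℤ → MeasurableSpace Ω) (v : ℤ → Lp E 4 P)
    (a : ℕ → ℤ → Lp E 4 P) (α : ℕ → ℝ) : Prop where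
  mono : Monotone sig
  le : ∀ I, sig I ≤ mΩ
  indep : ∀ I I', Disjoint I I' → Indep (sig I) (sig I') P
  mem_lpMeas : ∀ (k : ℕ) (j : ℤ), a k j ∈ lpMeas E ℝ (sig (Set.Icc (j - k) j)) 4 P
  condExp_eq_zero : ∀ (k : ℕ) (j : ℤ), P[a k j | sig (Set.Ici (j - k + 1))] =ᵐ[P] 0
  norm_le : ∀ k j, ‖a k j‖ ≤ α k
  summable : Summable α
  tendsto_sum : ∀ j, Tendsto (fun K => ∑ k ∈ Finset.range K, a k j) atTop (𝓝 (v j))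

namespace MartingaleExpansion

variable {sig : Set ℤ → MeasurableSpace Ω} {v : ℤ → Lp E 4 P} {a : ℕ → ℤ → Lp E 4 P} {α : ℕ → ℝ}

lemma nonneg (h : MartingaleExpansion sig v a α) (k : ℕ) : 0 ≤ α k :=
  (norm_nonneg _).trans (h.norm_le k 0)

lemma tsum_nonneg (h : MartingaleExpansion sig v a α) : 0 ≤ ∑' k, α k :=
  _root_.tsum_nonneg h.nonneg

lemma antitone (h : MartingaleExpansion sig v a α) (k : ℕ) :
    Antitone fun j : ℤ => sig (Set.Ici (j - k)) := fun i j hij =>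
  h.mono (Set.Ici_subset_Ici.2 (by linarith))

/-- At fixed depth `k` the oldest innovation of `a k j` has index `j - k`, and it is this one that
averages to zero given all later ones. Hence the filtration decreases in `j`. -/
lemma reverseMartingaleDiff (h : MartingaleExpansion sig v a α) (k : ℕ) :
    IsReverseMartingaleDiff (fun j : ℤ => sig (Set.Ici (j - k))) (a k) where
  mem_lpMeas j := lpMeas_mono (h.mono Set.Icc_subset_Ici_self) (h.mem_lpMeas k j)
  condExp_eq_zero j := by
    have := h.condExp_eq_zero k j
    rwa [show j - (k : ℤ) + 1 = j + 1 - k by ring] at this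

lemma norm_sum_smul_le (h : MartingaleExpansion sig v a α) (k : ℕ) (c : ℤ → ℝ) (s : Finset ℤ) :
    ‖∑ j ∈ s, c j • a k j‖ ≤ 2 * α k * √(∑ j ∈ s, c j ^ 2) := by
  have h1 := ((h.reverseMartingaleDiff k).smul c).norm_sum_sq_le (h.antitone k)
    (fun j => h.le _) s
  have h2 : ∑ j ∈ s, ‖c j • a k j‖ ^ 2 ≤ α k ^ 2 * ∑ j ∈ s, c j ^ 2 := by
    rw [Finset.mul_sum]
    refine Finset.sum_le_sum fun j _ => ?_
    rw [norm_smul, mul_pow, Real.norm_eq_abs, sq_abs, mul_comm]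
    exact mul_le_mul_of_nonneg_right (pow_le_pow_left₀ (norm_nonneg _) (h.norm_le k j) 2)
      (sq_nonneg _)
  refine (pow_le_pow_iff_left₀ (norm_nonneg _)
    (mul_nonneg (mul_nonneg zero_le_two (h.nonneg k)) (Real.sqrt_nonneg _)) two_ne_zero).1 ?_
  rw [mul_pow, Real.sq_sqrt (Finset.sum_nonneg fun _ _ => sq_nonneg _)]
  linarith

/-- The martingale inequality at each depth, summed over depths. The process thus obeys the
square-root bound of uncorrelated variables, up to a constant, although its terms are dependent. -/
lemma norm_sum_smul_le_tsum (h : MartingaleExpansion sig v a α) (c : ℤ → ℝ) (s : Finset ℤ) :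
    ‖∑ j ∈ s, c j • v j‖ ≤ 2 * (∑' k, α k) * √(∑ j ∈ s, c j ^ 2) := by
  have ht : Tendsto (fun K => ‖∑ j ∈ s, c j • ∑ k ∈ Finset.range K, a k j‖) atTop
      (𝓝 ‖∑ j ∈ s, c j • v j‖) :=
    (tendsto_finsetSum _ fun j _ => (h.tendsto_sum j).const_smul (c j)).norm
  refine le_of_tendsto' ht fun K => ?_
  simp_rw [Finset.smul_sum]
  rw [Finset.sum_comm]
  calc ‖∑ k ∈ Finset.range K, ∑ j ∈ s, c j • a k j‖
      ≤ ∑ k ∈ Finset.range K, 2 * α k * √(∑ j ∈ s, c j ^ 2) :=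
        norm_sum_le_of_le _ fun k _ => h.norm_sum_smul_le k c s
    _ = 2 * (∑ k ∈ Finset.range K, α k) * √(∑ j ∈ s, c j ^ 2) := by
        rw [← Finset.sum_mul, ← Finset.mul_sum]
    _ ≤ 2 * (∑' k, α k) * √(∑ j ∈ s, c j ^ 2) := by
        refine mul_le_mul_of_nonneg_right ?_ (Real.sqrt_nonneg _)
        exact mul_le_mul_of_nonneg_left (h.summable.sum_le_tsum _ fun k _ => h.nonneg k)
          zero_le_two

lemma norm_le_tsum (h : MartingaleExpansion sig v a α) (j : ℤ) : ‖v j‖ ≤ 2 * ∑' k, α k := by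
  simpa using h.norm_sum_smul_le_tsum (fun _ => 1) {j}

/-- The part of the quadratic form in which the second factor has the older innovation. -/
lemma norm_sum_offDiagonal_le (h : MartingaleExpansion sig v a α) {L : E →L[ℝ] E →L[ℝ] G}
    (hL : ‖L‖ ≤ 1) (k l : ℕ) (A : ℤ → ℤ → ℝ) (s : Finset ℤ) :
    ‖∑ i ∈ s, ∑ j ∈ s with i - l < j - k, A j i • (L.holder 2 (a k j) (a l i) : Lp G 2 P)‖
      ≤ 2 * α k * α l * √(∑ j ∈ s, ∑ i ∈ s, A j i ^ 2) := by
  -- For fixed `i`, collect all first factors whose oldest innovation is later than `i - l`. Then `S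
  -- i` is predictable relative to `a l i` and the sum over `i` is a martingale transform.
  set S : ℤ → Lp E 4 P := fun i => ∑ j ∈ s with i - l < j - k, A j i • a k j
  have hS : ∀ i, S i ∈ lpMeas E ℝ (sig (Set.Ici (i + 1 - l))) 4 P := by
    intro i
    refine Submodule.sum_mem _ fun j hj => Submodule.smul_mem _ _ ?_
    have hj' := (Finset.mem_filter.1 hj).2
    exact lpMeas_mono (h.mono (Set.Icc_subset_Ici_self.trans
      (Set.Ici_subset_Ici.2 (by omega)))) (h.mem_lpMeas k j)
  have hmd := (h.reverseMartingaleDiff l).holder (h.antitone l) hS L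
  have heq : ∑ i ∈ s, ∑ j ∈ s with i - l < j - k, A j i • (L.holder 2 (a k j) (a l i) : Lp G 2 P)
      = ∑ i ∈ s, (L.holder 2 (S i) (a l i) : Lp G 2 P) :=
    Finset.sum_congr rfl fun i _ => (holder_sum_smul_left L _ (fun j => A j i) (a k) _).symm
  rw [heq]
  refine (pow_le_pow_iff_left₀ (norm_nonneg _) (mul_nonneg (mul_nonneg (mul_nonneg zero_le_two
    (h.nonneg k)) (h.nonneg l)) (Real.sqrt_nonneg _)) two_ne_zero).1 ?_
  rw [hmd.norm_sum_sq (h.antitone l) (fun j => h.le _), mul_pow,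
    Real.sq_sqrt (Finset.sum_nonneg fun _ _ => Finset.sum_nonneg fun _ _ => sq_nonneg _),
    Finset.sum_comm, Finset.mul_sum]
  refine Finset.sum_le_sum fun i _ => ?_
  have h1 : ‖S i‖ ^ 2 ≤ 4 * α k ^ 2 * ∑ j ∈ s, A j i ^ 2 := by
    have h2 := h.norm_sum_smul_le k (fun j => A j i) (s.filter fun j => i - l < j - k)
    have h3 := pow_le_pow_left₀ (norm_nonneg _) h2 2
    rw [mul_pow, Real.sq_sqrt (Finset.sum_nonneg fun _ _ => sq_nonneg _)] at h3
    have h4 : ∑ j ∈ s with i - l < j - k, A j i ^ 2 ≤ ∑ j ∈ s, A j i ^ 2 :=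
      Finset.sum_le_sum_of_subset_of_nonneg (Finset.filter_subset _ _) fun _ _ _ => sq_nonneg _
    refine h3.trans ?_
    rw [mul_pow]
    norm_num
    exact mul_le_mul_of_nonneg_left h4 (by positivity)
  calc ‖(L.holder 2 (S i) (a l i) : Lp G 2 P)‖ ^ 2 ≤ (‖S i‖ * ‖a l i‖) ^ 2 :=
        pow_le_pow_left₀ (norm_nonneg _) (norm_holder_le hL _ _) 2
    _ = ‖S i‖ ^ 2 * ‖a l i‖ ^ 2 := mul_pow _ _ _
    _ ≤ (4 * α k ^ 2 * ∑ j ∈ s, A j i ^ 2) * α l ^ 2 :=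
        mul_le_mul h1 (pow_le_pow_left₀ (norm_nonneg _) (h.norm_le l i) 2) (by positivity)
          (mul_nonneg (by positivity) (Finset.sum_nonneg fun _ _ => sq_nonneg _))
    _ = (2 * α k * α l) ^ 2 * ∑ j ∈ s, A j i ^ 2 := by ring

/-- The part of the quadratic form in which both factors have the same oldest innovation. -/
lemma norm_sum_diagonal_le (h : MartingaleExpansion sig v a α) {L : E →L[ℝ] E →L[ℝ] G}
    (hL : ‖L‖ ≤ 1) (k l : ℕ) (c : ℤ → ℝ) (s : Finset ℤ) :
    ‖∑ j ∈ s, c j • centerL P G (L.holder 2 (a k j) (a l (j - k + l)))‖ ^ 2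
      ≤ 2 * (k + l + 1 : ℕ) * (2 * (α k * α l)) ^ 2 * ∑ j ∈ s, c j ^ 2 := by
  -- The second index is the one whose oldest innovation also has time `j - k`. Both factors then
  -- involve only innovations from `j - k` to `j + l`, so products `k + l + 1` apart are
  -- independent.
  have hm : ∀ j, (L.holder 2 (a k j) (a l (j - k + l)) : Lp G 2 P)
      ∈ lpMeas G ℝ (sig (Set.Icc (j - k) (j + l))) 2 P := by
    intro j
    rw [mem_lpMeas_iff_aestronglyMeasurable]
    have h1 := (mem_lpMeas_iff_aestronglyMeasurable.1 (h.mem_lpMeas k j)).mono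
      (h.mono (Set.Icc_subset_Icc le_rfl (by omega : j ≤ j + l)))
    have h2 := (mem_lpMeas_iff_aestronglyMeasurable.1 (h.mem_lpMeas l (j - k + l))).mono
      (h.mono (Set.Icc_subset_Icc (by omega : j - k ≤ j - k + l - l)
        (by omega : j - k + l ≤ j + l)))
    exact (L.continuous₂.comp_aestronglyMeasurable (h1.prodMk h2)).congr
      (L.coeFn_holder (a k j) (a l (j - k + l))).symm
  refine norm_sum_sq_le_of_finite_dependence (fun j => ?_) (fun i j hij => ?_) c s
  · refine (norm_centerL_apply_le _).trans (mul_le_mul_of_nonneg_left ?_ zero_le_two)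
    exact (norm_holder_le hL _ _).trans
      (mul_le_mul (h.norm_le k j) (h.norm_le l _) (norm_nonneg _) (h.nonneg k))
  · refine inner_eq_zero_of_condExp_eq_zero (h.le _) (centerL_mem_lpMeas (hm i))
      (condExp_centerL_of_indep (h.le _) (h.le _) (hm j) (h.indep _ _ ?_))
    rw [Set.disjoint_left]
    intro x hx hx'
    have h1 := hx.1
    have h2 := hx'.2
    push_cast at hij
    omega

end MartingaleExpansion

end QuadraticForms

lemma sum_comm_four {M ι κ : Type*} [AddCommMonoid M] (s s' : Finset ι) (S S' : Finset κ)
    (f : ι → ι → κ → κ → M) :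
    ∑ j ∈ s, ∑ i ∈ s', ∑ k ∈ S, ∑ l ∈ S', f j i k l
      = ∑ k ∈ S, ∑ l ∈ S', ∑ j ∈ s, ∑ i ∈ s', f j i k l := by
  calc ∑ j ∈ s, ∑ i ∈ s', ∑ k ∈ S, ∑ l ∈ S', f j i k l
      = ∑ j ∈ s, ∑ k ∈ S, ∑ i ∈ s', ∑ l ∈ S', f j i k l :=
        Finset.sum_congr rfl fun j _ => Finset.sum_comm
    _ = ∑ k ∈ S, ∑ j ∈ s, ∑ i ∈ s', ∑ l ∈ S', f j i k l := Finset.sum_comm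
    _ = ∑ k ∈ S, ∑ j ∈ s, ∑ l ∈ S', ∑ i ∈ s', f j i k l :=
        Finset.sum_congr rfl fun k _ => Finset.sum_congr rfl fun j _ => Finset.sum_comm
    _ = _ := Finset.sum_congr rfl fun k _ => Finset.sum_comm

/-! ### Quadratic forms with general weights. -/

section QuadForm

variable {Ω E G : Type*} {mΩ : MeasurableSpace Ω} {P : Measure Ω}
  [NormedAddCommGroup E] [NormedSpace ℝ E] [NormedAddCommGroup G] [NormedSpace ℝ G]

/-- The quadratic form `∑ A j i L(x_j, y_i)`. -/
def quadForm (L : E →L[ℝ] E →L[ℝ] G) (A : ℤ → ℤ → ℝ) (s : Finset ℤ) (x y : ℤ → Lp E 4 P) :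
    Lp G 2 P :=
  ∑ j ∈ s, ∑ i ∈ s, A j i • L.holder 2 (x j) (y i)

lemma quadForm_add (L : E →L[ℝ] E →L[ℝ] G) (A : ℤ → ℤ → ℝ) (s : Finset ℤ)
    (x x' y y' : ℤ → Lp E 4 P) :
    quadForm L A s (fun j => x j + x' j) (fun j => y j + y' j)
      = quadForm L A s x y + quadForm L A s x y' + quadForm L A s x' y
        + quadForm L A s x' y' := by
  simp only [quadForm, ContinuousLinearMap.holder_add_left, ContinuousLinearMap.holder_add_right,
    smul_add, Finset.sum_add_distrib]
  abel

lemma quadForm_sum {ι : Type*} (L : E →L[ℝ] E →L[ℝ] G) (A : ℤ → ℤ → ℝ) (s : Finset ℤ)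
    (S S' : Finset ι) (x y : ι → ℤ → Lp E 4 P) :
    quadForm L A s (fun j => ∑ k ∈ S, x k j) (fun j => ∑ l ∈ S', y l j)
      = ∑ k ∈ S, ∑ l ∈ S', quadForm L A s (x k) (y l) := by
  have hterm : ∀ j i, A j i • (L.holder 2 (∑ k ∈ S, x k j) (∑ l ∈ S', y l i) : Lp G 2 P)
      = ∑ k ∈ S, ∑ l ∈ S', A j i • (L.holder 2 (x k j) (y l i) : Lp G 2 P) := by
    intro j i
    rw [holder_sum_left, Finset.smul_sum]
    refine Finset.sum_congr rfl fun k _ => ?_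
    rw [holder_sum_right, Finset.smul_sum]
  simp only [quadForm, hterm]
  exact sum_comm_four s s S S' fun j i k l => A j i • (L.holder 2 (x k j) (y l i) : Lp G 2 P)

lemma tendsto_quadForm (L : E →L[ℝ] E →L[ℝ] G) (A : ℤ → ℤ → ℝ) (s : Finset ℤ)
    {x y : ℕ → ℤ → Lp E 4 P} {x₀ y₀ : ℤ → Lp E 4 P}
    (hx : ∀ j, Tendsto (fun K => x K j) atTop (𝓝 (x₀ j)))
    (hy : ∀ j, Tendsto (fun K => y K j) atTop (𝓝 (y₀ j))) :
    Tendsto (fun K => quadForm L A s (x K) (y K)) atTop (𝓝 (quadForm L A s x₀ y₀)) := by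
  refine tendsto_finsetSum _ fun j _ => tendsto_finsetSum _ fun i _ => ?_
  refine Tendsto.const_smul ?_ _
  have h := ((L.holderL P 4 4 2).continuous₂.tendsto (x₀ j, y₀ i)).comp
    ((hx j).prodMk_nhds (hy i))
  exact h

end QuadForm

/-! ### The law of large numbers for quadratic forms. -/

namespace MartingaleExpansion

variable {Ω E G : Type*} {mΩ : MeasurableSpace Ω} {P : Measure Ω} [IsProbabilityMeasure P]
  [NormedAddCommGroup E] [InnerProductSpace ℝ E] [CompleteSpace E]
  [NormedAddCommGroup G] [InnerProductSpace ℝ G] [CompleteSpace G]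
  {sig : Set ℤ → MeasurableSpace Ω} {v : ℤ → Lp E 4 P} {a : ℕ → ℤ → Lp E 4 P} {α : ℕ → ℝ}

/-- Trichotomy for the times of the oldest innovations, `j - k` and `i - l`. The flip puts the
factor with the older innovation in second place, so that one off-diagonal estimate serves both
sides; equality determines `i` from `j`. -/
lemma quadForm_split (L : E →L[ℝ] E →L[ℝ] G) (A : ℤ → ℤ → ℝ) (s : Finset ℤ) (k l : ℕ)
    (x y : ℤ → Lp E 4 P) :
    quadForm L A s x y =
      (∑ i ∈ s, ∑ j ∈ s with i - l < j - k, A j i • (L.holder 2 (x j) (y i) : Lp G 2 P))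
      + (∑ j ∈ s, ∑ i ∈ s with j - k < i - l, A j i • (L.flip.holder 2 (y i) (x j) : Lp G 2 P))
      + ∑ j ∈ s, (if j - k + l ∈ s then A j (j - k + l) else 0) •
          (L.holder 2 (x j) (y (j - k + l)) : Lp G 2 P) := by
  have h1 : (∑ i ∈ s, ∑ j ∈ s with i - l < j - k, A j i • (L.holder 2 (x j) (y i) : Lp G 2 P))
      = ∑ j ∈ s, ∑ i ∈ s with i - l < j - k, A j i • (L.holder 2 (x j) (y i) : Lp G 2 P) := by
    simp_rw [Finset.sum_filter]
    exact Finset.sum_comm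
  rw [h1, quadForm, ← Finset.sum_add_distrib, ← Finset.sum_add_distrib]
  refine Finset.sum_congr rfl fun j _ => ?_
  have h2 : (if j - k + l ∈ s then A j (j - k + l) else 0) •
      (L.holder 2 (x j) (y (j - k + l)) : Lp G 2 P)
      = ∑ i ∈ s, if j - k + l = i then A j i • (L.holder 2 (x j) (y i) : Lp G 2 P) else 0 := by
    rw [Finset.sum_ite_eq]
    split_ifs <;> simp
  rw [h2, Finset.sum_filter, Finset.sum_filter, ← Finset.sum_add_distrib,
    ← Finset.sum_add_distrib]
  refine Finset.sum_congr rfl fun i _ => ?_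
  rcases lt_trichotomy (i - (l : ℤ)) (j - k) with h | h | h
  · rw [if_pos h, if_neg h.not_gt, if_neg (by omega), add_zero, add_zero]
  · rw [if_neg h.not_lt, if_neg h.not_gt, if_pos (by omega), zero_add, zero_add]
  · rw [if_neg h.not_gt, if_pos h, if_neg (by omega), add_zero, zero_add, holder_flip]

/-- Each of the two off-diagonal parts has norm at most 2 in the units used, and centering at most
doubles it, which gives the factor 8. The diagonal part must stay centered, since its mean need not
be small. -/
lemma norm_center_quadForm_le (h : MartingaleExpansion sig v a α) {L : E →L[ℝ] E →L[ℝ] G}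
    (hL : ‖L‖ ≤ 1) (k l : ℕ) (A : ℤ → ℤ → ℝ) (s : Finset ℤ) :
    ‖centerL P G (quadForm L A s (a k) (a l))‖
      ≤ 8 * (α k * α l) * √(∑ j ∈ s, ∑ i ∈ s, A j i ^ 2)
        + ‖∑ j ∈ s, (if j - k + l ∈ s then A j (j - k + l) else 0) •
            centerL P G (L.holder 2 (a k j) (a l (j - k + l)))‖ := by
  have hd := map_sum (centerL P G) (fun j : ℤ => (if j - k + l ∈ s then A j (j - k + l) else 0) •
    (L.holder 2 (a k j) (a l (j - k + l)) : Lp G 2 P)) s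
  simp only [map_smul] at hd
  rw [quadForm_split L A s k l, map_add, map_add, hd]
  refine (norm_add_le _ _).trans (add_le_add ((norm_add_le _ _).trans ?_) le_rfl)
  have h1 := (norm_centerL_apply_le _).trans
    (mul_le_mul_of_nonneg_left (h.norm_sum_offDiagonal_le hL k l A s) zero_le_two)
  have hLf : ‖L.flip‖ ≤ 1 := by rwa [ContinuousLinearMap.opNorm_flip]
  have h2 := (norm_centerL_apply_le _).trans
    (mul_le_mul_of_nonneg_left (h.norm_sum_offDiagonal_le hLf l k (fun i j => A j i) s)
      zero_le_two)
  rw [Finset.sum_comm (f := fun i j => A j i ^ 2)] at h2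
  linarith

lemma sum_diagonal_sq_le (A : ℤ → ℤ → ℝ) (s : Finset ℤ) (k l : ℕ) :
    ∑ j ∈ s, (if j - k + l ∈ s then A j (j - k + l) else 0) ^ 2
      ≤ ∑ j ∈ s, ∑ i ∈ s, A j i ^ 2 := by
  refine Finset.sum_le_sum fun j _ => ?_
  split_ifs with hj
  · exact Finset.single_le_sum (f := fun i => A j i ^ 2) (fun _ _ => sq_nonneg _) hj
  · simpa using Finset.sum_nonneg fun i _ => sq_nonneg (A j i)

/-- The finite-dependence bound carries a factor growing with `k + l`, which need not be summable
against `α`. This cruder triangle-inequality bound has no such factor and serves as the dominating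
sequence. -/
lemma norm_center_diagonal_le (h : MartingaleExpansion sig v a α) {L : E →L[ℝ] E →L[ℝ] G}
    (hL : ‖L‖ ≤ 1) (k l : ℕ) {A : ℤ → ℤ → ℝ} {s : Finset ℤ} {C : ℝ}
    (hC : ∀ t, ∑ j ∈ s, |A j (j - t)| ≤ C) :
    ‖∑ j ∈ s, (if j - k + l ∈ s then A j (j - k + l) else 0) •
        centerL P G (L.holder 2 (a k j) (a l (j - k + l)))‖ ≤ 2 * C * (α k * α l) := by
  refine (norm_sum_le _ _).trans ?_
  calc ∑ j ∈ s, ‖(if j - k + l ∈ s then A j (j - k + l) else 0) •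
        centerL P G (L.holder 2 (a k j) (a l (j - k + l)))‖
      ≤ ∑ j ∈ s, |A j (j - (k - l))| * (2 * (α k * α l)) := by
        refine Finset.sum_le_sum fun j _ => ?_
        rw [norm_smul]
        refine mul_le_mul ?_ ?_ (norm_nonneg _) (abs_nonneg _)
        · rw [show j - ((k : ℤ) - l) = j - k + l by ring]
          split_ifs
          · exact le_rfl
          · simp
        · refine (norm_centerL_apply_le _).trans (mul_le_mul_of_nonneg_left ?_ zero_le_two)
          exact (norm_holder_le hL _ _).trans
            (mul_le_mul (h.norm_le k j) (h.norm_le l _) (norm_nonneg _) (h.nonneg k))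
    _ = (∑ j ∈ s, |A j (j - (k - l))|) * (2 * (α k * α l)) := by rw [Finset.sum_mul]
    _ ≤ C * (2 * (α k * α l)) := mul_le_mul_of_nonneg_right (hC _)
        (mul_nonneg zero_le_two (mul_nonneg (h.nonneg k) (h.nonneg l)))
    _ = 2 * C * (α k * α l) := by ring

lemma norm_center_quadForm_le_tsum (h : MartingaleExpansion sig v a α) {L : E →L[ℝ] E →L[ℝ] G}
    {A : ℤ → ℤ → ℝ} {s : Finset ℤ}
    (hs : Summable fun p : ℕ × ℕ => ‖centerL P G (quadForm L A s (a p.1) (a p.2))‖) :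
    ‖centerL P G (quadForm L A s v v)‖
      ≤ ∑' p : ℕ × ℕ, ‖centerL P G (quadForm L A s (a p.1) (a p.2))‖ := by
  have ht := (((centerL P G).continuous.tendsto _).comp
    (tendsto_quadForm L A s h.tendsto_sum h.tendsto_sum)).norm
  refine le_of_tendsto' ht fun K => ?_
  simp only [Function.comp_apply]
  rw [quadForm_sum, map_sum]
  simp_rw [map_sum]
  rw [← Finset.sum_product']
  exact (norm_sum_le _ _).trans (hs.sum_le_tsum _ fun _ _ => norm_nonneg _)

/-- A law of large numbers for quadratic forms. -/
theorem tendsto_center_quadForm (h : MartingaleExpansion sig v a α) {L : E →L[ℝ] E →L[ℝ] G}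
    (hL : ‖L‖ ≤ 1) {A : ℕ → ℤ → ℤ → ℝ} {s : ℕ → Finset ℤ} {C : ℝ}
    (hC : ∀ᶠ n in atTop, ∀ t, ∑ j ∈ s n, |A n j (j - t)| ≤ C)
    (hA : Tendsto (fun n => ∑ j ∈ s n, ∑ i ∈ s n, A n j i ^ 2) atTop (𝓝 0)) :
    Tendsto (fun n => ‖centerL P G (quadForm L (A n) (s n) v v)‖) atTop (𝓝 0) := by
  set q : ℕ → ℝ := fun n => ∑ j ∈ s n, ∑ i ∈ s n, A n j i ^ 2
  have hq0 : ∀ n, 0 ≤ q n := fun n =>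
    Finset.sum_nonneg fun _ _ => Finset.sum_nonneg fun _ _ => sq_nonneg _
  have hα : ∀ p : ℕ × ℕ, 0 ≤ α p.1 * α p.2 := fun p => mul_nonneg (h.nonneg _) (h.nonneg _)
  have hsum : Summable fun p : ℕ × ℕ => (8 + 2 * C) * (α p.1 * α p.2) :=
    (h.summable.mul_of_nonneg h.summable h.nonneg h.nonneg).mul_left _
  -- A bound summable over all pairs of depths, with no decay in `n`.
  have hbound : ∀ᶠ n in atTop, ∀ p : ℕ × ℕ,
      ‖centerL P G (quadForm L (A n) (s n) (a p.1) (a p.2))‖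
        ≤ (8 + 2 * C) * (α p.1 * α p.2) := by
    filter_upwards [hC, hA.eventually (ge_mem_nhds one_pos)] with n h1 h2 p
    refine (h.norm_center_quadForm_le hL p.1 p.2 (A n) (s n)).trans ?_
    have h3 := h.norm_center_diagonal_le hL p.1 p.2 h1
    have h4 : √(q n) ≤ 1 := Real.sqrt_le_one.2 h2
    have h5 : 8 * (α p.1 * α p.2) * √(q n) ≤ 8 * (α p.1 * α p.2) * 1 :=
      mul_le_mul_of_nonneg_left h4 (mul_nonneg (by norm_num) (hα p))
    have h6 := add_le_add h5 h3
    refine h6.trans_eq ?_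
    ring
  -- For fixed depths the factor `k + l + 1` is a constant, and the sum of squared weights drives
  -- every part to zero.
  have hpt : ∀ p : ℕ × ℕ, Tendsto
      (fun n => ‖centerL P G (quadForm L (A n) (s n) (a p.1) (a p.2))‖) atTop (𝓝 0) := by
    intro p
    have hlim : Tendsto (fun n => 8 * (α p.1 * α p.2) * √(q n)
        + √(2 * (p.1 + p.2 + 1 : ℕ) * (2 * (α p.1 * α p.2)) ^ 2 * q n)) atTop (𝓝 0) := by
      have h1 := (Real.continuous_sqrt.tendsto 0).comp hA
      have h2 := (Real.continuous_sqrt.tendsto _).comp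
        (hA.const_mul (2 * (p.1 + p.2 + 1 : ℕ) * (2 * (α p.1 * α p.2)) ^ 2))
      have h3 := (h1.const_mul (8 * (α p.1 * α p.2))).add h2
      simpa using h3
    refine squeeze_zero (fun _ => norm_nonneg _) (fun n => ?_) hlim
    refine (h.norm_center_quadForm_le hL p.1 p.2 (A n) (s n)).trans (add_le_add le_rfl ?_)
    refine Real.le_sqrt_of_sq_le ((h.norm_sum_diagonal_le hL p.1 p.2 _ (s n)).trans ?_)
    exact mul_le_mul_of_nonneg_left (sum_diagonal_sq_le (A n) (s n) p.1 p.2) (by positivity)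
  have hT := tendsto_tsum_of_dominated_convergence hsum hpt
    (hbound.mono fun n hn p => by rw [norm_norm]; exact hn p)
  rw [tsum_zero] at hT
  refine squeeze_zero' (Eventually.of_forall fun _ => norm_nonneg _) ?_ hT
  filter_upwards [hbound] with n hn
  exact h.norm_center_quadForm_le_tsum (hsum.of_nonneg_of_le (fun _ => norm_nonneg _) hn)

end MartingaleExpansion

/-! ### Bounds on localization and lag weights. -/

/-- Bounds on the weights `κ j * lam (j - i)` of a localized quadratic form: `W` is the window of
times that enter it, `μ` bounds the localization weights and `β` the number of lags. -/
structure WeightBounds (s W : Finset ℤ) (κ lam : ℤ → ℝ) (C M μ β : ℝ) : Prop where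
  mem_window_left : ∀ j ∈ s, κ j ≠ 0 → j ∈ W
  mem_window_right : ∀ j ∈ s, ∀ i ∈ s, κ j ≠ 0 → lam (j - i) ≠ 0 → i ∈ W
  abs_loc_le : ∀ j, |κ j| ≤ μ
  card_mul_le : W.card * μ ≤ C
  abs_lag_le : ∀ t, |lam t| ≤ M
  lag_neg : ∀ t < 0, lam t = 0
  sum_lag_left_le : ∀ j, ∑ i ∈ s, |lam (j - i)| ≤ β
  sum_lag_right_le : ∀ i, ∑ j ∈ s, |lam (j - i)| ≤ β

namespace WeightBounds

variable {s W : Finset ℤ} {κ lam : ℤ → ℝ} {C M μ β : ℝ}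

lemma loc_nonneg (h : WeightBounds s W κ lam C M μ β) : 0 ≤ μ :=
  (abs_nonneg _).trans (h.abs_loc_le 0)

lemma lag_nonneg (h : WeightBounds s W κ lam C M μ β) : 0 ≤ M :=
  (abs_nonneg _).trans (h.abs_lag_le 0)

lemma count_nonneg (h : WeightBounds s W κ lam C M μ β) : 0 ≤ β :=
  (Finset.sum_nonneg fun _ _ => abs_nonneg _).trans (h.sum_lag_left_le 0)

lemma sum_abs_loc_le (h : WeightBounds s W κ lam C M μ β) : ∑ j ∈ s, |κ j| ≤ C := by
  classical
  calc ∑ j ∈ s, |κ j| = ∑ j ∈ s with κ j ≠ 0, |κ j| := by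
        rw [Finset.sum_filter]
        refine Finset.sum_congr rfl fun j _ => ?_
        split_ifs with hj
        · rfl
        · simp [not_not.1 hj]
    _ ≤ ∑ j ∈ W, |κ j| := Finset.sum_le_sum_of_subset_of_nonneg
        (fun j hj => h.mem_window_left j (Finset.mem_filter.1 hj).1 (Finset.mem_filter.1 hj).2)
        fun _ _ _ => abs_nonneg _
    _ ≤ W.card * μ := by
        rw [← nsmul_eq_mul]
        exact Finset.sum_le_card_nsmul _ _ _ fun j _ => h.abs_loc_le j
    _ ≤ C := h.card_mul_le

lemma sum_lag_left_sq_le (h : WeightBounds s W κ lam C M μ β) (j : ℤ) :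
    ∑ i ∈ s, lam (j - i) ^ 2 ≤ M * β := by
  calc ∑ i ∈ s, lam (j - i) ^ 2 ≤ ∑ i ∈ s, M * |lam (j - i)| := by
        refine Finset.sum_le_sum fun i _ => ?_
        rw [← sq_abs, pow_two]
        exact mul_le_mul_of_nonneg_right (h.abs_lag_le _) (abs_nonneg _)
    _ ≤ M * β := by
        rw [← Finset.mul_sum]
        exact mul_le_mul_of_nonneg_left (h.sum_lag_left_le j) h.lag_nonneg

lemma sum_lag_right_sq_le (h : WeightBounds s W κ lam C M μ β) (i : ℤ) :
    ∑ j ∈ s, lam (j - i) ^ 2 ≤ M * β := by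
  calc ∑ j ∈ s, lam (j - i) ^ 2 ≤ ∑ j ∈ s, M * |lam (j - i)| := by
        refine Finset.sum_le_sum fun j _ => ?_
        rw [← sq_abs, pow_two]
        exact mul_le_mul_of_nonneg_right (h.abs_lag_le _) (abs_nonneg _)
    _ ≤ M * β := by
        rw [← Finset.mul_sum]
        exact mul_le_mul_of_nonneg_left (h.sum_lag_right_le i) h.lag_nonneg

/-- For the weights used later `μ` is of order 1/(Th) and `β` of order b, so this is the variance
order b/(Th) of the estimator. -/
lemma sum_sq_le (h : WeightBounds s W κ lam C M μ β) :
    ∑ j ∈ s, ∑ i ∈ s, (κ j * lam (j - i)) ^ 2 ≤ C * M * (μ * β) := by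
  calc ∑ j ∈ s, ∑ i ∈ s, (κ j * lam (j - i)) ^ 2
      = ∑ j ∈ s, κ j ^ 2 * ∑ i ∈ s, lam (j - i) ^ 2 := by
        refine Finset.sum_congr rfl fun j _ => ?_
        rw [Finset.mul_sum]
        exact Finset.sum_congr rfl fun i _ => mul_pow _ _ _
    _ ≤ ∑ j ∈ s, (μ * |κ j|) * (M * β) := by
        refine Finset.sum_le_sum fun j _ => mul_le_mul ?_ (h.sum_lag_left_sq_le j)
          (Finset.sum_nonneg fun _ _ => sq_nonneg _) (mul_nonneg h.loc_nonneg (abs_nonneg _))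
        rw [← sq_abs, pow_two]
        exact mul_le_mul_of_nonneg_right (h.abs_loc_le _) (abs_nonneg _)
    _ = (∑ j ∈ s, |κ j|) * (μ * (M * β)) := by
        rw [Finset.sum_mul]
        exact Finset.sum_congr rfl fun j _ => by ring
    _ ≤ C * (μ * (M * β)) := mul_le_mul_of_nonneg_right h.sum_abs_loc_le
        (mul_nonneg h.loc_nonneg (mul_nonneg h.lag_nonneg h.count_nonneg))
    _ = C * M * (μ * β) := by ring

lemma sum_diagonal_le (h : WeightBounds s W κ lam C M μ β) (t : ℤ) :
    ∑ j ∈ s, |κ j * lam (j - (j - t))| ≤ C * M := by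
  calc ∑ j ∈ s, |κ j * lam (j - (j - t))| ≤ ∑ j ∈ s, |κ j| * M := by
        refine Finset.sum_le_sum fun j _ => ?_
        rw [abs_mul]
        exact mul_le_mul_of_nonneg_left (h.abs_lag_le _) (abs_nonneg _)
    _ ≤ C * M := by
        rw [← Finset.sum_mul]
        exact mul_le_mul_of_nonneg_right h.sum_abs_loc_le h.lag_nonneg

end WeightBounds

/-! ### Consistency of localized quadratic forms under perturbation. -/

namespace MartingaleExpansion

variable {Ω E G : Type*} {mΩ : MeasurableSpace Ω} {P : Measure Ω} [IsProbabilityMeasure P]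
  [NormedAddCommGroup E] [InnerProductSpace ℝ E] [CompleteSpace E]
  [NormedAddCommGroup G] [InnerProductSpace ℝ G] [CompleteSpace G]
  {sig : Set ℤ → MeasurableSpace Ω} {v : ℤ → Lp E 4 P} {a : ℕ → ℤ → Lp E 4 P} {α : ℕ → ℝ}

/-- The inner sum over lags is taken of the process `v`, where the martingale inequality gives √β.
Bounding it termwise would give β ρ, but only β ρ² is assumed to vanish. -/
lemma norm_quadForm_left_le (h : MartingaleExpansion sig v a α) {L : E →L[ℝ] E →L[ℝ] G}
    (hL : ‖L‖ ≤ 1) {s W : Finset ℤ} {κ lam : ℤ → ℝ} {C M μ β ρ : ℝ}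
    (hw : WeightBounds s W κ lam C M μ β) {e : ℤ → Lp E 4 P} (hρ : 0 ≤ ρ)
    (he : ∀ i ∈ s, i ∈ W → ‖e i‖ ≤ ρ) :
    ‖quadForm L (fun j i => κ j * lam (j - i)) s e v‖
      ≤ 2 * (∑' k, α k) * C * (√(M * β) * ρ) := by
  have h1 : quadForm L (fun j i => κ j * lam (j - i)) s e v
      = ∑ j ∈ s, κ j • (L.holder 2 (e j) (∑ i ∈ s, lam (j - i) • v i) : Lp G 2 P) := by
    refine Finset.sum_congr rfl fun j _ => ?_
    rw [holder_sum_smul_right, Finset.smul_sum]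
    exact Finset.sum_congr rfl fun i _ => mul_smul _ _ _
  rw [h1]
  calc ‖∑ j ∈ s, κ j • (L.holder 2 (e j) (∑ i ∈ s, lam (j - i) • v i) : Lp G 2 P)‖
      ≤ ∑ j ∈ s, |κ j| * (ρ * (2 * (∑' k, α k) * √(M * β))) := by
        refine norm_sum_le_of_le _ fun j hj => ?_
        rw [norm_smul, Real.norm_eq_abs]
        by_cases hκ : κ j = 0
        · simp [hκ]
        refine mul_le_mul_of_nonneg_left ((norm_holder_le hL _ _).trans ?_) (abs_nonneg _)
        refine mul_le_mul (he j hj (hw.mem_window_left j hj hκ)) ?_ (norm_nonneg _) hρ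
        refine (h.norm_sum_smul_le_tsum _ s).trans (mul_le_mul_of_nonneg_left
          (Real.sqrt_le_sqrt (hw.sum_lag_left_sq_le j)) (mul_nonneg zero_le_two h.tsum_nonneg))
    _ = (∑ j ∈ s, |κ j|) * (ρ * (2 * (∑' k, α k) * √(M * β))) := by rw [Finset.sum_mul]
    _ ≤ C * (ρ * (2 * (∑' k, α k) * √(M * β))) :=
        mul_le_mul_of_nonneg_right hw.sum_abs_loc_le (mul_nonneg hρ (mul_nonneg
          (mul_nonneg zero_le_two h.tsum_nonneg) (Real.sqrt_nonneg _)))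
    _ = 2 * (∑' k, α k) * C * (√(M * β) * ρ) := by ring

/-- Here the localization weights sit inside the martingale sum, where they contribute `μ`. The
outer sum over `i` is restricted to the window, and its cardinality times `μ` is bounded by `C`. -/
lemma norm_quadForm_right_le (h : MartingaleExpansion sig v a α) {L : E →L[ℝ] E →L[ℝ] G}
    (hL : ‖L‖ ≤ 1) {s W : Finset ℤ} {κ lam : ℤ → ℝ} {C M μ β ρ : ℝ}
    (hw : WeightBounds s W κ lam C M μ β) {e : ℤ → Lp E 4 P} (hρ : 0 ≤ ρ)
    (he : ∀ i ∈ s, i ∈ W → ‖e i‖ ≤ ρ) :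
    ‖quadForm L (fun j i => κ j * lam (j - i)) s v e‖
      ≤ 2 * (∑' k, α k) * C * (√(M * β) * ρ) := by
  classical
  have h1 : quadForm L (fun j i => κ j * lam (j - i)) s v e
      = ∑ i ∈ s, (L.holder 2 (∑ j ∈ s, (κ j * lam (j - i)) • v j) (e i) : Lp G 2 P) := by
    rw [quadForm, Finset.sum_comm]
    exact Finset.sum_congr rfl fun i _ => (holder_sum_smul_left _ _ _ _ _).symm
  have h2 : ∑ i ∈ s, (L.holder 2 (∑ j ∈ s, (κ j * lam (j - i)) • v j) (e i) : Lp G 2 P)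
      = ∑ i ∈ s with i ∈ W,
        (L.holder 2 (∑ j ∈ s, (κ j * lam (j - i)) • v j) (e i) : Lp G 2 P) := by
    rw [Finset.sum_filter]
    refine Finset.sum_congr rfl fun i hi => ?_
    split_ifs with hiW
    · rfl
    · have : ∑ j ∈ s, (κ j * lam (j - i)) • v j = 0 := by
        refine Finset.sum_eq_zero fun j hj => ?_
        by_cases hκ : κ j = 0
        · simp [hκ]
        by_cases hl : lam (j - i) = 0
        · simp [hl]
        exact absurd (hw.mem_window_right j hj i hi hκ hl) hiW
      rw [this]
      exact map_zero ((L.holderₗ P 4 4 2).flip (e i))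
  have hA := h.tsum_nonneg
  rw [h1, h2]
  calc ‖∑ i ∈ s with i ∈ W, (L.holder 2 (∑ j ∈ s, (κ j * lam (j - i)) • v j) (e i) : Lp G 2 P)‖
      ≤ ∑ i ∈ s with i ∈ W, (2 * (∑' k, α k) * (μ * √(M * β))) * ρ := by
        refine norm_sum_le_of_le _ fun i hi => ?_
        rw [Finset.mem_filter] at hi
        refine (norm_holder_le hL _ _).trans (mul_le_mul ?_ (he i hi.1 hi.2) (norm_nonneg _)
          (mul_nonneg (mul_nonneg zero_le_two hA)
            (mul_nonneg hw.loc_nonneg (Real.sqrt_nonneg _))))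
        refine (h.norm_sum_smul_le_tsum _ s).trans (mul_le_mul_of_nonneg_left ?_
          (mul_nonneg zero_le_two hA))
        rw [← Real.sqrt_sq hw.loc_nonneg, ← Real.sqrt_mul (sq_nonneg _)]
        refine Real.sqrt_le_sqrt ?_
        calc ∑ j ∈ s, (κ j * lam (j - i)) ^ 2 ≤ ∑ j ∈ s, μ ^ 2 * lam (j - i) ^ 2 := by
              refine Finset.sum_le_sum fun j _ => ?_
              rw [mul_pow]
              refine mul_le_mul_of_nonneg_right ?_ (sq_nonneg _)
              exact sq_le_sq' (by linarith [neg_abs_le (κ j), hw.abs_loc_le j])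
                ((le_abs_self _).trans (hw.abs_loc_le j))
          _ ≤ μ ^ 2 * (M * β) := by
              rw [← Finset.mul_sum]
              exact mul_le_mul_of_nonneg_left (hw.sum_lag_right_sq_le i) (sq_nonneg _)
    _ ≤ W.card * ((2 * (∑' k, α k) * (μ * √(M * β))) * ρ) := by
        rw [Finset.sum_const, nsmul_eq_mul]
        refine mul_le_mul_of_nonneg_right ?_ (mul_nonneg (mul_nonneg (mul_nonneg zero_le_two hA)
            (mul_nonneg hw.loc_nonneg (Real.sqrt_nonneg _))) hρ)
        exact_mod_cast Finset.card_le_card fun i hi => (Finset.mem_filter.1 hi).2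
    _ = (W.card * μ) * (2 * (∑' k, α k) * (√(M * β) * ρ)) := by ring
    _ ≤ C * (2 * (∑' k, α k) * (√(M * β) * ρ)) :=
        mul_le_mul_of_nonneg_right hw.card_mul_le (mul_nonneg (mul_nonneg zero_le_two hA)
          (mul_nonneg (Real.sqrt_nonneg _) hρ))
    _ = 2 * (∑' k, α k) * C * (√(M * β) * ρ) := by ring

lemma norm_quadForm_le {L : E →L[ℝ] E →L[ℝ] G}
    (hL : ‖L‖ ≤ 1) {s W : Finset ℤ} {κ lam : ℤ → ℝ} {C M μ β ρ : ℝ}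
    (hw : WeightBounds s W κ lam C M μ β) {e : ℤ → Lp E 4 P} (hρ : 0 ≤ ρ)
    (he : ∀ i ∈ s, i ∈ W → ‖e i‖ ≤ ρ) :
    ‖quadForm L (fun j i => κ j * lam (j - i)) s e e‖ ≤ C * (β * ρ ^ 2) := by
  calc ‖quadForm L (fun j i => κ j * lam (j - i)) s e e‖
      ≤ ∑ j ∈ s, ∑ i ∈ s, |κ j| * (|lam (j - i)| * ρ ^ 2) := by
        refine norm_sum_le_of_le _ fun j hj => norm_sum_le_of_le _ fun i hi => ?_
        rw [norm_smul, Real.norm_eq_abs, abs_mul, mul_assoc]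
        by_cases hκ : κ j = 0
        · simp [hκ]
        by_cases hl : lam (j - i) = 0
        · simp [hl]
        refine mul_le_mul_of_nonneg_left (mul_le_mul_of_nonneg_left
          ((norm_holder_le hL _ _).trans ?_) (abs_nonneg _)) (abs_nonneg _)
        rw [pow_two]
        exact mul_le_mul (he j hj (hw.mem_window_left j hj hκ))
          (he i hi (hw.mem_window_right j hj i hi hκ hl)) (norm_nonneg _) hρ
    _ ≤ ∑ j ∈ s, |κ j| * (β * ρ ^ 2) := by
        refine Finset.sum_le_sum fun j _ => ?_
        rw [← Finset.mul_sum, ← Finset.sum_mul]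
        exact mul_le_mul_of_nonneg_left (mul_le_mul_of_nonneg_right (hw.sum_lag_left_le j)
          (sq_nonneg _)) (abs_nonneg _)
    _ ≤ C * (β * ρ ^ 2) := by
        rw [← Finset.sum_mul]
        exact mul_le_mul_of_nonneg_right hw.sum_abs_loc_le
          (mul_nonneg hw.count_nonneg (sq_nonneg _))

/-- Group the double sum by the lag `t = j - i`; negative lags carry zero weight. For fixed `t` the
shifted index eventually stays in the sample, so the coefficient tends to `lam' t`; it is at most `M
* C`, and the autocovariances are summable, so dominated convergence applies. -/
lemma tendsto_expectation_quadForm {L : E →L[ℝ] E →L[ℝ] G}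
    {Γ : ℕ → G} (hΓs : Summable fun t => ‖Γ t‖)
    (hΓ : ∀ (j : ℤ) (t : ℕ), expectationL P G (L.holder 2 (v j) (v (j - t))) = Γ t)
    {s W : ℕ → Finset ℤ} {κ lam : ℕ → ℤ → ℝ} {C M : ℝ} {μ β : ℕ → ℝ}
    (hw : ∀ᶠ n in atTop, WeightBounds (s n) (W n) (κ n) (lam n) C M (μ n) (β n))
    (hshift : ∀ t : ℕ, ∀ᶠ n in atTop, ∀ j ∈ s n, κ n j ≠ 0 → j - t ∈ s n)
    (hκ : Tendsto (fun n => ∑ j ∈ s n, κ n j) atTop (𝓝 1)) {lam' : ℕ → ℝ}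
    (hlam : ∀ t : ℕ, Tendsto (fun n => lam n t) atTop (𝓝 (lam' t))) :
    Tendsto (fun n => expectationL P G
      (quadForm L (fun j i => κ n j * lam n (j - i)) (s n) v v)) atTop
      (𝓝 (∑' t, lam' t • Γ t)) := by
  set F : ℕ → ℕ → G := fun n t =>
    ∑ j ∈ s n, ∑ i ∈ s n, if j - t = i then (κ n j * lam n t) • Γ t else 0
  have hF : ∀ n t, F n t = (lam n t * ∑ j ∈ s n, if j - t ∈ s n then κ n j else 0) • Γ t := by
    intro n t
    rw [Finset.mul_sum, Finset.sum_smul]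
    refine Finset.sum_congr rfl fun j _ => ?_
    rw [Finset.sum_ite_eq]
    split_ifs
    · rw [mul_comm]
    · simp
  have hsumF : ∀ᶠ n in atTop, ∑' t, F n t = expectationL P G
      (quadForm L (fun j i => κ n j * lam n (j - i)) (s n) v v) := by
    filter_upwards [hw] with n hn
    refine HasSum.tsum_eq ?_
    rw [quadForm, map_sum]
    refine hasSum_sum fun j _ => ?_
    rw [map_sum]
    refine hasSum_sum fun i _ => ?_
    rw [map_smul]
    rcases lt_or_ge (j - i) 0 with hji | hji
    · rw [hn.lag_neg _ hji, mul_zero, zero_smul]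
      convert hasSum_zero using 2 with t
      rw [if_neg (by omega)]
    · obtain ⟨t, ht⟩ := Int.eq_ofNat_of_zero_le hji
      have hi : i = j - t := by omega
      have h1 := hasSum_single (f := fun t' : ℕ =>
        if j - (t' : ℤ) = i then (κ n j * lam n t') • Γ t' else 0) t
        (fun t' ht' => if_neg (by omega))
      simp only [if_pos hi.symm] at h1
      rw [ht, hi, hΓ]
      rw [hi] at h1
      exact h1
  refine Tendsto.congr' hsumF (tendsto_tsum_of_dominated_convergence
    (bound := fun t => M * C * ‖Γ t‖) (hΓs.mul_left _) (fun t => ?_) ?_)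
  · simp_rw [hF]
    refine Tendsto.smul_const ?_ _
    rw [← mul_one (lam' t)]
    refine (hlam t).mul (hκ.congr' ?_)
    filter_upwards [hshift t] with n hn
    refine Finset.sum_congr rfl fun j hj => ?_
    split_ifs with hjt
    · rfl
    · by_contra hne
      exact hjt (hn j hj hne)
  · filter_upwards [hw] with n hn t
    rw [hF, norm_smul, Real.norm_eq_abs, abs_mul]
    refine mul_le_mul_of_nonneg_right (mul_le_mul (hn.abs_lag_le _) ?_ (abs_nonneg _)
      hn.lag_nonneg) (norm_nonneg _)
    refine (Finset.abs_sum_le_sum_abs _ _).trans (le_trans (Finset.sum_le_sum fun j _ => ?_)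
      hn.sum_abs_loc_le)
    split_ifs
    · exact le_rfl
    · simp

/-- Consistency of localized quadratic forms in a perturbed stationary process. -/
theorem tendsto_norm_quadForm_sub (h : MartingaleExpansion sig v a α) {L : E →L[ℝ] E →L[ℝ] G}
    (hL : ‖L‖ ≤ 1) {Γ : ℕ → G} (hΓs : Summable fun t => ‖Γ t‖)
    (hΓ : ∀ (j : ℤ) (t : ℕ), expectationL P G (L.holder 2 (v j) (v (j - t))) = Γ t)
    {s W : ℕ → Finset ℤ} {κ lam : ℕ → ℤ → ℝ} {C M : ℝ} {μ β ρ : ℕ → ℝ}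
    (hw : ∀ᶠ n in atTop, WeightBounds (s n) (W n) (κ n) (lam n) C M (μ n) (β n))
    (hshift : ∀ t : ℕ, ∀ᶠ n in atTop, ∀ j ∈ s n, κ n j ≠ 0 → j - t ∈ s n)
    (hκ : Tendsto (fun n => ∑ j ∈ s n, κ n j) atTop (𝓝 1)) {lam' : ℕ → ℝ}
    (hlam : ∀ t : ℕ, Tendsto (fun n => lam n t) atTop (𝓝 (lam' t)))
    (hμβ : Tendsto (fun n => μ n * β n) atTop (𝓝 0)) (hρ : ∀ n, 0 ≤ ρ n)
    (hβρ : Tendsto (fun n => β n * ρ n ^ 2) atTop (𝓝 0)) {y : ℕ → ℤ → Lp E 4 P}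
    (hy : ∀ᶠ n in atTop, ∀ i ∈ s n, i ∈ W n → ‖y n i - v i‖ ≤ ρ n) :
    Tendsto (fun n => ‖quadForm L (fun j i => κ n j * lam n (j - i)) (s n) (y n) (y n)
      - Lp.const 2 P (∑' t, lam' t • Γ t)‖) atTop (𝓝 0) := by
  have h1 : Tendsto (fun n => ‖centerL P G
      (quadForm L (fun j i => κ n j * lam n (j - i)) (s n) v v)‖) atTop (𝓝 0) := by
    refine h.tendsto_center_quadForm hL (A := fun n j i => κ n j * lam n (j - i)) (C := C * M)
      (hw.mono fun n hn t => hn.sum_diagonal_le t) ?_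
    refine squeeze_zero' (Eventually.of_forall fun n => Finset.sum_nonneg fun _ _ =>
      Finset.sum_nonneg fun _ _ => sq_nonneg _) (hw.mono fun n hn => hn.sum_sq_le) ?_
    simpa using hμβ.const_mul (C * M)
  have h2 := tendsto_iff_norm_sub_tendsto_zero.1
    (tendsto_expectation_quadForm hΓs hΓ hw hshift hκ hlam)
  have h3 : Tendsto (fun n => 2 * (2 * (∑' k, α k) * C * (√(M * β n) * ρ n))
      + C * (β n * ρ n ^ 2)) atTop (𝓝 0) := by
    have h4 : Tendsto (fun n => √(M * β n) * ρ n) atTop (𝓝 0) := by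
      -- The cross terms need no further condition: √(M β) ρ is the square root of M β ρ².
      have h5 := (Real.continuous_sqrt.tendsto _).comp (hβρ.const_mul M)
      rw [mul_zero, Real.sqrt_zero] at h5
      refine h5.congr fun n => ?_
      rw [Function.comp_apply, ← mul_assoc, Real.sqrt_mul' _ (sq_nonneg _), Real.sqrt_sq (hρ n)]
    have h6 := ((h4.const_mul (2 * (∑' k, α k) * C)).const_mul 2).add (hβρ.const_mul C)
    simpa using h6
  have h7 := (h1.add h2).add h3
  simp only [add_zero] at h7
  refine squeeze_zero' (Eventually.of_forall fun _ => norm_nonneg _) ?_ h7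
  filter_upwards [hw, hy] with n hn hyn
  set A : ℤ → ℤ → ℝ := fun j i => κ n j * lam n (j - i)
  set e : ℤ → Lp E 4 P := fun j => y n j - v j
  have hye : y n = fun j => v j + e j := by
    funext j
    simp [e]
  have hQ : quadForm L A (s n) (y n) (y n) = quadForm L A (s n) v v + quadForm L A (s n) v e
      + quadForm L A (s n) e v + quadForm L A (s n) e e := by
    rw [hye]
    exact quadForm_add L A (s n) v e v e
  have hc : quadForm L A (s n) v v = centerL P G (quadForm L A (s n) v v)
      + Lp.const 2 P (expectationL P G (quadForm L A (s n) v v)) := by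
    rw [centerL_apply, expectationL_apply, sub_add_cancel]
  -- Fluctuation, bias and perturbation error, matched with the three null sequences `h1`, `h2` and
  -- `h3`.
  have hdiff : quadForm L A (s n) (y n) (y n) - Lp.const 2 P (∑' t, lam' t • Γ t)
      = centerL P G (quadForm L A (s n) v v)
        + Lp.const 2 P (expectationL P G (quadForm L A (s n) v v) - ∑' t, lam' t • Γ t)
        + (quadForm L A (s n) v e + quadForm L A (s n) e v + quadForm L A (s n) e e) := by
    rw [hQ, map_sub]
    nth_rewrite 1 [hc]
    abel
  rw [hdiff]
  have b1 := h.norm_quadForm_right_le hL hn (hρ n) hyn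
  have b2 := h.norm_quadForm_left_le hL hn (hρ n) hyn
  have b3 := norm_quadForm_le hL hn (hρ n) hyn
  refine (norm_add_le _ _).trans (add_le_add ((norm_add_le _ _).trans
    (add_le_add le_rfl (norm_const_two _).le)) ?_)
  refine (norm_add_le _ _).trans (le_trans (add_le_add (norm_add_le _ _) le_rfl) ?_)
  linarith

end MartingaleExpansion

/-! ### Conditioning on one of two independent variables. -/

section IndependentPairs

variable {Ω C B E : Type*} [mΩ : MeasurableSpace Ω] {P : Measure Ω} [IsProbabilityMeasure P]
  [mC : MeasurableSpace C] [MeasurableSpace B] {W : Ω → C} {Z : Ω → B}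

/-- Independence on `Ω` is the same as using separate coordinates of `Ω × Ω`. This links the
couplings, which live on the product, with conditional expectations on `Ω`. -/
lemma map_prodMk_eq_map_prodMap (hW : Measurable W) (hZ : Measurable Z) (hi : IndepFun W Z P) :
    P.map (fun ω => (W ω, Z ω)) = (P.prod P).map (Prod.map W Z) := by
  rw [(indepFun_iff_map_prod_eq_prod_map_map hW.aemeasurable hZ.aemeasurable).1 hi,
    Measure.map_prod_map P P hW hZ]

variable [NormedAddCommGroup E]

lemma memLp_prodMap_of_indepFun {p : ℝ≥0∞} (hW : Measurable W) (hZ : Measurable Z)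
    (hi : IndepFun W Z P) {F : C × B → E} (hF : StronglyMeasurable F)
    (hp : MemLp (fun ω => F (W ω, Z ω)) p P) :
    MemLp (fun z : Ω × Ω => F (W z.1, Z z.2)) p (P.prod P) := by
  have h1 := memLp_map_measure_iff (μ := P) (p := p) (hF.aestronglyMeasurable)
    (hW.prodMk hZ).aemeasurable
  have h2 := memLp_map_measure_iff (μ := P.prod P) (p := p) (hF.aestronglyMeasurable)
    (hW.prodMap hZ).aemeasurable
  rw [map_prodMk_eq_map_prodMap hW hZ hi, h2] at h1
  exact h1.2 hp

variable [NormedSpace ℝ E]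

lemma integral_prodMap_of_indepFun (hW : Measurable W) (hZ : Measurable Z)
    (hi : IndepFun W Z P) {F : C × B → E} (hF : StronglyMeasurable F) :
    ∫ z : Ω × Ω, F (W z.1, Z z.2) ∂(P.prod P) = ∫ ω, F (W ω, Z ω) ∂P := by
  have h1 := integral_map (μ := P) (hW.prodMk hZ).aemeasurable
    (hF.aestronglyMeasurable (μ := P.map fun ω => (W ω, Z ω)))
  have h2 := integral_map (μ := P.prod P) (hW.prodMap hZ).aemeasurable
    (hF.aestronglyMeasurable (μ := (P.prod P).map (Prod.map W Z)))
  rw [map_prodMk_eq_map_prodMap hW hZ hi] at h1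
  exact h2.symm.trans h1

variable [CompleteSpace E]

/-- Conditioning on the first of two independent variables integrates out the second one. -/
lemma condExp_of_indepFun (hW : Measurable W) (hZ : Measurable Z) (hi : IndepFun W Z P)
    {F : C × B → E} (hF : StronglyMeasurable F) (hint : Integrable (fun ω => F (W ω, Z ω)) P) :
    P[fun ω => F (W ω, Z ω) | mC.comap W] =ᵐ[P] fun ω => ∫ ω', F (W ω, Z ω') ∂P := by
  have hprod : Integrable (fun z : Ω × Ω => F (W z.1, Z z.2)) (P.prod P) :=
    memLp_one_iff_integrable.1 (memLp_prodMap_of_indepFun hW hZ hi hF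
      (memLp_one_iff_integrable.2 hint))
  have hsm : StronglyMeasurable fun c => ∫ ω', F (c, Z ω') ∂P :=
    (hF.comp_measurable (measurable_id.prodMap hZ)).integral_prod_right'
  refine (ae_eq_condExp_of_forall_setIntegral_eq hW.comap_le hint
    (fun s _ _ => hprod.integral_prod_left.integrableOn) (fun s hs _ => ?_)
    (hsm.comp_measurable (comap_measurable W)).aestronglyMeasurable).symm
  obtain ⟨A, hA, rfl⟩ := hs
  have hF' : StronglyMeasurable ((A ×ˢ (Set.univ : Set B)).indicator F) :=
    hF.indicator (hA.prod MeasurableSet.univ)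
  have h1 := integral_prodMap_of_indepFun hW hZ hi hF'
  have hprod' : Integrable (fun z : Ω × Ω => (A ×ˢ (Set.univ : Set B)).indicator F
      (W z.1, Z z.2)) (P.prod P) := by
    refine (hprod.indicator ((hW hA).prod MeasurableSet.univ)).congr
      (Eventually.of_forall fun z => ?_)
    by_cases hz : W z.1 ∈ A <;> simp [Set.indicator, hz]
  rw [integral_prod _ hprod'] at h1
  rw [← integral_indicator (hW hA), ← integral_indicator (hW hA)]
  refine Eq.trans (integral_congr_ae (Eventually.of_forall fun ω => ?_)) (h1.trans
    (integral_congr_ae (Eventually.of_forall fun ω => ?_)))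
  · by_cases hz : W ω ∈ A <;> simp [Set.indicator, hz]
  · by_cases hz : W ω ∈ A <;> simp [Set.indicator, hz]

end IndependentPairs

/-! ### Innovations, their σ-algebras and truncations of the process. -/

section Innovations

variable {Ω S : Type*} [mΩ : MeasurableSpace Ω] [MeasurableSpace S] {P : Measure Ω}
  {ε : ℤ → Ω → S}

/-- The σ-algebra generated by the innovations with indices in `I`. -/
abbrev innovSigma (ε : ℤ → Ω → S) (I : Set ℤ) : MeasurableSpace Ω :=
  MeasurableSpace.comap (fun ω (i : I) => ε i ω) MeasurableSpace.pi

lemma innovSigma_eq_iSup (I : Set ℤ) :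
    innovSigma ε I = ⨆ i ∈ I, MeasurableSpace.comap (ε i) inferInstance := by
  rw [innovSigma, MeasurableSpace.pi, MeasurableSpace.comap_iSup, iSup_subtype']
  simp_rw [MeasurableSpace.comap_comp]
  rfl

lemma innovSigma_mono : Monotone (innovSigma ε) := fun I J hIJ => by
  rw [innovSigma_eq_iSup, innovSigma_eq_iSup]
  exact biSup_mono hIJ

lemma innovSigma_le (hε : ∀ j, Measurable (ε j)) (I : Set ℤ) : innovSigma ε I ≤ mΩ :=
  (measurable_pi_lambda _ fun _ => hε _).comap_le

lemma indep_innovSigma (hε : ∀ j, Measurable (ε j)) (hi : iIndepFun ε P) {I J : Set ℤ}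
    (hIJ : Disjoint I J) : Indep (innovSigma ε I) (innovSigma ε J) P := by
  rw [innovSigma_eq_iSup, innovSigma_eq_iSup]
  exact indep_iSup_of_disjoint (fun j => (hε j).comap_le) hi hIJ

lemma measurable_innov_innovSigma {I : Set ℤ} {i : ℤ} (h : i ∈ I) :
    Measurable[innovSigma ε I] (ε i) := by
  have h1 := comap_measurable (m := MeasurableSpace.pi) (fun ω (i : I) => ε i ω)
  exact (measurable_pi_apply (⟨i, h⟩ : I)).comp h1

/-- The innovations `ε_t, ε_{t-1}, …` -/
def past (ε : ℤ → Ω → S) (t : ℤ) (ω : Ω) : ℕ → S := fun k => ε (t - k) ω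

/-- The sequence with the first `m` terms of `x`, followed by those of `y`. -/
def splice (m : ℕ) (x y : ℕ → S) : ℕ → S := fun k => if k < m then x k else y k

lemma measurable_past (hε : ∀ j, Measurable (ε j)) (t : ℤ) : Measurable (past ε t) :=
  measurable_pi_lambda _ fun _ => hε _

lemma measurable_past_innovSigma (t : ℤ) : Measurable[innovSigma ε (Set.Iic t)] (past ε t) :=
  @measurable_pi_lambda Ω ℕ (fun _ => S) (innovSigma ε (Set.Iic t)) _ _ fun k =>
    measurable_innov_innovSigma (by simp)

lemma measurable_splice (m : ℕ) :
    Measurable fun z : (ℕ → S) × (ℕ → S) => splice m z.1 z.2 := by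
  refine measurable_pi_lambda _ fun k => ?_
  by_cases hk : k < m
  · simpa [splice, hk, Function.comp_def] using (measurable_pi_apply k).comp measurable_fst
  · simpa [splice, hk, Function.comp_def] using (measurable_pi_apply k).comp measurable_snd

lemma splice_self (m : ℕ) (x : ℕ → S) : splice m x x = x := by
  funext k; simp [splice]

lemma splice_zero (x y : ℕ → S) : splice 0 x y = y := by
  funext k; simp [splice]

variable [IsProbabilityMeasure P]

/-- The law of the past is the infinite product of the common law of the innovations, whatever the
time. All stationarity needed below comes from this. -/
lemma map_past_eq (hε : ∀ j, Measurable (ε j)) (hi : iIndepFun ε P)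
    (hid : ∀ j, IdentDistrib (ε j) (ε 0) P P) (t : ℤ) : P.map (past ε t) = P.map (past ε 0) := by
  have h : ∀ t : ℤ, P.map (past ε t) = Measure.infinitePi fun _ : ℕ => P.map (ε 0) := by
    intro t
    have hinj : Function.Injective fun k : ℕ => t - (k : ℤ) := fun a b hab => by
      simpa using hab
    have h1 := (hi.precomp hinj).map_fun_eq_infinitePi_map (fun k => hε _)
    simp_rw [fun j => (hid j).map_eq] at h1
    exact h1
  rw [h t, h 0]

variable {E : Type*} [NormedAddCommGroup E] {f : (ℕ → S) → E}

/-- Splitting the innovations at time `t - m`, before which they are replaced by a copy. -/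
lemma exists_split (hε : ∀ j, Measurable (ε j)) (hi : iIndepFun ε P) (hf : StronglyMeasurable f)
    (t : ℤ) (m : ℕ) {I J : Set ℤ} (hIJ : Disjoint I J) (hI : ∀ k : ℕ, k < m → t - k ∈ I)
    (hJ : ∀ k : ℕ, m ≤ k → t - k ∈ J) :
    ∃ F : (I → S) × (J → S) → E, StronglyMeasurable F ∧
      IndepFun (fun ω (i : I) => ε i ω) (fun ω (i : J) => ε i ω) P ∧
      ∀ ω ω', F (fun i => ε i ω, fun i => ε i ω') = f (splice m (past ε t ω) (past ε t ω')) := by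
  refine ⟨fun z => f fun k => if h : k < m then z.1 ⟨t - k, hI k h⟩
    else z.2 ⟨t - k, hJ k (not_lt.1 h)⟩, ?_, ?_, ?_⟩
  · refine hf.comp_measurable (measurable_pi_lambda _ fun k => ?_)
    by_cases hk : k < m
    · simpa [hk, Function.comp_def] using (measurable_pi_apply _).comp measurable_fst
    · simpa [hk, Function.comp_def] using (measurable_pi_apply _).comp measurable_snd
  · exact indep_innovSigma hε hi hIJ
  · intro ω ω'
    refine congrArg f (funext fun k => ?_)
    simp only [splice, past, dite_eq_ite]

/-- Replacing the older innovations by an independent copy does not change the law. -/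
lemma memLp_splice (hε : ∀ j, Measurable (ε j)) (hi : iIndepFun ε P) (hf : StronglyMeasurable f)
    {p : ℝ≥0∞} {t : ℤ} (hp : MemLp (fun ω => f (past ε t ω)) p P) (m : ℕ) :
    MemLp (fun z : Ω × Ω => f (splice m (past ε t z.1) (past ε t z.2))) p (P.prod P) := by
  obtain ⟨F, hF, hind, hFf⟩ := exists_split (I := Set.Ioi (t - m)) (J := Set.Iic (t - m)) hε hi hf
    t m (Set.disjoint_left.2 fun i h1 h2 => not_lt.2 (Set.mem_Iic.1 h2) (Set.mem_Ioi.1 h1))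
    (fun k hk => by simp; omega) (fun k hk => by simp; omega)
  have := memLp_prodMap_of_indepFun (p := p) (measurable_pi_lambda _ fun _ => hε _)
    (measurable_pi_lambda _ fun _ => hε _) hind hF (by simpa only [hFf, splice_self] using hp)
  simpa only [hFf] using this

lemma couplingError_eq {p : ℝ≥0∞} (t : ℤ) (m : ℕ) : couplingError P p ε f t m
    = eLpNorm (fun z : Ω × Ω => f (past ε t z.1) - f (splice m (past ε t z.1) (past ε t z.2))) p
      (P.prod P) := rfl

lemma couplingError_lt_top (hε : ∀ j, Measurable (ε j)) (hi : iIndepFun ε P)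
    (hf : StronglyMeasurable f) {p : ℝ≥0∞} {t : ℤ} (hp : MemLp (fun ω => f (past ε t ω)) p P)
    (m : ℕ) : couplingError P p ε f t m < ∞ := by
  rw [couplingError_eq]
  exact ((hp.comp_fst P).sub (memLp_splice hε hi hf hp m)).2

/-- The coupling error depends only on the law of the past, which does not vary with time. -/
lemma couplingError_eq_zero_time (hε : ∀ j, Measurable (ε j)) (hi : iIndepFun ε P)
    (hid : ∀ j, IdentDistrib (ε j) (ε 0) P P) (hf : StronglyMeasurable f) {p : ℝ≥0∞} (t : ℤ)
    (m : ℕ) : couplingError P p ε f t m = couplingError P p ε f 0 m := by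
  have h : ∀ t : ℤ, couplingError P p ε f t m
      = eLpNorm (fun z : (ℕ → S) × (ℕ → S) => f z.1 - f (splice m z.1 z.2)) p
        ((P.map (past ε t)).prod (P.map (past ε t))) := by
    intro t
    have hg : StronglyMeasurable fun z : (ℕ → S) × (ℕ → S) => f z.1 - f (splice m z.1 z.2) :=
      (hf.comp_measurable measurable_fst).sub (hf.comp_measurable (measurable_splice m))
    have hm := measurable_past hε t
    rw [Measure.map_prod_map P P hm hm,
      eLpNorm_map_measure hg.aestronglyMeasurable (hm.prodMap hm).aemeasurable]
    rfl
  rw [h t, h 0, map_past_eq hε hi hid t]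

variable [NormedSpace ℝ E]

/-- The average of `f (ε_t, ε_{t-1}, …)` over the innovations with indices at most `t - m`. -/
def truncation (P : Measure Ω) (ε : ℤ → Ω → S) (f : (ℕ → S) → E) (m : ℕ) (t : ℤ) (ω : Ω) : E :=
  ∫ ω', f (splice m (past ε t ω) (past ε t ω')) ∂P

lemma stronglyMeasurable_truncation (hε : ∀ j, Measurable (ε j)) (hi : iIndepFun ε P)
    (hf : StronglyMeasurable f) (t : ℤ) (m : ℕ) {I : Set ℤ} (hI : Set.Ioc (t - m) t ⊆ I) :
    StronglyMeasurable[innovSigma ε I] (truncation P ε f m t) := by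
  obtain ⟨F, hF, -, hFf⟩ := exists_split (I := Set.Ioc (t - m) t) (J := Set.Iic (t - m)) hε hi hf
    t m (Set.disjoint_left.2 fun i h1 h2 => not_lt.2 h2 h1.1)
    (fun k hk => by simp; omega) (fun k hk => by simp; omega)
  have h1 : StronglyMeasurable fun c => ∫ ω', F (c, fun i => ε i ω') ∂P :=
    (hF.comp_measurable (measurable_id.prodMap (measurable_pi_lambda _ fun _ =>
      hε _))).integral_prod_right'
  have h2 := h1.comp_measurable (comap_measurable (fun ω (i : Set.Ioc (t - (m : ℤ)) t) => ε i ω))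
  have h3 : StronglyMeasurable[innovSigma ε (Set.Ioc (t - (m : ℤ)) t)] (truncation P ε f m t) := by
    refine Eq.mp ?_ h2
    congr 1
    funext ω
    simp only [Function.comp_apply, hFf, truncation]
  exact h3.mono (innovSigma_mono hI)

variable [CompleteSpace E]

/-- The conditioning includes the innovations after `t`, which are irrelevant to the value but
needed for the reverse martingale structure: averaging out the old innovations amounts to
conditioning on all later ones. -/
lemma condExp_past_eq_truncation (hε : ∀ j, Measurable (ε j)) (hi : iIndepFun ε P)
    (hf : StronglyMeasurable f) {t : ℤ} (hint : Integrable (fun ω => f (past ε t ω)) P) (m : ℕ) :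
    P[fun ω => f (past ε t ω) | innovSigma ε (Set.Ioi (t - m))] =ᵐ[P] truncation P ε f m t := by
  obtain ⟨F, hF, hind, hFf⟩ := exists_split (I := Set.Ioi (t - m)) (J := Set.Iic (t - m)) hε hi hf
    t m (Set.disjoint_left.2 fun i h1 h2 => not_lt.2 (Set.mem_Iic.1 h2) (Set.mem_Ioi.1 h1))
    (fun k hk => by simp; omega) (fun k hk => by simp; omega)
  have := condExp_of_indepFun (measurable_pi_lambda _ fun _ => hε _)
    (measurable_pi_lambda _ fun _ => hε _) hind hF (by simpa only [hFf, splice_self] using hint)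
  simp only [hFf, splice_self] at this
  exact this

/-- Jensen in the second coordinate: on a probability space the norm of the averaged difference is
at most its L¹ norm, hence its L^p norm. Fubini then assembles the product norm. -/
lemma eLpNorm_sub_integral_le {p : ℝ≥0∞} (hp1 : 1 ≤ p) (hp : p ≠ ∞) {g : Ω × Ω → E} {φ : Ω → E}
    (hφ : MemLp φ p P) (hg : MemLp g p (P.prod P)) :
    eLpNorm (fun ω => φ ω - ∫ ω', g (ω, ω') ∂P) p P
      ≤ eLpNorm (fun z : Ω × Ω => φ z.1 - g z) p (P.prod P) := by
  have hp0 : p ≠ 0 := (zero_lt_one.trans_le hp1).ne'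
  have hd : MemLp (fun z : Ω × Ω => φ z.1 - g z) p (P.prod P) := (hφ.comp_fst P).sub hg
  have hr : 0 < p.toReal := ENNReal.toReal_pos hp0 hp
  rw [eLpNorm_eq_lintegral_rpow_enorm_toReal hp0 hp, eLpNorm_eq_lintegral_rpow_enorm_toReal hp0 hp]
  refine ENNReal.rpow_le_rpow ?_ (by positivity)
  rw [lintegral_prod _ (hd.1.enorm.pow_const _)]
  refine lintegral_mono_ae ?_
  filter_upwards [(hg.integrable hp1).prod_right_ae, hd.1.prodMk_left] with ω h1 h2
  have h3 : φ ω - ∫ ω', g (ω, ω') ∂P = ∫ ω', (φ ω - g (ω, ω')) ∂P := by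
    rw [integral_sub (integrable_const _) h1, integral_const]
    simp
  have h4 : ‖φ ω - ∫ ω', g (ω, ω') ∂P‖ₑ ≤ eLpNorm (fun ω' => φ ω - g (ω, ω')) p P := by
    rw [h3]
    refine (enorm_integral_le_lintegral_enorm _).trans ?_
    rw [← eLpNorm_one_eq_lintegral_enorm]
    exact eLpNorm_le_eLpNorm_of_exponent_le hp1 h2
  refine (ENNReal.rpow_le_rpow h4 hr.le).trans ?_
  rw [eLpNorm_eq_lintegral_rpow_enorm_toReal hp0 hp, ← ENNReal.rpow_mul, one_div,
    inv_mul_cancel₀ hr.ne', ENNReal.rpow_one]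

lemma eLpNorm_sub_truncation_le (hε : ∀ j, Measurable (ε j)) (hi : iIndepFun ε P)
    (hf : StronglyMeasurable f) {p : ℝ≥0∞} (hp1 : 1 ≤ p) (hp : p ≠ ∞) {t : ℤ}
    (hmem : MemLp (fun ω => f (past ε t ω)) p P) (m : ℕ) :
    eLpNorm (fun ω => f (past ε t ω) - truncation P ε f m t ω) p P
      ≤ couplingError P p ε f t m := by
  rw [couplingError_eq]
  exact eLpNorm_sub_integral_le (g := fun z => f (splice m (past ε t z.1) (past ε t z.2)))
    (φ := fun ω => f (past ε t ω)) hp1 hp hmem (memLp_splice hε hi hf hmem m)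

end Innovations

/-! ### The martingale expansion of an approximable process and its autocovariances. -/

namespace IsLpMApproximable

variable {Ω S E G : Type*} [mΩ : MeasurableSpace Ω] [MeasurableSpace S] {P : Measure Ω}
  [IsProbabilityMeasure P] [NormedAddCommGroup E] [InnerProductSpace ℝ E] [CompleteSpace E]
  [NormedAddCommGroup G] [InnerProductSpace ℝ G] [CompleteSpace G]
  {ε : ℤ → Ω → S} {f : (ℕ → S) → E} {Y : ℤ → Ω → E}

lemma memLp_past (h : IsLpMApproximable P 4 ε f Y) (t : ℤ) :
    MemLp (fun ω => f (past ε t ω)) 4 P := (h.memLp t).ae_eq (h.repr t)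

/-- The process as a sequence in `L⁴`. -/
def toLp (h : IsLpMApproximable P 4 ε f Y) (t : ℤ) : Lp E 4 P := (h.memLp t).toLp (Y t)

lemma coeFn_toLp (h : IsLpMApproximable P 4 ε f Y) (t : ℤ) :
    h.toLp t =ᵐ[P] fun ω => f (past ε t ω) := (MemLp.coeFn_toLp _).trans (h.repr t)

/-- The coupling errors as real numbers. -/
def couplingNorm (_ : IsLpMApproximable P 4 ε f Y) (m : ℕ) : ℝ :=
  (couplingError P 4 ε f 0 m).toReal

lemma couplingNorm_nonneg (h : IsLpMApproximable P 4 ε f Y) (m : ℕ) : 0 ≤ h.couplingNorm m :=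
  ENNReal.toReal_nonneg

lemma summable_couplingNorm (h : IsLpMApproximable P 4 ε f Y) : Summable h.couplingNorm :=
  (summable_nat_add_iff 1).1 (ENNReal.summable_toReal (h.summable 0).ne)

lemma aestronglyMeasurable_truncation (h : IsLpMApproximable P 4 ε f Y) (m : ℕ) (t : ℤ) :
    AEStronglyMeasurable (truncation P ε f m t) P :=
  ((stronglyMeasurable_truncation h.measurable_innov h.indep_innov h.measurable_repr t m
    subset_rfl).mono (innovSigma_le h.measurable_innov _)).aestronglyMeasurable

lemma eLpNorm_sub_truncation_le (h : IsLpMApproximable P 4 ε f Y) (m : ℕ) (t : ℤ) :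
    eLpNorm (fun ω => f (past ε t ω) - truncation P ε f m t ω) 4 P
      ≤ couplingError P 4 ε f 0 m := by
  rw [← couplingError_eq_zero_time h.measurable_innov h.indep_innov h.identDistrib_innov
    h.measurable_repr t m]
  exact LSFTS.eLpNorm_sub_truncation_le h.measurable_innov h.indep_innov h.measurable_repr
    (by norm_num) (by norm_num) (h.memLp_past t) m

lemma couplingError_ne_top (h : IsLpMApproximable P 4 ε f Y) (m : ℕ) :
    couplingError P 4 ε f 0 m ≠ ∞ :=
  (couplingError_lt_top h.measurable_innov h.indep_innov h.measurable_repr (h.memLp_past 0) m).ne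

lemma memLp_truncation (h : IsLpMApproximable P 4 ε f Y) (m : ℕ) (t : ℤ) :
    MemLp (truncation P ε f m t) 4 P := by
  have h1 : MemLp (fun ω => f (past ε t ω) - truncation P ε f m t ω) 4 P :=
    ⟨(h.memLp_past t).1.sub (h.aestronglyMeasurable_truncation m t),
      (h.eLpNorm_sub_truncation_le m t).trans_lt (h.couplingError_ne_top m).lt_top⟩
  refine ((h.memLp_past t).sub h1).ae_eq (Eventually.of_forall fun ω => ?_)
  simp

/-- The truncations of the process as elements of `L⁴`. -/
def truncLp (h : IsLpMApproximable P 4 ε f Y) (m : ℕ) (t : ℤ) : Lp E 4 P :=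
  (h.memLp_truncation m t).toLp _

lemma coeFn_truncLp (h : IsLpMApproximable P 4 ε f Y) (m : ℕ) (t : ℤ) :
    h.truncLp m t =ᵐ[P] truncation P ε f m t := MemLp.coeFn_toLp _

lemma norm_toLp_sub_truncLp_le (h : IsLpMApproximable P 4 ε f Y) (m : ℕ) (t : ℤ) :
    ‖h.toLp t - h.truncLp m t‖ ≤ h.couplingNorm m := by
  rw [Lp.norm_def]
  refine ENNReal.toReal_mono (h.couplingError_ne_top m) ?_
  refine le_trans (eLpNorm_congr_ae ?_).le (h.eLpNorm_sub_truncation_le m t)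
  filter_upwards [Lp.coeFn_sub (h.toLp t) (h.truncLp m t), h.coeFn_toLp t,
    h.coeFn_truncLp m t] with ω h1 h2 h3
  rw [h1, Pi.sub_apply, h2, h3]

lemma truncLp_mem_lpMeas (h : IsLpMApproximable P 4 ε f Y) {m : ℕ} {t : ℤ} {I : Set ℤ}
    (hI : Set.Ioc (t - m) t ⊆ I) : h.truncLp m t ∈ lpMeas E ℝ (innovSigma ε I) 4 P := by
  rw [mem_lpMeas_iff_aestronglyMeasurable]
  exact (stronglyMeasurable_truncation h.measurable_innov h.indep_innov h.measurable_repr t m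
    hI).aestronglyMeasurable.congr (h.coeFn_truncLp m t).symm

lemma toLp_mem_lpMeas (h : IsLpMApproximable P 4 ε f Y) (t : ℤ) :
    h.toLp t ∈ lpMeas E ℝ (innovSigma ε (Set.Iic t)) 4 P := by
  rw [mem_lpMeas_iff_aestronglyMeasurable]
  exact (h.measurable_repr.comp_measurable
    (measurable_past_innovSigma t)).aestronglyMeasurable.congr (h.coeFn_toLp t).symm

lemma condExp_toLp (h : IsLpMApproximable P 4 ε f Y) (m : ℕ) (t : ℤ) :
    P[h.toLp t | innovSigma ε (Set.Ioi (t - m))] =ᵐ[P] h.truncLp m t :=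
  (condExp_congr_ae (h.coeFn_toLp t)).trans ((condExp_past_eq_truncation h.measurable_innov
    h.indep_innov h.measurable_repr ((h.memLp_past t).integrable (by norm_num)) m).trans
      (h.coeFn_truncLp m t).symm)

/-- At depth zero every innovation is averaged out, leaving the mean. This starts the telescoping
sum. -/
lemma truncLp_zero (h : IsLpMApproximable P 4 ε f Y) (hY : ∀ t, ∫ ω, Y t ω ∂P = 0) (t : ℤ) :
    h.truncLp 0 t = 0 := by
  refine Lp.ext ((h.coeFn_truncLp 0 t).trans ?_)
  refine EventuallyEq.trans (Eventually.of_forall fun ω => ?_) (Lp.coeFn_zero E 4 P).symm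
  simp only [truncation, splice_zero, Pi.zero_apply]
  rw [← hY t]
  exact (integral_congr_ae (h.repr t)).symm

/-- The martingale expansion of an `L⁴`-`m`-approximable process. -/
lemma martingaleExpansion (h : IsLpMApproximable P 4 ε f Y) (hY : ∀ t, ∫ ω, Y t ω ∂P = 0) :
    MartingaleExpansion (innovSigma ε) h.toLp (fun k j => h.truncLp (k + 1) j - h.truncLp k j)
      (fun k => h.couplingNorm (k + 1) + h.couplingNorm k) where
  mono := innovSigma_mono
  le := innovSigma_le h.measurable_innov
  indep I J hIJ := indep_innovSigma h.measurable_innov h.indep_innov hIJ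
  mem_lpMeas k j := by
    refine Submodule.sub_mem _ (h.truncLp_mem_lpMeas ?_) (h.truncLp_mem_lpMeas ?_)
    · intro i hi
      simp only [Set.mem_Ioc, Set.mem_Icc] at hi ⊢
      push_cast at hi
      omega
    · intro i hi
      simp only [Set.mem_Ioc, Set.mem_Icc] at hi ⊢
      omega
  condExp_eq_zero k j := by
    have hle := innovSigma_le (ε := ε) h.measurable_innov
    have hset : Set.Ici (j - (k : ℤ) + 1) = Set.Ioi (j - (k : ℤ)) := by
      ext i; simp only [Set.mem_Ici, Set.mem_Ioi]; omega
    rw [hset]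
    have hint : ∀ m, Integrable (h.truncLp m j) P := fun m =>
      (Lp.memLp _).integrable (q := 4) (by norm_num)
    -- The tower property: dropping one more old innovation from the conditioning takes the
    -- truncation at depth `k + 1` to that at depth `k`.
    have h1 : P[h.truncLp (k + 1) j | innovSigma ε (Set.Ioi (j - (k : ℤ)))]
        =ᵐ[P] h.truncLp k j := by
      refine (condExp_congr_ae (h.condExp_toLp (k + 1) j).symm).trans ?_
      refine (condExp_condExp_of_le (innovSigma_mono (Set.Ioi_subset_Ioi ?_)) (hle _)).trans
        (h.condExp_toLp k j)
      push_cast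
      omega
    have h2 : P[h.truncLp k j | innovSigma ε (Set.Ioi (j - (k : ℤ)))] =ᵐ[P] h.truncLp k j :=
      condExp_of_aestronglyMeasurable' (hle _) (mem_lpMeas_iff_aestronglyMeasurable.1
        (h.truncLp_mem_lpMeas Set.Ioc_subset_Ioi_self)) (hint k)
    have h3 : P[⇑(h.truncLp (k + 1) j - h.truncLp k j) | innovSigma ε (Set.Ioi (j - (k : ℤ)))]
        =ᵐ[P] P[⇑(h.truncLp (k + 1) j) - ⇑(h.truncLp k j) |
          innovSigma ε (Set.Ioi (j - (k : ℤ)))] := condExp_congr_ae (Lp.coeFn_sub _ _)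
    filter_upwards [h3, condExp_sub (hint (k + 1)) (hint k)
      (innovSigma ε (Set.Ioi (j - (k : ℤ)))), h1, h2] with ω e3 e4 e1 e2
    rw [e3, e4, Pi.sub_apply, e1, e2, sub_self, Pi.zero_apply]
  norm_le k j := by
    have h1 : h.truncLp (k + 1) j - h.truncLp k j
        = (h.toLp j - h.truncLp k j) - (h.toLp j - h.truncLp (k + 1) j) := by abel
    rw [h1]
    exact ((norm_sub_le _ _).trans (add_le_add (h.norm_toLp_sub_truncLp_le k j)
      (h.norm_toLp_sub_truncLp_le (k + 1) j))).trans_eq (add_comm _ _)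
  summable := ((summable_nat_add_iff (f := h.couplingNorm) 1).2
    h.summable_couplingNorm).add h.summable_couplingNorm
  tendsto_sum j := by
    simp_rw [Finset.sum_range_sub (fun k => h.truncLp k j), h.truncLp_zero hY, sub_zero]
    rw [tendsto_iff_norm_sub_tendsto_zero]
    refine squeeze_zero (fun _ => norm_nonneg _) (fun m => ?_)
      h.summable_couplingNorm.tendsto_atTop_zero
    rw [norm_sub_rev]
    exact h.norm_toLp_sub_truncLp_le m j

variable (L : E →L[ℝ] E →L[ℝ] G)

lemma expectationL_holder (x y : Lp E 4 P) :
    expectationL P G (L.holder 2 x y) = ∫ ω, L (x ω) (y ω) ∂P :=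
  integral_congr_ae (L.coeFn_holder x y)

/-- Both factors are functions of the past at time `j`, the second through a shift by `t`, so the
expectation depends only on the law of that past. -/
lemma expectationL_holder_shift (h : IsLpMApproximable P 4 ε f Y) (j : ℤ) (t : ℕ) :
    expectationL P G (L.holder 2 (h.toLp j) (h.toLp (j - t)))
      = expectationL P G (L.holder 2 (h.toLp 0) (h.toLp (-t))) := by
  have key : ∀ j : ℤ, expectationL P G (L.holder 2 (h.toLp j) (h.toLp (j - t)))
      = ∫ x, L (f x) (f fun k => x (t + k)) ∂(P.map (past ε j)) := by
    intro j
    have hm : StronglyMeasurable fun x : ℕ → S => L (f x) (f fun k => x (t + k)) :=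
      L.continuous₂.comp_stronglyMeasurable (h.measurable_repr.prodMk
        (h.measurable_repr.comp_measurable (measurable_pi_lambda _ fun k =>
          measurable_pi_apply (t + k))))
    rw [integral_map (measurable_past h.measurable_innov j).aemeasurable hm.aestronglyMeasurable,
      expectationL_holder]
    refine integral_congr_ae ?_
    filter_upwards [h.coeFn_toLp j, h.coeFn_toLp (j - t)] with ω h1 h2
    rw [h1, h2]
    congr 2
    funext k
    simp only [past]
    congr 1
    push_cast
    ring
  have h0 := key 0
  rw [zero_sub] at h0
  rw [key j, h0, map_past_eq h.measurable_innov h.indep_innov h.identDistrib_innov j]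

/-- Truncated at depth `t`, the value at time 0 uses only innovations after `-t`. It is then
independent of the mean-zero value at time `-t`, so the lag-`t` covariance costs at most the
coupling error at depth `t` times a constant. -/
lemma summable_norm_expectationL (h : IsLpMApproximable P 4 ε f Y)
    (hY : ∀ t, ∫ ω, Y t ω ∂P = 0) {L : E →L[ℝ] E →L[ℝ] G} (hL : ‖L‖ ≤ 1) :
    Summable fun t : ℕ => ‖expectationL P G (L.holder 2 (h.toLp 0) (h.toLp (-t)))‖ := by
  have hexp := h.martingaleExpansion hY
  have hle := innovSigma_le (ε := ε) h.measurable_innov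
  refine Summable.of_nonneg_of_le (fun _ => norm_nonneg _) (fun t => ?_)
    (h.summable_couplingNorm.mul_right (2 * ∑' k, (h.couplingNorm (k + 1) + h.couplingNorm k)))
  have hint : Integrable (h.toLp (-t)) P := (Lp.memLp _).integrable (q := 4) (by norm_num)
  have hmean : ∫ ω, h.toLp (-t) ω ∂P = 0 := by
    rw [← hY (-t)]
    exact integral_congr_ae (MemLp.coeFn_toLp _)
  have h0 : expectationL P G (L.holder 2 (h.truncLp t 0) (h.toLp (-t))) = 0 := by
    rw [expectationL_holder]
    refine integral_bilin_eq_zero (hle (Set.Ioi (-t))) L (mem_lpMeas_iff_aestronglyMeasurable.1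
      (h.truncLp_mem_lpMeas (by rw [zero_sub]; exact Set.Ioc_subset_Ioi_self))) hint ?_ ?_
    · refine (condExp_eq_integral_of_indep (hle (Set.Iic (-t))) (hle _)
        (mem_lpMeas_iff_aestronglyMeasurable.1 (h.toLp_mem_lpMeas (-t)))
        (hexp.indep _ _ (Set.disjoint_left.2 fun i h1 h2 => ?_))).trans
          (Eventually.of_forall fun _ => hmean)
      exact not_lt.2 (Set.mem_Iic.1 h1) (Set.mem_Ioi.1 h2)
    · exact ((Lp.memLp (L.holder 2 (h.truncLp t 0) (h.toLp (-t)) : Lp G 2 P)).integrable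
        (by norm_num)).congr (L.coeFn_holder _ _)
  have h1 : expectationL P G (L.holder 2 (h.toLp 0) (h.toLp (-t)))
      = expectationL P G (L.holder 2 (h.toLp 0 - h.truncLp t 0) (h.toLp (-t))) := by
    have h2 : (L.holder 2 (h.toLp 0 - h.truncLp t 0) (h.toLp (-t)) : Lp G 2 P)
        = L.holder 2 (h.toLp 0) (h.toLp (-t)) - L.holder 2 (h.truncLp t 0) (h.toLp (-t)) :=
      map_sub ((L.holderₗ P 4 4 2).flip (h.toLp (-t))) _ _
    rw [h2, map_sub, h0, sub_zero]
  rw [h1]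
  refine (norm_expectationL_apply_le _).trans ((norm_holder_le hL _ _).trans ?_)
  exact mul_le_mul (h.norm_toLp_sub_truncLp_le t 0) (hexp.norm_le_tsum _) (norm_nonneg _)
    (h.couplingNorm_nonneg t)

end IsLpMApproximable

/-! ### The concrete weights and the Riemann-sum error. -/

section Weights

/-- The localization weight `(T h)⁻¹ K₁((u - j/T)/h)`. -/
def locWeight (K₁ : ℝ → ℝ) (h u : ℝ) (T : ℕ) (j : ℤ) : ℝ :=
  1 / ((T : ℝ) * h) * K₁ ((u - (j : ℝ) / T) / h)

/-- The lag weight `K₂(t/b)` for positive lags. -/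
def lagWeight (K₂ : ℝ → ℝ) (b : ℝ) (t : ℤ) : ℝ := if 1 ≤ t then K₂ ((t : ℝ) / b) else 0

/-- The lag weight selecting lag zero. -/
def zeroLagWeight (t : ℤ) : ℝ := if t = 0 then 1 else 0

/-- The times `j` with `|j/T - u| ≤ r`. -/
def timeWindow (r u : ℝ) (T : ℕ) : Finset ℤ := Finset.Icc ⌈(T : ℝ) * (u - r)⌉ ⌊(T : ℝ) * (u + r)⌋

lemma mem_timeWindow {r u : ℝ} {T : ℕ} (hT : 0 < (T : ℝ)) {j : ℤ} :
    j ∈ timeWindow r u T ↔ |(j : ℝ) / T - u| ≤ r := by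
  rw [timeWindow, Finset.mem_Icc, Int.ceil_le, Int.le_floor, abs_le, neg_le_sub_iff_le_add,
    sub_le_iff_le_add, div_le_iff₀ hT, ← sub_le_iff_le_add, le_div_iff₀ hT, mul_comm (T : ℝ),
    mul_comm (T : ℝ), add_comm r u]

lemma card_timeWindow_le {r u : ℝ} {T : ℕ} (hr : 0 ≤ r) :
    ((timeWindow r u T).card : ℝ) ≤ 2 * (T * r) + 1 := by
  have hTr : 0 ≤ (T : ℝ) * r := mul_nonneg (Nat.cast_nonneg _) hr
  rw [timeWindow, Int.card_Icc]
  have h1 := Int.floor_le ((T : ℝ) * (u + r))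
  have h2 := Int.le_ceil ((T : ℝ) * (u - r))
  set p := ⌊(T : ℝ) * (u + r)⌋
  set q := ⌈(T : ℝ) * (u - r)⌉
  have h3 : (((p + 1 - q).toNat : ℤ) : ℝ) ≤ 2 * (T * r) + 1 := by
    rw [Int.toNat_eq_max]
    push_cast
    exact max_le (by linarith) (by linarith)
  exact_mod_cast h3

lemma sum_comp_le_card_mul {φ : ℤ → ℝ} {F : Finset ℤ} {M : ℝ} (h0 : ∀ t, t ∉ F → φ t = 0)
    (hM : ∀ t, φ t ≤ M) (hM0 : 0 ≤ M) {e : ℤ → ℤ} (he : Function.Injective e) (s : Finset ℤ) :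
    ∑ i ∈ s, φ (e i) ≤ F.card * M := by
  have h1 : ∑ i ∈ s, φ (e i) = ∑ i ∈ s with e i ∈ F, φ (e i) := by
    rw [Finset.sum_filter]
    refine Finset.sum_congr rfl fun i _ => ?_
    split_ifs with h
    · rfl
    · exact h0 _ h
  rw [h1]
  refine (Finset.sum_le_card_nsmul _ _ M fun i _ => hM _).trans ?_
  rw [nsmul_eq_mul]
  refine mul_le_mul_of_nonneg_right ?_ hM0
  exact_mod_cast Finset.card_le_card_of_injOn e (fun i hi => (Finset.mem_filter.1 hi).2)
    he.injOn

variable {K₁ K₂ : ℝ → ℝ} {M₁ C₁ M₂ C₂ h b u L : ℝ} {T : ℕ}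

lemma abs_sub_le_of_locWeight_ne_zero (hC₁ : ∀ z, C₁ < |z| → K₁ z = 0) (hh : 0 < h) {j : ℤ}
    (hj : locWeight K₁ h u T j ≠ 0) : |(j : ℝ) / T - u| ≤ C₁ * h := by
  by_contra! hlt
  refine hj ?_
  rw [locWeight, hC₁, mul_zero]
  rw [abs_div, abs_of_pos hh, lt_div_iff₀ hh, abs_sub_comm]
  exact hlt

lemma abs_locWeight_le (hM₁ : ∀ z, |K₁ z| ≤ M₁) (hTh : 0 < T * h) (j : ℤ) :
    |locWeight K₁ h u T j| ≤ M₁ / (T * h) := by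
  rw [locWeight, abs_mul, abs_of_pos (one_div_pos.2 hTh), div_eq_mul_one_div M₁, mul_comm M₁]
  exact mul_le_mul_of_nonneg_left (hM₁ _) (one_div_pos.2 hTh).le

lemma card_timeWindow_mul_le {R : ℝ} (hR : 0 ≤ R) (hM₁ : 0 ≤ M₁) (hh : 0 < h) (hTh : 1 ≤ T * h) :
    ((timeWindow (R * h) u T).card : ℝ) * (M₁ / (T * h)) ≤ (2 * R + 1) * M₁ := by
  have h0 : 0 < T * h := by linarith
  have h1 := card_timeWindow_le (u := u) (T := T) (mul_nonneg hR hh.le)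
  calc ((timeWindow (R * h) u T).card : ℝ) * (M₁ / (T * h))
      ≤ (2 * (T * (R * h)) + T * h) * (M₁ / (T * h)) :=
        mul_le_mul_of_nonneg_right (by linarith) (by positivity)
    _ = (2 * R + 1) * M₁ * ((T * h) / (T * h)) := by ring
    _ = (2 * R + 1) * M₁ := by rw [div_self h0.ne', mul_one]

/-- The localization kernel keeps `j / T` within `C₁ * h` of `u`, and the lag can move it by a
further `C₂ * h`. The bound `C₂ * b * M₂` is the number of active lags times the bound of `K₂`. -/
lemma weightBounds_lagWeight (hM₁ : ∀ z, |K₁ z| ≤ M₁) (hC₁ : ∀ z, C₁ < |z| → K₁ z = 0)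
    (hC₁0 : 0 ≤ C₁) (hM₂ : ∀ z, |K₂ z| ≤ M₂) (hC₂ : ∀ z, C₂ < |z| → K₂ z = 0) (hC₂0 : 0 < C₂)
    (hh : 0 < h) (hb : 0 < b) (hTh : 1 ≤ T * h) (hbT : b ≤ T * h) :
    WeightBounds (Finset.Icc 1 (T : ℤ)) (timeWindow ((C₁ + C₂) * h) u T) (locWeight K₁ h u T)
      (lagWeight K₂ b) ((2 * (C₁ + C₂) + 1) * M₁) M₂ (M₁ / (T * h)) (C₂ * b * M₂) := by
  have hM₁0 : 0 ≤ M₁ := (abs_nonneg _).trans (hM₁ 0)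
  have hM₂0 : 0 ≤ M₂ := (abs_nonneg _).trans (hM₂ 0)
  have hT : 0 < (T : ℝ) := by
    rcases (Nat.cast_nonneg T : (0 : ℝ) ≤ T).eq_or_lt with h0 | h0
    · rw [← h0, zero_mul] at hTh; linarith
    · exact h0
  have hlag : ∀ t : ℤ, t ∉ Finset.Icc 1 ⌊C₂ * b⌋ → lagWeight K₂ b t = 0 := by
    intro t ht
    rw [lagWeight]
    split_ifs with h1
    · refine hC₂ _ ?_
      rw [Finset.mem_Icc, not_and] at ht
      have h2 := Int.floor_lt.1 (not_le.1 (ht h1))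
      rw [abs_div, abs_of_pos hb, lt_div_iff₀ hb]
      exact h2.trans_le (le_abs_self _)
    · rfl
  have hle : ∀ t, |lagWeight K₂ b t| ≤ M₂ := by
    intro t
    rw [lagWeight]
    split_ifs
    · exact hM₂ _
    · simpa using hM₂0
  have hcard : ((Finset.Icc 1 ⌊C₂ * b⌋).card : ℝ) * M₂ ≤ C₂ * b * M₂ := by
    refine mul_le_mul_of_nonneg_right ?_ hM₂0
    rw [Int.card_Icc]
    have h1 : 0 ≤ ⌊C₂ * b⌋ := Int.floor_nonneg.2 (by positivity)
    have h2 : (((⌊C₂ * b⌋ + 1 - 1).toNat : ℤ) : ℝ) ≤ C₂ * b := by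
      rw [add_sub_cancel_right, Int.toNat_of_nonneg h1]
      exact Int.floor_le _
    exact_mod_cast h2
  refine ⟨fun j _ hj => ?_, fun j _ i _ hj hi => ?_, abs_locWeight_le hM₁ (by linarith),
    card_timeWindow_mul_le (by positivity) hM₁0 hh hTh, hle, fun t ht => ?_, fun j => ?_,
    fun i => ?_⟩
  · rw [mem_timeWindow hT]
    refine (abs_sub_le_of_locWeight_ne_zero hC₁ hh hj).trans ?_
    nlinarith
  · rw [mem_timeWindow hT]
    have h1 := abs_sub_le_of_locWeight_ne_zero hC₁ hh hj
    have h2 : j - i ∈ Finset.Icc 1 ⌊C₂ * b⌋ := by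
      by_contra hcon
      exact hi (hlag _ hcon)
    rw [Finset.mem_Icc, Int.le_floor] at h2
    -- A lag of at most `C₂ * b` is at most `C₂ * (T * h)`; this is where `b ≤ T * h` enters.
    have h3 : |((i : ℝ) - j) / T| ≤ C₂ * h := by
      rw [abs_div, abs_of_pos hT, div_le_iff₀ hT, abs_sub_comm]
      have h4 : (1 : ℝ) ≤ (j : ℝ) - i := by exact_mod_cast h2.1
      have h5 : ((j : ℝ) - i) ≤ C₂ * b := by exact_mod_cast h2.2
      rw [abs_of_nonneg (by linarith)]
      nlinarith
    have h4 : (i : ℝ) / T - u = ((j : ℝ) / T - u) + ((i : ℝ) - j) / T := by ring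
    rw [h4]
    refine (abs_add_le _ _).trans ?_
    linarith
  · rw [lagWeight, if_neg (by omega)]
  · exact (sum_comp_le_card_mul (φ := fun t => |lagWeight K₂ b t|)
      (fun t ht => by rw [hlag t ht, abs_zero]) hle hM₂0
      (e := fun i => j - i) (fun x y hxy => by simpa using hxy) _).trans hcard
  · exact (sum_comp_le_card_mul (φ := fun t => |lagWeight K₂ b t|)
      (fun t ht => by rw [hlag t ht, abs_zero]) hle hM₂0
      (e := fun j => j - i) (fun x y hxy => by simpa using hxy) _).trans hcard

/-- The window is wider than lag zero requires, so that it agrees with the one for positive lags and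
one approximation bound serves both. -/
lemma weightBounds_zeroLagWeight (hM₁ : ∀ z, |K₁ z| ≤ M₁) (hC₁ : ∀ z, C₁ < |z| → K₁ z = 0)
    (hC₁0 : 0 ≤ C₁) (hC₂0 : 0 < C₂) (hh : 0 < h) (hTh : 1 ≤ T * h) :
    WeightBounds (Finset.Icc 1 (T : ℤ)) (timeWindow ((C₁ + C₂) * h) u T) (locWeight K₁ h u T)
      zeroLagWeight ((2 * (C₁ + C₂) + 1) * M₁) 1 (M₁ / (T * h)) 1 := by
  have hM₁0 : 0 ≤ M₁ := (abs_nonneg _).trans (hM₁ 0)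
  have hT : 0 < (T : ℝ) := by
    rcases (Nat.cast_nonneg T : (0 : ℝ) ≤ T).eq_or_lt with h0 | h0
    · rw [← h0, zero_mul] at hTh; linarith
    · exact h0
  have hlag : ∀ t : ℤ, t ∉ ({0} : Finset ℤ) → |zeroLagWeight t| = 0 := by
    intro t ht
    rw [zeroLagWeight, if_neg (by simpa using ht), abs_zero]
  have hle : ∀ t, |zeroLagWeight t| ≤ 1 := by
    intro t
    rw [zeroLagWeight]
    split_ifs <;> simp
  have hmem : ∀ j, locWeight K₁ h u T j ≠ 0 → j ∈ timeWindow ((C₁ + C₂) * h) u T := by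
    intro j hj
    rw [mem_timeWindow hT]
    refine (abs_sub_le_of_locWeight_ne_zero hC₁ hh hj).trans ?_
    nlinarith
  refine ⟨fun j _ => hmem j, fun j _ i _ hj hi => ?_, abs_locWeight_le hM₁ (by linarith),
    card_timeWindow_mul_le (by positivity) hM₁0 hh hTh, hle, fun t ht => ?_, fun j => ?_,
    fun i => ?_⟩
  · rw [zeroLagWeight] at hi
    have h1 : j - i = 0 := by
      by_contra hcon
      exact hi (if_neg hcon)
    have h2 : i = j := by omega
    rw [h2]
    exact hmem j hj
  · rw [zeroLagWeight, if_neg ht.ne]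
  · simpa using sum_comp_le_card_mul hlag hle zero_le_one
      (e := fun i => j - i) (fun x y hxy => by simpa using hxy) (Finset.Icc 1 (T : ℤ))
  · simpa using sum_comp_le_card_mul hlag hle zero_le_one
      (e := fun j => j - i) (fun x y hxy => by simpa using hxy) (Finset.Icc 1 (T : ℤ))

/-- A Riemann sum with unit cells: the rescaled kernel has Lipschitz constant L/(Th)², and at most
(2C₁ + 4)Th cells matter. The conditions `hu` and `hu'` keep its support away from the ends of the
sample, so no mass is cut off. -/
lemma abs_sum_locWeight_sub_one_le (hC₁ : ∀ z, C₁ < |z| → K₁ z = 0) (hC₁0 : 0 ≤ C₁)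
    (hint : ∫ z, K₁ z = 1) (hL : ∀ y z, |K₁ y - K₁ z| ≤ L * |y - z|)
    (hh : 0 < h) (hTh : 1 ≤ T * h) (hu : (C₁ + 1) * h ≤ u) (hu' : (C₁ + 1) * h ≤ 1 - u) :
    |∑ j ∈ Finset.Icc 1 (T : ℤ), locWeight K₁ h u T j - 1| ≤ (2 * C₁ + 4) * L / (T * h) := by
  have hTh0 : 0 < T * h := by linarith
  have hT : 0 < (T : ℝ) := pos_of_mul_pos_left hTh0 hh.le
  have hL0 : 0 ≤ L := by
    have := hL 1 0
    rw [sub_zero, abs_one, mul_one] at this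
    exact (abs_nonneg _).trans this
  set g : ℝ → ℝ := fun x => 1 / ((T : ℝ) * h) * K₁ ((u - x / T) / h) with hg
  have hgL : ∀ x y, |g x - g y| ≤ L / (T * h) ^ 2 * |x - y| := by
    intro x y
    have h1 := hL ((u - x / T) / h) ((u - y / T) / h)
    have h2 : (u - x / T) / h - (u - y / T) / h = -(1 / (T * h) * (x - y)) := by
      field_simp
      ring
    rw [h2, abs_neg, abs_mul, abs_of_pos (one_div_pos.2 hTh0)] at h1
    simp only [hg]
    rw [← mul_sub, abs_mul, abs_of_pos (one_div_pos.2 hTh0)]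
    refine (mul_le_mul_of_nonneg_left h1 (one_div_pos.2 hTh0).le).trans_eq ?_
    field_simp
  have hgc : Continuous g := by
    refine (LipschitzWith.of_dist_le_mul (K := ⟨L / (T * h) ^ 2, by positivity⟩) fun x y => ?_
      ).continuous
    rw [Real.dist_eq, Real.dist_eq]
    exact hgL x y
  have hg1 : ∫ x, g x = 1 := by
    have h1 : ∀ x, K₁ ((u - x / T) / h) = (fun y => K₁ (u / h - y)) (x / (T * h)) := by
      intro x
      simp only
      congr 1
      field_simp
    simp only [hg]
    rw [integral_const_mul]
    simp_rw [h1]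
    rw [Measure.integral_comp_div (fun y => K₁ (u / h - y)), integral_sub_left_eq_self K₁ volume,
      hint, abs_of_pos hTh0, smul_eq_mul, mul_one]
    exact one_div_mul_cancel hTh0.ne'
  have hg0 : ∀ x, g x ≠ 0 → |x - T * u| ≤ C₁ * (T * h) := by
    intro x hx
    by_contra! hlt
    refine hx ?_
    simp only [hg]
    rw [hC₁, mul_zero]
    have h2 : (u - x / T) / h = -((x - T * u) / (T * h)) := by
      field_simp
      ring
    rwa [h2, abs_neg, abs_div, abs_of_pos hTh0, lt_div_iff₀ hTh0]
  have hlo : 0 ≤ (T : ℝ) * u - C₁ * (T * h) - 1 := by nlinarith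
  -- The extra `-1` puts `p` strictly below the support, as the half-open interval requires.
  set p := ⌊(T : ℝ) * u - C₁ * (T * h) - 1⌋₊ with hp
  set q := ⌈(T : ℝ) * u + C₁ * (T * h)⌉₊ with hq
  have hp1 : (p : ℝ) ≤ (T : ℝ) * u - C₁ * (T * h) - 1 := Nat.floor_le hlo
  have hp2 : (T : ℝ) * u - C₁ * (T * h) - 1 < p + 1 := Nat.lt_floor_add_one _
  have hq1 : (T : ℝ) * u + C₁ * (T * h) ≤ q := Nat.le_ceil _
  have hq2 : (q : ℝ) < (T : ℝ) * u + C₁ * (T * h) + 1 := Nat.ceil_lt_add_one (by nlinarith)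
  have hpq : p ≤ q := by
    have : (p : ℝ) ≤ q := by nlinarith
    exact_mod_cast this
  have hqT : q ≤ T := Nat.ceil_le.2 (by nlinarith)
  have hsupp : Function.support g ⊆ Set.Ioc (p : ℝ) q := by
    intro x hx
    have h1 := abs_le.1 (hg0 x hx)
    constructor <;> linarith
  have hsum : ∑ j ∈ Finset.Icc 1 (T : ℤ), locWeight K₁ h u T j
      = ∑ k ∈ Finset.Ico p q, g (k + 1 : ℕ) := by
    symm
    have himg : (Finset.Ico p q).image (fun k : ℕ => (k : ℤ) + 1) ⊆ Finset.Icc 1 (T : ℤ) := by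
      intro j hj
      obtain ⟨k, hk, rfl⟩ := Finset.mem_image.1 hj
      have := Finset.mem_Ico.1 hk
      rw [Finset.mem_Icc]
      omega
    rw [← Finset.sum_subset himg, Finset.sum_image fun x _ y _ hxy => by simpa using hxy]
    · refine Finset.sum_congr rfl fun k _ => ?_
      simp [hg, locWeight]
    · intro j hj hj'
      by_contra hne
      have h1 : (j : ℝ) ∈ Set.Ioc (p : ℝ) q := hsupp hne
      refine hj' (Finset.mem_image.2 ⟨(j - 1).toNat, ?_, ?_⟩)
      · have h2 : (p : ℤ) < j := by exact_mod_cast h1.1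
        have h3 : j ≤ (q : ℤ) := by exact_mod_cast h1.2
        rw [Finset.mem_Ico]
        omega
      · have h2 := (Finset.mem_Icc.1 hj).1
        omega
  have hcell : ∀ k : ℕ, |g (k + 1 : ℕ) - ∫ x in (k : ℝ)..((k + 1 : ℕ) : ℝ), g x|
      ≤ L / (T * h) ^ 2 := by
    intro k
    have h1 : g (k + 1 : ℕ) - ∫ x in (k : ℝ)..((k + 1 : ℕ) : ℝ), g x
        = ∫ x in (k : ℝ)..((k + 1 : ℕ) : ℝ), (g (k + 1 : ℕ) - g x) := by
      rw [intervalIntegral.integral_sub intervalIntegrable_const (hgc.intervalIntegrable _ _),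
        intervalIntegral.integral_const]
      simp
    rw [h1, ← Real.norm_eq_abs]
    have h2 : ∀ x ∈ Set.uIoc (k : ℝ) ((k + 1 : ℕ) : ℝ), ‖g (k + 1 : ℕ) - g x‖
        ≤ L / (T * h) ^ 2 := by
      intro x hx
      rw [Set.uIoc_of_le (by push_cast; linarith)] at hx
      have h3 := hx.1
      have h4 := hx.2
      push_cast at h4
      refine (hgL _ _).trans (mul_le_of_le_one_right (by positivity) ?_)
      push_cast
      rw [abs_le]
      constructor <;> linarith
    refine (intervalIntegral.norm_integral_le_of_norm_le_const h2).trans_eq ?_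
    simp
  have htot : ∫ x in (p : ℝ)..(q : ℝ), g x = 1 := by
    rw [intervalIntegral.integral_eq_integral_of_support_subset hsupp, hg1]
  have hadj := intervalIntegral.sum_integral_adjacent_intervals_Ico (f := g) (μ := volume)
    (a := fun k : ℕ => (k : ℝ)) hpq (fun k _ => hgc.intervalIntegrable _ _)
  rw [hsum, ← htot, ← hadj, ← Finset.sum_sub_distrib]
  refine (Finset.abs_sum_le_sum_abs _ _).trans
    ((Finset.sum_le_card_nsmul _ _ _ fun k _ => hcell k).trans ?_)
  rw [nsmul_eq_mul, Nat.card_Ico, Nat.cast_sub hpq]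
  have h1 : (q : ℝ) - p ≤ (2 * C₁ + 4) * (T * h) := by nlinarith
  refine (mul_le_mul_of_nonneg_right h1 (by positivity)).trans_eq ?_
  field_simp

end Weights

/-! ### Consequences of the bandwidth condition. -/

namespace BandwidthCondition

variable {T : ℕ → ℕ} {h b : ℕ → ℝ}

lemma tendsto_mul (hb : BandwidthCondition T h b) :
    Tendsto (fun n => (T n : ℝ) * h n) atTop atTop :=
  tendsto_atTop_mono (fun _ => (min_le_left _ _).trans (min_le_left _ _)) hb.tendsto_min

lemma tendsto_bandwidth_atTop (hb : BandwidthCondition T h b) : Tendsto b atTop atTop :=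
  tendsto_atTop_mono (fun _ => (min_le_right _ _).trans (min_le_left _ _)) hb.tendsto_min

lemma tendsto_mul_div (hb : BandwidthCondition T h b) :
    Tendsto (fun n => (T n : ℝ) * h n / b n) atTop atTop :=
  tendsto_atTop_mono (fun _ => (min_le_right _ _).trans (min_le_right _ _)) hb.tendsto_min

lemma tendsto_inv_mul (hb : BandwidthCondition T h b) :
    Tendsto (fun n => 1 / ((T n : ℝ) * h n)) atTop (𝓝 0) := by
  refine hb.tendsto_mul.inv_tendsto_atTop.congr fun n => ?_
  rw [Pi.inv_apply, one_div]

lemma tendsto_div_mul (hb : BandwidthCondition T h b) :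
    Tendsto (fun n => b n * (1 / ((T n : ℝ) * h n))) atTop (𝓝 0) := by
  refine hb.tendsto_mul_div.inv_tendsto_atTop.congr fun n => ?_
  rw [Pi.inv_apply, inv_div, div_eq_mul_one_div]

lemma tendsto_mul_cube (hb : BandwidthCondition T h b) :
    Tendsto (fun n => (T n : ℝ) * h n ^ 3) atTop (𝓝 0) := by
  have h1 : Tendsto (fun n => 1 / ((T n : ℝ) * h n ^ 3)) atTop atTop :=
    tendsto_atTop_mono (fun _ => (min_le_left _ _).trans (min_le_right _ _)) hb.tendsto_min
  refine h1.inv_tendsto_atTop.congr fun n => ?_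
  rw [Pi.inv_apply, one_div, inv_inv]

lemma eventually_one_le (hb : BandwidthCondition T h b) : ∀ᶠ n in atTop, 1 ≤ (T n : ℝ) * h n :=
  hb.tendsto_mul.eventually_ge_atTop 1

lemma eventually_le (hb : BandwidthCondition T h b) : ∀ᶠ n in atTop, b n ≤ (T n : ℝ) * h n := by
  filter_upwards [hb.tendsto_mul_div.eventually_ge_atTop 1] with n hn
  rwa [le_div_iff₀ (hb.b_pos n), one_mul] at hn

/-- Write h² as Th³ divided by Th. -/
lemma tendsto_sq (hb : BandwidthCondition T h b) : Tendsto (fun n => h n ^ 2) atTop (𝓝 0) := by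
  have h1 := hb.tendsto_mul_cube.mul hb.tendsto_inv_mul
  rw [mul_zero] at h1
  refine h1.congr' ?_
  filter_upwards [hb.eventually_one_le] with n hn
  have h2 : (T n : ℝ) * h n ≠ 0 := by linarith
  rw [show (T n : ℝ) * h n ^ 3 = (T n * h n) * h n ^ 2 by ring,
    mul_right_comm, mul_one_div_cancel h2, one_mul]

lemma tendsto_h (hb : BandwidthCondition T h b) : Tendsto h atTop (𝓝 0) := by
  have h1 := (Real.continuous_sqrt.tendsto _).comp hb.tendsto_sq
  rw [Real.sqrt_zero] at h1
  exact h1.congr fun n => Real.sqrt_sq (hb.h_pos n).le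

/-- Write b h² as b/(Th) times Th³. -/
lemma tendsto_mul_sq (hb : BandwidthCondition T h b) :
    Tendsto (fun n => b n * h n ^ 2) atTop (𝓝 0) := by
  have h1 := hb.tendsto_div_mul.mul hb.tendsto_mul_cube
  rw [mul_zero] at h1
  refine h1.congr' ?_
  filter_upwards [hb.eventually_one_le] with n hn
  have h2 : (T n : ℝ) * h n ≠ 0 := by linarith
  rw [show (T n : ℝ) * h n ^ 3 = (T n * h n) * h n ^ 2 by ring,
    mul_assoc, ← mul_assoc (1 / _), one_div_mul_cancel h2, one_mul]

lemma tendsto_rate (hb : BandwidthCondition T h b) :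
    Tendsto (fun n => (h n + √(1 / ((T n : ℝ) * h n))) ^ 2) atTop (𝓝 0) := by
  have h1 := (Real.continuous_sqrt.tendsto _).comp hb.tendsto_inv_mul
  rw [Real.sqrt_zero] at h1
  simpa using (hb.tendsto_h.add h1).pow 2

lemma tendsto_mul_rate (hb : BandwidthCondition T h b) :
    Tendsto (fun n => b n * (h n + √(1 / ((T n : ℝ) * h n))) ^ 2) atTop (𝓝 0) := by
  have h1 := (hb.tendsto_mul_sq.add hb.tendsto_div_mul).const_mul 2
  rw [add_zero, mul_zero] at h1
  refine squeeze_zero (fun n => mul_nonneg (hb.b_pos n).le (sq_nonneg _)) (fun n => ?_) h1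
  have h2 : √(1 / ((T n : ℝ) * h n)) ^ 2 = 1 / ((T n : ℝ) * h n) :=
    Real.sq_sqrt (one_div_nonneg.2 (mul_nonneg (Nat.cast_nonneg _) (hb.h_pos n).le))
  rw [← mul_add, ← mul_assoc, mul_comm 2, mul_assoc]
  refine mul_le_mul_of_nonneg_left ?_ (hb.b_pos n).le
  nlinarith [sq_nonneg (h n - √(1 / ((T n : ℝ) * h n)))]

lemma tendsto_sampleSize (hb : BandwidthCondition T h b) :
    Tendsto (fun n => (T n : ℝ)) atTop atTop := by
  refine tendsto_atTop_mono' _ ?_ hb.tendsto_mul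
  filter_upwards [hb.tendsto_h.eventually_le_const zero_lt_one] with n hn
  exact mul_le_of_le_one_right (Nat.cast_nonneg _) hn

end BandwidthCondition

/-! ### Local centering errors and L⁴ bounds. -/

section Residual

variable {Ω E : Type*} {mΩ : MeasurableSpace Ω} {P : Measure Ω} [IsProbabilityMeasure P]

lemma norm_const_four [NormedAddCommGroup E] (c : E) : ‖Lp.const 4 P c‖ = ‖c‖ := by
  rw [Lp.norm_const' _ _ _ (by norm_num) (by norm_num)]
  simp

variable [NormedAddCommGroup E] [InnerProductSpace ℝ E] [CompleteSpace E]

/-- Write `x j` as `c + v j` plus an error of size `r`. The local mean reproduces `c` up to the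
defect of the weights, propagates the error with factor `C`, and averages `v` down to the order √μ
by the martingale inequality. -/
lemma MartingaleExpansion.norm_sub_weightedSum_sub_le {sig : Set ℤ → MeasurableSpace Ω}
    {v : ℤ → Lp E 4 P} {a : ℕ → ℤ → Lp E 4 P} {α : ℕ → ℝ} (h : MartingaleExpansion sig v a α)
    {s W : Finset ℤ} {κ lam : ℤ → ℝ} {C M μ β : ℝ} (hw : WeightBounds s W κ lam C M μ β)
    {x : ℤ → Lp E 4 P} {c : Lp E 4 P} {r : ℝ} (hr0 : 0 ≤ r)
    (hr : ∀ j ∈ s, j ∈ W → ‖x j - c - v j‖ ≤ r) {i : ℤ} (hi : i ∈ s) (hiW : i ∈ W) :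
    ‖x i - ∑ j ∈ s, κ j • x j - v i‖
      ≤ (1 + C) * r + |∑ j ∈ s, κ j - 1| * ‖c‖ + 2 * (∑' k, α k) * √(C * μ) := by
  have hdec : x i - ∑ j ∈ s, κ j • x j - v i = (x i - c - v i)
      - ∑ j ∈ s, κ j • (x j - c - v j) - (∑ j ∈ s, κ j - 1) • c - ∑ j ∈ s, κ j • v j := by
    simp only [smul_sub, Finset.sum_sub_distrib, ← Finset.sum_smul, sub_smul, one_smul]
    abel
  have h1 : ‖∑ j ∈ s, κ j • (x j - c - v j)‖ ≤ C * r := by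
    refine (norm_sum_le_of_le (f := fun j => κ j • (x j - c - v j)) (n := fun j => |κ j| * r) s
      fun j hj => ?_).trans ?_
    · rw [norm_smul, Real.norm_eq_abs]
      by_cases h0 : κ j = 0
      · simp [h0]
      · exact mul_le_mul_of_nonneg_left (hr j hj (hw.mem_window_left j hj h0)) (abs_nonneg _)
    · rw [← Finset.sum_mul]
      exact mul_le_mul_of_nonneg_right hw.sum_abs_loc_le hr0
  have h2 : ∑ j ∈ s, κ j ^ 2 ≤ C * μ := by
    calc ∑ j ∈ s, κ j ^ 2 ≤ ∑ j ∈ s, |κ j| * μ := by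
          refine Finset.sum_le_sum fun j _ => ?_
          rw [← sq_abs, pow_two]
          exact mul_le_mul_of_nonneg_left (hw.abs_loc_le _) (abs_nonneg _)
      _ ≤ C * μ := by
          rw [← Finset.sum_mul]
          exact mul_le_mul_of_nonneg_right hw.sum_abs_loc_le hw.loc_nonneg
  have h3 : ‖∑ j ∈ s, κ j • v j‖ ≤ 2 * (∑' k, α k) * √(C * μ) :=
    (h.norm_sum_smul_le_tsum κ s).trans (mul_le_mul_of_nonneg_left (Real.sqrt_le_sqrt h2)
      (mul_nonneg zero_le_two h.tsum_nonneg))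
  rw [hdec]
  refine (norm_sub_le _ _).trans ?_
  refine (add_le_add_left (norm_sub_le _ _) _).trans ?_
  refine (add_le_add_left (add_le_add_left (norm_sub_le _ _) _) _).trans ?_
  rw [norm_smul, Real.norm_eq_abs]
  have h4 := hr i hi hiW
  linarith

/-- A fourth moment below `C` bounds the L⁴ norm of `U` by `max C 1`, since that number is at most
its own fourth power; the crude form avoids fourth roots. -/
lemma exists_norm_le_of_ae_le {U : Ω → ℝ} {C : ℝ} (hU : AEStronglyMeasurable U P)
    (hpos : ∀ ω, 0 < U ω) (hint : Integrable (fun ω => U ω ^ (4 : ℝ)) P)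
    (hC : ∫ ω, U ω ^ (4 : ℝ) ∂P < C) {a c : ℝ} (hc : 0 ≤ c) {g : Lp E 4 P}
    (hg : ∀ᵐ ω ∂P, ‖g ω‖ ≤ a + c * U ω) : ‖g‖ ≤ |a| + c * max C 1 := by
  have hmem : MemLp U 4 P := by
    refine (integrable_norm_rpow_iff hU (by norm_num) (by norm_num)).1 (hint.congr
      (Eventually.of_forall fun ω => ?_))
    simp [Real.norm_of_nonneg (hpos ω).le]
  have hV : ‖hmem.toLp U‖ ≤ max C 1 := by
    have h1 := norm_pow_four_eq_integral (hmem.toLp U)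
    have h2 : ∫ ω, ‖hmem.toLp U ω‖ ^ 4 ∂P = ∫ ω, U ω ^ (4 : ℝ) ∂P := by
      refine integral_congr_ae ?_
      filter_upwards [hmem.coeFn_toLp] with ω h
      rw [h, Real.norm_of_nonneg (hpos ω).le]
      norm_cast
    rw [h2] at h1
    by_contra! hlt
    have h3 : (1 : ℝ) ≤ max C 1 := le_max_right _ _
    have h4 : max C 1 ^ 4 ≤ ‖hmem.toLp U‖ ^ 4 :=
      pow_le_pow_left₀ (by linarith) hlt.le 4
    have h5 : max C 1 ≤ max C 1 ^ 4 := le_self_pow₀ h3 (by norm_num)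
    have h6 : C ≤ max C 1 := le_max_left _ _
    linarith
  have h1 : ‖g‖ ≤ ‖Lp.const 4 P a + c • hmem.toLp U‖ := by
    refine Lp.norm_le_norm_of_ae_le ?_
    filter_upwards [hg, Lp.coeFn_add (Lp.const 4 P a) (c • hmem.toLp U), Lp.coeFn_const 4 P a,
      Lp.coeFn_smul c (hmem.toLp U), hmem.coeFn_toLp] with ω h1 h2 h3 h4 h5
    rw [h2, Pi.add_apply, h3, h4, Pi.smul_apply, h5, Function.const_apply, smul_eq_mul]
    exact h1.trans (le_abs_self _)
  refine h1.trans ((norm_add_le _ _).trans ?_)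
  rw [norm_const_four, norm_smul, Real.norm_eq_abs, Real.norm_eq_abs, abs_of_nonneg hc]
  exact add_le_add_right (mul_le_mul_of_nonneg_left hV hc) _

end Residual

/-! ### The estimator as a quadratic form; its symmetry and finite rank. -/

section EstimatorAlgebra

variable {α : Type*} [MeasurableSpace α] {μ : Measure α} [SFinite μ]

lemma sum_Icc_intCast {M : Type*} [AddCommMonoid M] (T : ℕ) (g : ℤ → M) :
    ∑ j ∈ Finset.Icc 1 (T : ℤ), g j = ∑ j ∈ Finset.Icc 1 T, g (j : ℤ) := by
  refine Finset.sum_bij' (fun j _ => j.toNat) (fun j _ => (j : ℤ)) ?_ ?_ ?_ ?_ ?_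
  · intro j hj
    rw [Finset.mem_Icc] at hj ⊢
    omega
  · intro j hj
    rw [Finset.mem_Icc] at hj ⊢
    omega
  · intro j hj
    rw [Finset.mem_Icc] at hj
    exact Int.toNat_of_nonneg (by omega)
  · intro j _
    exact Int.toNat_natCast j
  · intro j hj
    rw [Finset.mem_Icc] at hj
    rw [Int.toNat_of_nonneg (by omega)]

/-- The sample centered at its local mean, indexed by the integers. -/
def centeredSample (K₁ : ℝ → ℝ) (h u : ℝ) (T : ℕ) (x : ℕ → L2 μ) (i : ℤ) : L2 μ :=
  x i.toNat - localMean K₁ h u T x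

variable (K₁ K₂ : ℝ → ℝ) (h b u : ℝ) (T : ℕ) (x : ℕ → L2 μ)

lemma localMean_eq_sum : localMean K₁ h u T x
    = ∑ j ∈ Finset.Icc 1 (T : ℤ), locWeight K₁ h u T j • x j.toNat := by
  rw [sum_Icc_intCast, localMean, Finset.smul_sum]
  refine Finset.sum_congr rfl fun j _ => ?_
  rw [smul_smul, locWeight, Int.toNat_natCast, Int.cast_natCast]

lemma gammaHat_zero_eq_sum : gammaHat K₁ h u T x 0
    = ∑ j ∈ Finset.Icc 1 (T : ℤ), ∑ i ∈ Finset.Icc 1 (T : ℤ),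
      (locWeight K₁ h u T j * zeroLagWeight (j - i)) •
        tensor (centeredSample K₁ h u T x j) (centeredSample K₁ h u T x i) := by
  have h1 : ∀ j ∈ Finset.Icc 1 (T : ℤ), ∑ i ∈ Finset.Icc 1 (T : ℤ),
      (locWeight K₁ h u T j * zeroLagWeight (j - i)) •
        tensor (centeredSample K₁ h u T x j) (centeredSample K₁ h u T x i)
      = locWeight K₁ h u T j •
        tensor (centeredSample K₁ h u T x j) (centeredSample K₁ h u T x j) := by
    intro j hj
    rw [Finset.sum_eq_single_of_mem j hj]
    · simp [zeroLagWeight]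
    · intro i _ hij
      rw [zeroLagWeight, if_neg (sub_ne_zero.2 hij.symm), mul_zero, zero_smul]
  rw [Finset.sum_congr rfl h1, sum_Icc_intCast, gammaHat, Finset.smul_sum]
  refine Finset.sum_congr rfl fun j _ => ?_
  rw [smul_smul, locWeight, Int.cast_natCast]
  rfl

/-- For each `j`, the substitution `i = j - t` exchanges admissible lags and earlier times; pairs
with `i ≥ j` have zero lag weight. -/
lemma sum_gammaHat_eq_sum : ∑ t ∈ Finset.Icc 1 (T - 1), K₂ ((t : ℝ) / b) • gammaHat K₁ h u T x t
    = ∑ j ∈ Finset.Icc 1 (T : ℤ), ∑ i ∈ Finset.Icc 1 (T : ℤ),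
      (locWeight K₁ h u T j * lagWeight K₂ b (j - i)) •
        tensor (centeredSample K₁ h u T x j) (centeredSample K₁ h u T x i) := by
  set z := centeredSample K₁ h u T x with hz
  have hL : ∀ t ∈ Finset.Icc 1 (T - 1), K₂ ((t : ℝ) / b) • gammaHat K₁ h u T x t
      = ∑ j ∈ Finset.Icc 1 T, if t + 1 ≤ j then
        (locWeight K₁ h u T j * K₂ ((t : ℝ) / b)) • tensor (z j) (z (j - t : ℕ)) else 0 := by
    intro t _
    rw [← Finset.sum_filter, gammaHat, Finset.smul_sum, Finset.smul_sum]
    have hset : Finset.Icc (t + 1) T = (Finset.Icc 1 T).filter fun j => t + 1 ≤ j := by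
      ext j
      simp only [Finset.mem_filter, Finset.mem_Icc]
      omega
    rw [← hset]
    refine Finset.sum_congr rfl fun j _ => ?_
    rw [smul_smul, smul_smul, locWeight, Int.cast_natCast, hz, centeredSample, centeredSample,
      Int.toNat_natCast, Int.toNat_natCast]
    congr 1
    ring
  rw [Finset.sum_congr rfl hL, Finset.sum_comm, sum_Icc_intCast]
  refine Finset.sum_congr rfl fun j hj => ?_
  have hj' := Finset.mem_Icc.1 hj
  have hR : ∀ i ∈ Finset.Icc 1 T, (locWeight K₁ h u T j * lagWeight K₂ b ((j : ℤ) - (i : ℤ))) •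
      tensor (z j) (z i) = if i < j then
        (locWeight K₁ h u T j * K₂ (((j - i : ℕ) : ℝ) / b)) • tensor (z j) (z i) else 0 := by
    intro i _
    by_cases hij : i < j
    · rw [if_pos hij, lagWeight, if_pos (by omega), Nat.cast_sub hij.le]
      push_cast
      rfl
    · rw [if_neg hij, lagWeight, if_neg (by omega), mul_zero, zero_smul]
  rw [sum_Icc_intCast, Finset.sum_congr rfl hR, ← Finset.sum_filter, ← Finset.sum_filter]
  refine Finset.sum_bij' (fun t _ => j - t) (fun i _ => j - i) ?_ ?_ ?_ ?_ ?_
  · intro t ht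
    simp only [Finset.mem_filter, Finset.mem_Icc] at ht ⊢
    omega
  · intro t ht
    simp only [Finset.mem_filter, Finset.mem_Icc] at ht ⊢
    omega
  · intro t ht
    simp only [Finset.mem_filter, Finset.mem_Icc] at ht
    omega
  · intro t ht
    simp only [Finset.mem_filter, Finset.mem_Icc] at ht
    omega
  · intro t ht
    simp only [Finset.mem_filter, Finset.mem_Icc] at ht
    rw [Nat.sub_sub_self (by omega)]

/-- Only the one-sided lag sum then needs a limit: the other half is its transpose, and
transposition is an isometry. -/
lemma longRunEstimator_eq : longRunEstimator K₁ K₂ h b u T x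
    = gammaHat K₁ h u T x 0
      + ∑ t ∈ Finset.Icc 1 (T - 1), K₂ ((t : ℝ) / b) • gammaHat K₁ h u T x t
      + transposeKernel
        (∑ t ∈ Finset.Icc 1 (T - 1), K₂ ((t : ℝ) / b) • gammaHat K₁ h u T x t) := by
  rw [← transposeL_apply, map_sum, longRunEstimator, add_assoc, ← Finset.sum_add_distrib]
  congr 1
  refine Finset.sum_congr rfl fun t _ => ?_
  rw [smul_add, map_smul, transposeL_apply]

lemma transposeKernel_gammaHat_zero :
    transposeKernel (gammaHat K₁ h u T x 0) = gammaHat K₁ h u T x 0 := by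
  rw [← transposeL_apply, gammaHat, map_smul, map_sum]
  congr 1
  refine Finset.sum_congr rfl fun j _ => ?_
  rw [map_smul, transposeL_apply, transposeKernel_tensor]
  rfl

lemma transposeKernel_longRunEstimator :
    transposeKernel (longRunEstimator K₁ K₂ h b u T x) = longRunEstimator K₁ K₂ h b u T x := by
  have h1 := transposeKernel_gammaHat_zero K₁ h u T x
  rw [longRunEstimator_eq, ← transposeL_apply, map_add, map_add, transposeL_apply, h1,
    transposeL_apply, transposeL_apply, transposeKernel_transposeKernel, add_right_comm]

lemma gammaHat_mem_finiteRankKernels (t : ℕ) : gammaHat K₁ h u T x t ∈ finiteRankKernels μ :=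
  Submodule.smul_mem _ _ (Submodule.sum_mem _ fun _ _ => Submodule.smul_mem _ _
    (tensor_mem_finiteRankKernels _ _))

lemma transposeKernel_gammaHat_mem_finiteRankKernels (t : ℕ) :
    transposeKernel (gammaHat K₁ h u T x t) ∈ finiteRankKernels μ := by
  rw [← transposeL_apply, gammaHat, map_smul, map_sum]
  refine Submodule.smul_mem _ _ (Submodule.sum_mem _ fun _ _ => ?_)
  rw [map_smul, transposeL_apply, transposeKernel_tensor]
  exact Submodule.smul_mem _ _ (tensor_mem_finiteRankKernels _ _)

lemma longRunEstimator_mem_finiteRankKernels :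
    longRunEstimator K₁ K₂ h b u T x ∈ finiteRankKernels μ :=
  Submodule.add_mem _ (gammaHat_mem_finiteRankKernels _ _ _ _ _ _)
    (Submodule.sum_mem _ fun _ _ => Submodule.smul_mem _ _ (Submodule.add_mem _
      (gammaHat_mem_finiteRankKernels _ _ _ _ _ _)
      (transposeKernel_gammaHat_mem_finiteRankKernels _ _ _ _ _ _)))

end EstimatorAlgebra

/-! ### The long-run kernel: autocovariance series, symmetry and compactness. -/

section LongRunKernel

variable {α : Type*} [MeasurableSpace α] {μ : Measure α} [SFinite μ]
  {Ω S : Type*} [mΩ : MeasurableSpace Ω] [MeasurableSpace S] {P : Measure Ω}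
  [IsProbabilityMeasure P] {ε : ℤ → Ω → S} {f : (ℕ → S) → L2 μ} {Y : ℤ → Ω → L2 μ}

namespace IsLpMApproximable

/-- The autocovariance kernel `E[Y_0 ⊗ Y_{-t}]`. -/
def autocov (h : IsLpMApproximable P 4 ε f Y) (t : ℕ) : L2 (μ.prod μ) :=
  expectationL P _ ((tensorL μ).holder 2 (h.toLp 0) (h.toLp (-t)))

lemma integral_tensor_eq (h : IsLpMApproximable P 4 ε f Y) (t : ℕ) :
    ∫ ω, tensor (Y t ω) (Y 0 ω) ∂P = h.autocov t := by
  have h1 := h.expectationL_holder_shift (tensorL μ) t t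
  rw [sub_self, expectationL_holder] at h1
  rw [autocov, ← h1]
  refine integral_congr_ae ?_
  filter_upwards [(h.memLp t).coeFn_toLp, (h.memLp 0).coeFn_toLp] with ω h2 h3
  rw [tensorL_apply, toLp, toLp, h2, h3]

lemma integral_tensor_swap_eq (h : IsLpMApproximable P 4 ε f Y) (t : ℕ) :
    ∫ ω, tensor (Y 0 ω) (Y t ω) ∂P = transposeKernel (h.autocov t) := by
  have hi : Integrable (fun ω => tensor (Y t ω) (Y 0 ω)) P := by
    refine ((Lp.memLp ((tensorL μ).holder 2 (h.toLp t) (h.toLp 0))).integrable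
      (q := 2) (by norm_num)).congr ?_
    filter_upwards [(tensorL μ).coeFn_holder (r := 2) (h.toLp t) (h.toLp 0),
      (h.memLp t).coeFn_toLp, (h.memLp 0).coeFn_toLp] with ω h1 h2 h3
    rw [h1, tensorL_apply, toLp, toLp, h2, h3]
  rw [← h.integral_tensor_eq]
  refine Eq.trans (integral_congr_ae (Eventually.of_forall fun ω => ?_))
    ((transposeL μ).toContinuousLinearMap.integral_comp_comm hi)
  simp

lemma summable_norm_autocov (h : IsLpMApproximable P 4 ε f Y)
    (hY : ∀ t, ∫ ω, Y t ω ∂P = 0) :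
    Summable fun t => ‖h.autocov t‖ :=
  h.summable_norm_expectationL hY norm_tensorL_le

/-- By stationarity `autocov t` is the mean of `Y_t ⊗ Y_0`, the transpose of the kernel in the
definition. The two series there therefore appear here in the opposite order. -/
lemma longRunKernel_eq (h : IsLpMApproximable P 4 ε f Y)
    (hY : ∀ t, ∫ ω, Y t ω ∂P = 0) :
    longRunKernel P Y = h.autocov 0 + ∑' t, h.autocov (t + 1)
      + transposeKernel (∑' t, h.autocov (t + 1)) := by
  have hs : Summable fun t => h.autocov (t + 1) :=
    (summable_nat_add_iff 1).2 (h.summable_norm_autocov hY).of_norm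
  have h1 : ∀ t : ℕ, ∫ ω, tensor (Y 0 ω) (Y ((t : ℤ) + 1) ω) ∂P
      = transposeKernel (h.autocov (t + 1)) := fun t => by
    rw [← h.integral_tensor_swap_eq]
    push_cast
    rfl
  have h0 : ∫ ω, tensor (Y 0 ω) (Y 0 ω) ∂P = h.autocov 0 := h.integral_tensor_eq 0
  have h2 : ∑' t, transposeKernel (h.autocov (t + 1))
      = transposeKernel (∑' t, h.autocov (t + 1)) :=
    ((transposeL μ).toContinuousLinearMap.map_tsum hs).symm
  rw [longRunKernel, h0]
  simp_rw [h1, transposeKernel_transposeKernel]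
  rw [h2, add_right_comm]

lemma transposeKernel_longRunKernel (h : IsLpMApproximable P 4 ε f Y)
    (hY : ∀ t, ∫ ω, Y t ω ∂P = 0) :
    transposeKernel (longRunKernel P Y) = longRunKernel P Y := by
  have h0 : transposeKernel (h.autocov 0) = h.autocov 0 := by
    rw [← h.integral_tensor_swap_eq]
    exact h.integral_tensor_eq 0
  rw [h.longRunKernel_eq hY, ← transposeL_apply, map_add, map_add, transposeL_apply, h0,
    transposeL_apply, transposeL_apply, transposeKernel_transposeKernel, add_right_comm]

end IsLpMApproximable

/-- The Bochner integral of values in a closed convex set stays in it. If integrability fails, the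
default value 0 also belongs to the subspace. -/
lemma integral_tensor_mem_compactKernels {X Z : Ω → L2 μ} :
    ∫ ω, tensor (X ω) (Z ω) ∂P ∈ compactKernels μ := by
  by_cases hi : Integrable (fun ω => tensor (X ω) (Z ω)) P
  · exact (compactKernels μ).toConvexCone.convex.integral_mem isClosed_compactKernels
      (Eventually.of_forall fun ω =>
        finiteRankKernels_le_compactKernels (tensor_mem_finiteRankKernels _ _)) hi
  · rw [integral_undef hi]
    exact Submodule.zero_mem _

lemma tsum_mem_compactKernels {g : ℕ → L2 (μ.prod μ)} (hg : ∀ t, g t ∈ compactKernels μ) :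
    ∑' t, g t ∈ compactKernels μ := by
  by_cases hs : Summable g
  · exact isClosed_compactKernels.mem_of_tendsto hs.hasSum
      (Eventually.of_forall fun s => Submodule.sum_mem _ fun t _ => hg t)
  · rw [tsum_eq_zero_of_not_summable hs]
    exact Submodule.zero_mem _

lemma IsLpMApproximable.longRunKernel_mem_compactKernels
    (h : IsLpMApproximable P 4 ε f Y) : longRunKernel P Y ∈ compactKernels μ := by
  refine Submodule.add_mem _ (Submodule.add_mem _ integral_tensor_mem_compactKernels
    (tsum_mem_compactKernels fun _ => integral_tensor_mem_compactKernels))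
    (tsum_mem_compactKernels fun t => ?_)
  have h1 := h.integral_tensor_swap_eq (t + 1)
  push_cast at h1
  rw [h1, transposeKernel_transposeKernel, ← h.integral_tensor_eq]
  exact integral_tensor_mem_compactKernels

end LongRunKernel

/-! ### The sample as a sequence in L⁴. -/

section SampleLp

variable {α Ω : Type*} [MeasurableSpace α] {μ : Measure α} [SFinite μ] {mΩ : MeasurableSpace Ω}
  {P : Measure Ω} [IsProbabilityMeasure P]

/-- A sample `x_1, x_2, …` of random elements as a sequence in `L⁴`. -/
def sampleLp (P : Measure Ω) (x : ℕ → Ω → L2 μ) (i : ℤ) : Lp (L2 μ) 4 P :=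
  haveI := Classical.propDecidable (MemLp (x i.toNat) 4 P)
  if h : MemLp (x i.toNat) 4 P then h.toLp _ else 0

lemma coeFn_sampleLp {x : ℕ → Ω → L2 μ} {i : ℤ} (h : MemLp (x i.toNat) 4 P) :
    sampleLp P x i =ᵐ[P] x i.toNat := by
  rw [sampleLp, dif_pos h]
  exact h.coeFn_toLp

/-- The sample centered at its local mean, as a sequence in `L⁴`. -/
def centeredLp (P : Measure Ω) (K₁ : ℝ → ℝ) (h u : ℝ) (T : ℕ) (x : ℕ → Ω → L2 μ) (i : ℤ) :
    Lp (L2 μ) 4 P :=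
  sampleLp P x i - ∑ j ∈ Finset.Icc 1 (T : ℤ), locWeight K₁ h u T j • sampleLp P x j

variable {K₁ : ℝ → ℝ} {h u : ℝ} {T : ℕ} {x : ℕ → Ω → L2 μ}

/-- One null set has to serve all times at once, which is possible because there are finitely many
of them. -/
lemma coeFn_centeredLp (hx : ∀ t, 1 ≤ t → t ≤ T → MemLp (x t) 4 P) :
    ∀ᵐ ω ∂P, ∀ i ∈ Finset.Icc 1 (T : ℤ), centeredLp P K₁ h u T x i ω
      = centeredSample K₁ h u T (fun t => x t ω) i := by
  have hx' : ∀ i ∈ Finset.Icc 1 (T : ℤ), MemLp (x i.toNat) 4 P := fun i hi => by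
    rw [Finset.mem_Icc] at hi
    exact hx _ (by omega) (by omega)
  have h1 : ∀ᵐ ω ∂P, ∀ i ∈ Finset.Icc 1 (T : ℤ), sampleLp P x i ω = x i.toNat ω :=
    (ae_ball_iff (Finset.countable_toSet _)).2 fun i hi => coeFn_sampleLp (hx' i hi)
  have h2 : ∀ᵐ ω ∂P, ∀ i ∈ Finset.Icc 1 (T : ℤ), (locWeight K₁ h u T i • sampleLp P x i) ω
      = locWeight K₁ h u T i • sampleLp P x i ω :=
    (ae_ball_iff (Finset.countable_toSet _)).2 fun i _ => Lp.coeFn_smul _ _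
  have h3 : ∀ᵐ ω ∂P, ∀ i ∈ Finset.Icc 1 (T : ℤ), centeredLp P K₁ h u T x i ω
      = sampleLp P x i ω
        - (∑ j ∈ Finset.Icc 1 (T : ℤ), locWeight K₁ h u T j • sampleLp P x j :
          Lp (L2 μ) 4 P) ω :=
    (ae_ball_iff (Finset.countable_toSet _)).2 fun i _ => Lp.coeFn_sub _ _
  filter_upwards [h1, h2, h3, Lp.coeFn_fun_finsetSum (Finset.Icc 1 (T : ℤ)) fun j =>
    locWeight K₁ h u T j • sampleLp P x j] with ω h1 h2 h3 h4 i hi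
  rw [h3 i hi, h4, h1 i hi, centeredSample, localMean_eq_sum]
  congr 1
  exact Finset.sum_congr rfl fun j hj => by rw [h2 j hj, h1 j hj]

lemma coeFn_quadForm {E G : Type*} [NormedAddCommGroup E] [NormedSpace ℝ E]
    [NormedAddCommGroup G] [NormedSpace ℝ G] (L : E →L[ℝ] E →L[ℝ] G) (A : ℤ → ℤ → ℝ)
    (s : Finset ℤ) (x y : ℤ → Lp E 4 P) :
    quadForm L A s x y =ᵐ[P] fun ω => ∑ j ∈ s, ∑ i ∈ s, A j i • L (x j ω) (y i ω) := by
  have h1 : ∀ᵐ ω ∂P, ∀ j ∈ s, (∑ i ∈ s, A j i • L.holder 2 (x j) (y i) : Lp G 2 P) ω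
      = ∑ i ∈ s, (A j i • L.holder 2 (x j) (y i) : Lp G 2 P) ω :=
    (ae_ball_iff (Finset.countable_toSet _)).2 fun j _ => Lp.coeFn_fun_finsetSum _ _
  have h2 : ∀ᵐ ω ∂P, ∀ j ∈ s, ∀ i ∈ s, (A j i • L.holder 2 (x j) (y i) : Lp G 2 P) ω
      = A j i • (L.holder 2 (x j) (y i) : Lp G 2 P) ω :=
    (ae_ball_iff (Finset.countable_toSet _)).2 fun j _ =>
      (ae_ball_iff (Finset.countable_toSet _)).2 fun i _ => Lp.coeFn_smul _ _
  have h3 : ∀ᵐ ω ∂P, ∀ j ∈ s, ∀ i ∈ s, (L.holder 2 (x j) (y i) : Lp G 2 P) ω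
      = L (x j ω) (y i ω) :=
    (ae_ball_iff (Finset.countable_toSet _)).2 fun j _ =>
      (ae_ball_iff (Finset.countable_toSet _)).2 fun i _ => L.coeFn_holder _ _
  filter_upwards [h1, h2, h3, Lp.coeFn_fun_finsetSum s fun j =>
    ∑ i ∈ s, A j i • (L.holder 2 (x j) (y i) : Lp G 2 P)] with ω h1 h2 h3 h4
  rw [quadForm, h4]
  refine Finset.sum_congr rfl fun j hj => ?_
  rw [h1 j hj]
  exact Finset.sum_congr rfl fun i hi => by rw [h2 j hj i hi, h3 j hj i hi]

lemma coeFn_quadForm_centeredLp (hx : ∀ t, 1 ≤ t → t ≤ T → MemLp (x t) 4 P) (A : ℤ → ℤ → ℝ) :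
    quadForm (tensorL μ) A (Finset.Icc 1 (T : ℤ)) (centeredLp P K₁ h u T x)
      (centeredLp P K₁ h u T x) =ᵐ[P] fun ω => ∑ j ∈ Finset.Icc 1 (T : ℤ),
        ∑ i ∈ Finset.Icc 1 (T : ℤ), A j i • tensor (centeredSample K₁ h u T (fun t => x t ω) j)
          (centeredSample K₁ h u T (fun t => x t ω) i) := by
  filter_upwards [coeFn_quadForm (tensorL μ) A (Finset.Icc 1 (T : ℤ)) (centeredLp P K₁ h u T x)
    (centeredLp P K₁ h u T x), coeFn_centeredLp (K₁ := K₁) (h := h) (u := u) hx] with ω h1 h2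
  refine h1.trans (Finset.sum_congr rfl fun j hj => Finset.sum_congr rfl fun i hi => ?_)
  rw [h2 j hj, h2 i hi, tensorL_apply]

end SampleLp

/-! ### Distance of the centered sample from the stationary process. -/

section Centering

variable {α Ω S : Type*} [MeasurableSpace α] {μ : Measure α} [SFinite μ] [mΩ : MeasurableSpace Ω]
  [MeasurableSpace S] {P : Measure Ω} [IsProbabilityMeasure P]
  {X v : ℕ → ℕ → Ω → L2 μ} {m : ℝ → L2 μ} {vs : ℝ → ℤ → Ω → L2 μ} {ε : ℤ → Ω → S}
  {f : ℝ → (ℕ → S) → L2 μ} {u : ℝ}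

lemma ProcessAssumption.memLp_of_eq_add (hv : ProcessAssumption P 4 ε f v vs)
    (hX : ∀ T t : ℕ, 1 ≤ t → t ≤ T → ∀ ω, X T t ω = m ((t : ℝ) / T) + v T t ω) {T t : ℕ}
    (ht : 1 ≤ t) (htT : t ≤ T) : MemLp (X T t) 4 P := by
  have h1 : MemLp (fun _ : Ω => m ((t : ℝ) / T)) 4 P := memLp_const _
  refine (h1.add (hv.locallyStationary.memLp_array T t ht htT)).ae_eq
    (Eventually.of_forall fun ω => ?_)
  rw [Pi.add_apply, hX T t ht htT]

/-- The distance of the observations near time `u` from the stationary approximation. -/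
lemma exists_norm_sampleLp_sub_le (hm : LipschitzMean m) (hv : ProcessAssumption P 4 ε f v vs)
    (hX : ∀ T t : ℕ, 1 ≤ t → t ≤ T → ∀ ω, X T t ω = m ((t : ℝ) / T) + v T t ω)
    (hu : u ∈ Set.Icc (0 : ℝ) 1) : ∃ A : ℝ, 0 ≤ A ∧ ∀ (T : ℕ) (r : ℝ), 0 ≤ r → 1 / (T : ℝ) ≤ r →
      ∀ i ∈ Finset.Icc 1 (T : ℤ), |(i : ℝ) / T - u| ≤ r →
        ‖sampleLp P (X T) i - Lp.const 4 P (m u) - (hv.approximable u hu).toLp i‖ ≤ A * r := by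
  obtain ⟨c, hc, hmc⟩ := hm
  obtain ⟨U, C, hU⟩ := hv.locallyStationary.approx
  -- `c` is the Lipschitz constant of the mean. The factor 2 comes from `|t/T - u| + 1/T ≤ 2 * r`,
  -- and `max C 1` bounds the L⁴ norm of `U`.
  refine ⟨c + 2 * max C 1, by positivity, fun T r hr0 hr i hi hir => ?_⟩
  obtain ⟨t, rfl⟩ : ∃ t : ℕ, i = t := ⟨i.toNat, by rw [Finset.mem_Icc] at hi; omega⟩
  rw [Finset.mem_Icc] at hi
  have ht : 1 ≤ t := by exact_mod_cast hi.1
  have htT : t ≤ T := by exact_mod_cast hi.2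
  rw [Int.cast_natCast] at hir
  obtain ⟨hU1, hU2, hU3, hU4, hU5⟩ := hU u hu T t ht htT
  have hT : (0 : ℝ) < T := by exact_mod_cast ht.trans htT
  have htI : (t : ℝ) / T ∈ Set.Icc (0 : ℝ) 1 :=
    ⟨by positivity, (div_le_one hT).2 (by exact_mod_cast htT)⟩
  have hae : ∀ᵐ ω ∂P, ‖(sampleLp P (X T) t - Lp.const 4 P (m u)
      - (hv.approximable u hu).toLp t : Lp (L2 μ) 4 P) ω‖ ≤ c * r + 2 * r * U u T t ω := by
    have hmem : MemLp (X T (t : ℤ).toNat) 4 P := by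
      rw [Int.toNat_natCast]
      exact hv.memLp_of_eq_add hX ht htT
    filter_upwards [hU5, coeFn_sampleLp hmem, Lp.coeFn_const 4 P (m u),
      ((hv.approximable u hu).memLp t).coeFn_toLp,
      Lp.coeFn_sub (sampleLp P (X T) t - Lp.const 4 P (m u)) ((hv.approximable u hu).toLp t),
      Lp.coeFn_sub (sampleLp P (X T) t) (Lp.const 4 P (m u))] with ω h1 h2 h3 h4 h5 h6
    rw [h5, Pi.sub_apply, h6, Pi.sub_apply, h2, h3, IsLpMApproximable.toLp, h4,
      Function.const_apply, Int.toNat_natCast, hX T t ht htT]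
    have h7 : m ((t : ℝ) / T) + v T t ω - m u - vs u t ω
        = (m ((t : ℝ) / T) - m u) + (v T t ω - vs u t ω) := by abel
    rw [h7]
    refine (norm_add_le _ _).trans (add_le_add ?_ (h1.trans ?_))
    · refine (hmc u hu _ htI).trans (mul_le_mul_of_nonneg_left ?_ hc.le)
      rwa [abs_sub_comm]
    · exact mul_le_mul_of_nonneg_right (by linarith) (hU1 ω).le
  refine (exists_norm_le_of_ae_le hU2 hU1 hU3 hU4 (by positivity) hae).trans_eq ?_
  rw [abs_of_nonneg (by positivity)]
  ring

/-- The rate has a bias part `h`, from the smooth mean and local stationarity, and a stochastic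
part, the fluctuation of the local mean over about Th observations. -/
lemma exists_norm_centeredLp_sub_le (hm : LipschitzMean m)
    (hv : ProcessAssumption P 4 ε f v vs)
    (hX : ∀ T t : ℕ, 1 ≤ t → t ≤ T → ∀ ω, X T t ω = m ((t : ℝ) / T) + v T t ω)
    (hu : u ∈ Set.Icc (0 : ℝ) 1) {K₁ : ℝ → ℝ} {M₁ C₁ C₂ L : ℝ} (hM₁ : ∀ z, |K₁ z| ≤ M₁)
    (hC₁ : ∀ z, C₁ < |z| → K₁ z = 0) (hC₁0 : 0 ≤ C₁) (hint : ∫ z, K₁ z = 1)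
    (hL : ∀ y z, |K₁ y - K₁ z| ≤ L * |y - z|) (hC₂0 : 0 < C₂) :
    ∃ A : ℝ, 0 ≤ A ∧ ∀ (T : ℕ) (h : ℝ), 0 < h → 1 ≤ T * h → (C₁ + 1) * h ≤ u →
      (C₁ + 1) * h ≤ 1 - u → ∀ i ∈ Finset.Icc 1 (T : ℤ),
        i ∈ timeWindow ((C₁ + C₂) * h) u T →
          ‖centeredLp P K₁ h u T (X T) i - (hv.approximable u hu).toLp i‖
            ≤ A * (h + √(1 / (T * h))) := by
  obtain ⟨A, hA, hbound⟩ := exists_norm_sampleLp_sub_le hm hv hX hu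
  have hexp := (hv.approximable u hu).martingaleExpansion (hv.mean_zero u hu)
  set S := ∑' k, ((hv.approximable u hu).couplingNorm (k + 1)
    + (hv.approximable u hu).couplingNorm k)
  have hS : 0 ≤ S := hexp.tsum_nonneg
  have hM₁0 : 0 ≤ M₁ := (abs_nonneg _).trans (hM₁ 0)
  have hL0 : 0 ≤ L := by
    have := hL 1 0
    rw [sub_zero, abs_one, mul_one] at this
    exact (abs_nonneg _).trans this
  set C := (2 * (C₁ + C₂) + 1) * M₁ with hC
  have hC0 : 0 ≤ C := by positivity
  refine ⟨(1 + C) * (A * (C₁ + C₂ + 1)) + (2 * C₁ + 4) * L * ‖m u‖ + 2 * S * √(C * M₁),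
    by positivity, fun T h hh hTh hu1 hu2 i hi hiW => ?_⟩
  have hTh0 : 0 < T * h := by linarith
  have hT : 0 < (T : ℝ) := pos_of_mul_pos_left hTh0 hh.le
  have hw := weightBounds_zeroLagWeight (u := u) hM₁ hC₁ hC₁0 hC₂0 hh hTh
  have hr : ∀ j ∈ Finset.Icc 1 (T : ℤ), j ∈ timeWindow ((C₁ + C₂) * h) u T →
      ‖sampleLp P (X T) j - Lp.const 4 P (m u) - (hv.approximable u hu).toLp j‖
        ≤ A * ((C₁ + C₂ + 1) * h) := by
    intro j hj hjW
    refine hbound T _ (by positivity) ?_ j hj (((mem_timeWindow hT).1 hjW).trans ?_)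
    · rw [div_le_iff₀ hT]
      nlinarith [mul_nonneg (add_nonneg hC₁0 hC₂0.le) hTh0.le]
    · nlinarith
  have h1 := hexp.norm_sub_weightedSum_sub_le hw (by positivity) hr hi hiW
  have h2 := abs_sum_locWeight_sub_one_le hC₁ hC₁0 hint hL hh hTh hu1 hu2
  rw [norm_const_four] at h1
  set q := √(1 / (T * h)) with hq
  have hq0 : 0 ≤ q := Real.sqrt_nonneg _
  -- Since `T * h ≥ 1`, the Riemann-sum error is absorbed into the stochastic rate.
  have hqle : 1 / (T * h) ≤ q := by
    rw [hq]
    refine Real.le_sqrt_of_sq_le ?_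
    rw [pow_two]
    exact mul_le_of_le_one_left (by positivity) ((div_le_one hTh0).2 hTh)
  have h3 : |∑ j ∈ Finset.Icc 1 (T : ℤ), locWeight K₁ h u T j - 1| ≤ (2 * C₁ + 4) * L * q := by
    refine h2.trans ?_
    rw [div_eq_mul_one_div]
    exact mul_le_mul_of_nonneg_left hqle (by positivity)
  have h4 : √(C * (M₁ / (T * h))) = √(C * M₁) * q := by
    rw [hq, ← Real.sqrt_mul (by positivity)]
    congr 1
    ring
  rw [h4] at h1
  have h5 := mul_le_mul_of_nonneg_right h3 (norm_nonneg (m u))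
  refine h1.trans ?_
  have e1 : 0 ≤ (1 + C) * (A * (C₁ + C₂ + 1)) * q := by positivity
  have e2 : 0 ≤ (2 * C₁ + 4) * L * ‖m u‖ * h := by positivity
  have e3 : 0 ≤ 2 * S * √(C * M₁) * h := by positivity
  nlinarith

end Centering

/-! ### Convergence in probability of the estimated kernels. -/

section Consistency

variable {Ω V : Type*} [MeasurableSpace Ω] {P : Measure Ω} [NormedAddCommGroup V]

lemma tendstoInMeasure_of_norm_le {V' V'' : Type*} [NormedAddCommGroup V'] [NormedAddCommGroup V'']
    {F : ℕ → Ω → V} {F' : Ω → V} {A : ℕ → Ω → V'} {A' : Ω → V'} {B : ℕ → Ω → V''} {B' : Ω → V''}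
    (hA : TendstoInMeasure P A atTop A') (hB : TendstoInMeasure P B atTop B') {K : ℝ} (hK : 0 < K)
    {c : ℕ → ℝ} (hc : Tendsto c atTop (𝓝 0))
    (hle : ∀ n ω, ‖F n ω - F' ω‖ ≤ K * (‖A n ω - A' ω‖ + ‖B n ω - B' ω‖) + c n) :
    TendstoInMeasure P F atTop F' := by
  rw [tendstoInMeasure_iff_norm] at hA hB ⊢
  intro δ hδ
  have hδ' : 0 < δ / (3 * K) := by positivity
  have h1 := (hA _ hδ').add (hB _ hδ')
  rw [add_zero] at h1
  refine tendsto_of_tendsto_of_tendsto_of_le_of_le' tendsto_const_nhds h1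
    (Eventually.of_forall fun _ => zero_le) ?_
  filter_upwards [hc.eventually_lt_const (show 0 < δ / 3 by positivity)] with n hn
  refine (measure_mono fun ω hω => ?_).trans (measure_union_le _ _)
  by_contra hcon
  simp only [Set.mem_union, Set.mem_ofPred_eq, not_or, not_le] at hcon hω
  have h2 := hle n ω
  have h3 : K * (‖A n ω - A' ω‖ + ‖B n ω - B' ω‖) < K * (δ / (3 * K) + δ / (3 * K)) :=
    mul_lt_mul_of_pos_left (add_lt_add hcon.1 hcon.2) hK
  have h4 : K * (δ / (3 * K) + δ / (3 * K)) = 2 * (δ / 3) := by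
    field_simp
    ring
  linarith

end Consistency

section Consistency

variable {α Ω S : Type*} [MeasurableSpace α] {μ : Measure α} [SFinite μ] [mΩ : MeasurableSpace Ω]
  [MeasurableSpace S] {P : Measure Ω} [IsProbabilityMeasure P]
  {X v : ℕ → ℕ → Ω → L2 μ} {m : ℝ → L2 μ} {vs : ℝ → ℤ → Ω → L2 μ} {ε : ℤ → Ω → S}
  {f : ℝ → (ℕ → S) → L2 μ} {u : ℝ} {K₁ K₂ : ℝ → ℝ} {T : ℕ → ℕ} {h b : ℕ → ℝ}

/-- Localization around `u > 0` eventually forces `j ≥ T u / 2`, so a fixed shift does not leave the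
sample. -/
lemma eventually_sub_mem_Icc {C₁ : ℝ} (hC₁ : ∀ z, C₁ < |z| → K₁ z = 0)
    (hb : BandwidthCondition T h b) (hu : 0 < u) (t : ℕ) :
    ∀ᶠ n in atTop, ∀ j ∈ Finset.Icc 1 (T n : ℤ), locWeight K₁ (h n) u (T n) j ≠ 0 →
      j - t ∈ Finset.Icc 1 (T n : ℤ) := by
  have h1 : Tendsto (fun n => C₁ * h n) atTop (𝓝 0) := by simpa using hb.tendsto_h.const_mul C₁
  have h2 : Tendsto (fun n => (T n : ℝ) * (u / 2)) atTop atTop :=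
    hb.tendsto_sampleSize.atTop_mul_const (by positivity)
  filter_upwards [h1.eventually_le_const (show 0 < u / 2 by positivity),
    h2.eventually_ge_atTop ((t : ℝ) + 1), hb.tendsto_sampleSize.eventually_gt_atTop 0]
    with n e1 e2 e3 j hj hne
  have h3 := (abs_le.1 ((abs_sub_le_of_locWeight_ne_zero hC₁ (hb.h_pos n) hne).trans e1)).1
  have h4 : u / 2 ≤ (j : ℝ) / T n := by linarith
  rw [le_div_iff₀ e3] at h4
  have h5 : (t : ℝ) + 1 ≤ j := by linarith
  have h6 : (t : ℤ) + 1 ≤ j := by exact_mod_cast h5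
  rw [Finset.mem_Icc] at hj ⊢
  omega

lemma tendsto_sum_locWeight {C₁ L : ℝ} (hC₁ : ∀ z, C₁ < |z| → K₁ z = 0) (hC₁0 : 0 ≤ C₁)
    (hint : ∫ z, K₁ z = 1) (hL : ∀ y z, |K₁ y - K₁ z| ≤ L * |y - z|)
    (hb : BandwidthCondition T h b) (hu : u ∈ Set.Ioo (0 : ℝ) 1) :
    Tendsto (fun n => ∑ j ∈ Finset.Icc 1 (T n : ℤ), locWeight K₁ (h n) u (T n) j) atTop (𝓝 1) := by
  have h1 : Tendsto (fun n => (C₁ + 1) * h n) atTop (𝓝 0) := by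
    simpa using hb.tendsto_h.const_mul (C₁ + 1)
  have h2 := hb.tendsto_inv_mul.const_mul ((2 * C₁ + 4) * L)
  rw [mul_zero] at h2
  rw [tendsto_iff_norm_sub_tendsto_zero]
  refine squeeze_zero' (Eventually.of_forall fun _ => norm_nonneg _) ?_ h2
  filter_upwards [h1.eventually_le_const hu.1, h1.eventually_le_const (sub_pos.2 hu.2),
    hb.eventually_one_le] with n e1 e2 e3
  rw [Real.norm_eq_abs, ← div_eq_mul_one_div]
  exact abs_sum_locWeight_sub_one_le hC₁ hC₁0 hint hL (hb.h_pos n) e3 e1 e2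

/-- Consistency of the estimator of the local long-run covariance kernel. -/
theorem tendstoInMeasure_longRunEstimator (hm : LipschitzMean m)
    (hv : ProcessAssumption P 4 ε f v vs)
    (hX : ∀ T t : ℕ, 1 ≤ t → t ≤ T → ∀ ω, X T t ω = m ((t : ℝ) / T) + v T t ω)
    (hu : u ∈ Set.Ioo (0 : ℝ) 1) (hK₁ : IsLocalizationKernel K₁) (hK₂ : IsLagKernel K₂)
    (hb : BandwidthCondition T h b) :
    TendstoInMeasure P (fun n ω => longRunEstimator K₁ K₂ (h n) (b n) u (T n)
      fun t => X (T n) t ω) atTop (fun _ => longRunKernel P (vs u)) := by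
  have hu' : u ∈ Set.Icc (0 : ℝ) 1 := Set.Ioo_subset_Icc_self hu
  obtain ⟨M₁, hM₁⟩ := hK₁.bounded
  obtain ⟨C₁, hC₁0, hC₁⟩ : ∃ C₁ : ℝ, 0 ≤ C₁ ∧ ∀ z, C₁ < |z| → K₁ z = 0 := by
    obtain ⟨C, hC⟩ := hK₁.compactSupport
    exact ⟨max C 0, le_max_right _ _, fun z hz => hC z ((le_max_left _ _).trans_lt hz)⟩
  obtain ⟨L, hL⟩ := hK₁.lipschitz
  obtain ⟨M₂, hM₂⟩ := hK₂.bounded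
  obtain ⟨C₂, hC₂0, hC₂⟩ := hK₂.compactSupport
  have happ := hv.approximable u hu'
  have hY := hv.mean_zero u hu'
  have hexp := happ.martingaleExpansion hY
  have hΓs := happ.summable_norm_autocov hY
  have hΓ : ∀ (j : ℤ) (t : ℕ), expectationL P _ ((tensorL μ).holder 2 (happ.toLp j)
      (happ.toLp (j - t))) = happ.autocov t := happ.expectationL_holder_shift (tensorL μ)
  obtain ⟨A, hA, hcent⟩ := exists_norm_centeredLp_sub_le hm hv hX hu' hM₁ hC₁ hC₁0
    hK₁.integral_eq_one hL hC₂0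
  have hwin : Tendsto (fun n => (C₁ + 1) * h n) atTop (𝓝 0) := by
    simpa using hb.tendsto_h.const_mul (C₁ + 1)
  have hy : ∀ᶠ n in atTop, ∀ i ∈ Finset.Icc 1 (T n : ℤ),
      i ∈ timeWindow ((C₁ + C₂) * h n) u (T n) →
        ‖centeredLp P K₁ (h n) u (T n) (X (T n)) i - happ.toLp i‖
          ≤ A * (h n + √(1 / ((T n : ℝ) * h n))) := by
    filter_upwards [hwin.eventually_le_const hu.1, hwin.eventually_le_const (sub_pos.2 hu.2),
      hb.eventually_one_le] with n e1 e2 e3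
    exact hcent (T n) (h n) (hb.h_pos n) e3 e1 e2
  have hρ : ∀ n, 0 ≤ A * (h n + √(1 / ((T n : ℝ) * h n))) := fun n =>
    mul_nonneg hA (add_nonneg (hb.h_pos n).le (Real.sqrt_nonneg _))
  have hκ := tendsto_sum_locWeight hC₁ hC₁0 hK₁.integral_eq_one hL hb hu
  have hshift := eventually_sub_mem_Icc (K₁ := K₁) hC₁ hb hu.1
  have hμ : Tendsto (fun n => M₁ / ((T n : ℝ) * h n)) atTop (𝓝 0) := by
    simpa [div_eq_mul_one_div M₁] using hb.tendsto_inv_mul.const_mul M₁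
  have hmem : ∀ n t, 1 ≤ t → t ≤ T n → MemLp (X (T n) t) 4 P := fun n t ht htT =>
    hv.memLp_of_eq_add hX ht htT
  have hzero : TendstoInMeasure P (fun n ω => gammaHat K₁ (h n) u (T n) (fun t => X (T n) t ω) 0)
      atTop (fun _ => happ.autocov 0) := by
    have h1 := hexp.tendsto_norm_quadForm_sub norm_tensorL_le hΓs hΓ
      (lam := fun _ => zeroLagWeight) (lam' := fun t => zeroLagWeight t) (β := fun _ => 1)
      (hb.eventually_one_le.mono fun n hn => weightBounds_zeroLagWeight (u := u) hM₁ hC₁ hC₁0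
        hC₂0 (hb.h_pos n) hn) hshift hκ (fun t => tendsto_const_nhds) (by simpa using hμ) hρ
      (by simpa [mul_pow] using hb.tendsto_rate.const_mul (A ^ 2)) hy
    have h2 : ∑' t : ℕ, zeroLagWeight t • happ.autocov t = happ.autocov 0 := by
      rw [tsum_eq_single 0 fun t ht => by simp [zeroLagWeight, ht]]
      simp [zeroLagWeight]
    rw [h2] at h1
    refine (tendstoInMeasure_of_tendsto_Lp (tendsto_iff_norm_sub_tendsto_zero.2 h1)).congr
      (fun n => ?_) (Lp.coeFn_const 2 P _)
    filter_upwards [coeFn_quadForm_centeredLp (K₁ := K₁) (h := h n) (u := u) (hmem n)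
      fun j i => locWeight K₁ (h n) u (T n) j * zeroLagWeight (j - i)] with ω hω
    rw [gammaHat_zero_eq_sum]
    exact hω
  have hlag : TendstoInMeasure P (fun n ω => ∑ t ∈ Finset.Icc 1 (T n - 1),
      K₂ ((t : ℝ) / b n) • gammaHat K₁ (h n) u (T n) (fun t => X (T n) t ω) t)
      atTop (fun _ => ∑' t, happ.autocov (t + 1)) := by
    -- For fixed `t ≥ 1`, `t / b` tends to 0 and the weight to `K₂ 0 = 1`, by continuity at zero.
    -- Lag zero has limit 0, being treated separately.
    have hlam : ∀ t : ℕ, Tendsto (fun n => lagWeight K₂ (b n) t) atTop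
        (𝓝 (if 1 ≤ t then 1 else 0)) := by
      intro t
      by_cases ht : 1 ≤ t
      · rw [if_pos ht]
        have h1 : Tendsto (fun n => (t : ℝ) / b n) atTop (𝓝 0) :=
          hb.tendsto_bandwidth_atTop.const_div_atTop _
        have h2 := hK₂.continuousAt_zero.tendsto.comp h1
        rw [hK₂.apply_zero] at h2
        refine h2.congr fun n => ?_
        rw [lagWeight, if_pos (by exact_mod_cast ht), Int.cast_natCast]
        rfl
      · rw [if_neg ht]
        refine tendsto_const_nhds.congr fun n => ?_
        rw [lagWeight, if_neg (by exact_mod_cast ht)]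
    have h1 := hexp.tendsto_norm_quadForm_sub norm_tensorL_le hΓs hΓ
      (lam := fun n => lagWeight K₂ (b n)) (β := fun n => C₂ * b n * M₂)
      ((hb.eventually_one_le.and hb.eventually_le).mono fun n hn => weightBounds_lagWeight
        (u := u) hM₁ hC₁ hC₁0 hM₂ hC₂ hC₂0 (hb.h_pos n) (hb.b_pos n) hn.1 hn.2)
      hshift hκ hlam ?_ hρ ?_ hy
    · have h2 : ∑' t : ℕ, (if 1 ≤ t then (1 : ℝ) else 0) • happ.autocov t
          = ∑' t, happ.autocov (t + 1) := by
        have hs : Summable fun t : ℕ => (if 1 ≤ t then (1 : ℝ) else 0) • happ.autocov t := by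
          refine Summable.of_norm_bounded hΓs fun t => ?_
          split_ifs <;> simp
        rw [hs.tsum_eq_zero_add]
        simp
      rw [h2] at h1
      refine (tendstoInMeasure_of_tendsto_Lp (tendsto_iff_norm_sub_tendsto_zero.2 h1)).congr
        (fun n => ?_) (Lp.coeFn_const 2 P _)
      filter_upwards [coeFn_quadForm_centeredLp (K₁ := K₁) (h := h n) (u := u) (hmem n)
        fun j i => locWeight K₁ (h n) u (T n) j * lagWeight K₂ (b n) (j - i)] with ω hω
      rw [sum_gammaHat_eq_sum]
      exact hω
    -- The product of localization and lag bounds is a constant times b/(Th).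
    · have h2 := hb.tendsto_div_mul.const_mul (M₁ * C₂ * M₂)
      rw [mul_zero] at h2
      refine h2.congr fun n => ?_
      ring
    -- The perturbation condition is a constant times b(h + (Th)^(-1/2))².
    · have h2 := hb.tendsto_mul_rate.const_mul (C₂ * M₂ * A ^ 2)
      rw [mul_zero] at h2
      refine h2.congr fun n => ?_
      ring
  refine tendstoInMeasure_of_norm_le hzero hlag (K := 2) two_pos
    (c := fun _ => 0) tendsto_const_nhds fun n ω => ?_
  rw [longRunEstimator_eq, happ.longRunKernel_eq hY]
  set g := gammaHat K₁ (h n) u (T n) (fun t => X (T n) t ω) 0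
  set l := ∑ t ∈ Finset.Icc 1 (T n - 1),
      K₂ ((t : ℝ) / b n) • gammaHat K₁ (h n) u (T n) (fun t => X (T n) t ω) t
  set g' := happ.autocov 0
  set l' := ∑' t, happ.autocov (t + 1)
  have h1 : g + l + transposeKernel l - (g' + l' + transposeKernel l')
      = (g - g') + (l - l') + transposeL μ (l - l') := by
    rw [map_sub, transposeL_apply, transposeL_apply]
    abel
  rw [h1]
  refine (norm_add₃_le).trans ?_
  rw [(transposeL μ).norm_map]
  linarith [norm_nonneg (g - g')]

lemma tendstoInMeasure_pooledKernel {c₁ c₂ : ℕ → Ω → L2 (μ.prod μ)} {c₁' c₂' : L2 (μ.prod μ)}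
    (h₁ : TendstoInMeasure P c₁ atTop fun _ => c₁') (h₂ : TendstoInMeasure P c₂ atTop fun _ => c₂')
    {θn : ℕ → ℝ} (hθn : ∀ n, θn n ∈ Set.Icc (0 : ℝ) 1) {θ : ℝ} (hθ : Tendsto θn atTop (𝓝 θ)) :
    TendstoInMeasure P (fun n ω => pooledKernel (θn n) (c₁ n ω) (c₂ n ω)) atTop
      (fun _ => pooledKernel θ c₁' c₂') := by
  have hc : Tendsto (fun n => ‖θn n - θ‖ * ‖c₂' - c₁'‖) atTop (𝓝 0) := by
    simpa using (tendsto_iff_norm_sub_tendsto_zero.1 hθ).mul_const ‖c₂' - c₁'‖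
  refine tendstoInMeasure_of_norm_le h₁ h₂ one_pos hc fun n ω => ?_
  have h1 : pooledKernel (θn n) (c₁ n ω) (c₂ n ω) - pooledKernel θ c₁' c₂'
      = (1 - θn n) • (c₁ n ω - c₁') + θn n • (c₂ n ω - c₂') + (θn n - θ) • (c₂' - c₁') := by
    simp only [pooledKernel]
    module
  rw [h1]
  refine norm_add₃_le.trans ?_
  rw [norm_smul, norm_smul, norm_smul, Real.norm_of_nonneg (hθn n).1,
    Real.norm_of_nonneg (sub_nonneg.2 (hθn n).2)]
  have e1 := mul_le_of_le_one_left (norm_nonneg (c₁ n ω - c₁'))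
    (show 1 - θn n ≤ 1 by linarith [(hθn n).1])
  have e2 := mul_le_of_le_one_left (norm_nonneg (c₂ n ω - c₂')) (hθn n).2
  linarith

lemma norm_integralOperatorL_sub_le (k l : L2 (μ.prod μ)) :
    ‖integralOperatorL μ k - integralOperatorL μ l‖ ≤ ‖k - l‖ := by
  rw [← map_sub]
  exact ContinuousLinearMap.opNorm_le_bound _ (norm_nonneg _) fun x =>
    norm_integralOperator_le _ x

lemma transposeKernel_pooledKernel {θ : ℝ} {c₁ c₂ : L2 (μ.prod μ)}
    (h₁ : transposeKernel c₁ = c₁) (h₂ : transposeKernel c₂ = c₂) :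
    transposeKernel (pooledKernel θ c₁ c₂) = pooledKernel θ c₁ c₂ := by
  rw [pooledKernel, ← transposeL_apply, map_add, map_smul, map_smul, transposeL_apply,
    transposeL_apply, h₁, h₂]

lemma pooledKernel_mem {θ : ℝ} {c₁ c₂ : L2 (μ.prod μ)} {M : Submodule ℝ (L2 (μ.prod μ))}
    (h₁ : c₁ ∈ M) (h₂ : c₂ ∈ M) : pooledKernel θ c₁ c₂ ∈ M :=
  M.add_mem (M.smul_mem _ h₁) (M.smul_mem _ h₂)

end Consistency

end LSFTS

end

theorem corollary2 {d : ℕ} (D : Set (EuclideanSpace ℝ (Fin d))) (hD : IsCompact D)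
    {Ω S₁ S₂ : Type*} [MeasurableSpace Ω] [MeasurableSpace S₁] [MeasurableSpace S₂]
    (P : Measure Ω) [IsProbabilityMeasure P]
    -- the two observed arrays, their mean functions, and their error processes
    (X Y v w : ℕ → ℕ → Ω → LSFTS.L2 (volume.restrict D))
    (m₁ m₂ : ℝ → LSFTS.L2 (volume.restrict D))
    (vs ws : ℝ → ℤ → Ω → LSFTS.L2 (volume.restrict D))
    (ε₁ : ℤ → Ω → S₁) (f₁ : ℝ → (ℕ → S₁) → LSFTS.L2 (volume.restrict D))
    (ε₂ : ℤ → Ω → S₂) (f₂ : ℝ → (ℕ → S₂) → LSFTS.L2 (volume.restrict D))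
    (hX : ∀ T t : ℕ, 1 ≤ t → t ≤ T → ∀ ω, X T t ω = m₁ ((t : ℝ) / T) + v T t ω)
    (hY : ∀ T t : ℕ, 1 ≤ t → t ≤ T → ∀ ω, Y T t ω = m₂ ((t : ℝ) / T) + w T t ω)
    (hm₁ : LSFTS.LipschitzMean m₁) (hm₂ : LSFTS.LipschitzMean m₂)
    (hv : LSFTS.ProcessAssumption P 4 ε₁ f₁ v vs)
    (hw : LSFTS.ProcessAssumption P 4 ε₂ f₂ w ws)
    -- the kernels, the sample sizes and the bandwidths
    (K₁ K₂ : ℝ → ℝ) (hK₁ : LSFTS.IsLocalizationKernel K₁) (hK₂ : LSFTS.IsLagKernel K₂)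
    (T₁ T₂ : ℕ → ℕ) (hT : Tendsto (fun n => min (T₁ n) (T₂ n)) atTop atTop)
    (θ : ℝ) (hθ : θ ∈ Set.Ioo (0 : ℝ) 1)
    (hTθ : Tendsto (fun n => (T₁ n : ℝ) / ((T₁ n : ℝ) + (T₂ n : ℝ))) atTop (𝓝 θ))
    (hXY : ∀ n, IndepFun (fun ω (t : Set.Icc 1 (T₁ n)) => X (T₁ n) t ω)
      (fun ω (t : Set.Icc 1 (T₂ n)) => Y (T₂ n) t ω) P)
    (h₁ b₁ h₂ b₂ : ℕ → ℝ) (hb₁ : LSFTS.BandwidthCondition T₁ h₁ b₁)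
    (hb₂ : LSFTS.BandwidthCondition T₂ h₂ b₂)
    -- the rescaled time point
    (u : ℝ) (hu : u ∈ Set.Ioo (0 : ℝ) 1)
    (hrate₁ : Tendsto (fun m : ℕ => (m : ℝ≥0∞) * LSFTS.couplingError P 2 ε₁ (f₁ u) 0 m)
      atTop (𝓝 0))
    (hrate₂ : Tendsto (fun m : ℕ => (m : ℝ≥0∞) * LSFTS.couplingError P 2 ε₂ (f₂ u) 0 m)
      atTop (𝓝 0))
    -- the eigenvalues of the pooled long-run covariance operator
    (η : ℕ → ℝ)
    (hη : ∀ j, η j = LSFTS.eigenvalue (LSFTS.integralOperator (LSFTS.pooledKernel θ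
      (LSFTS.longRunKernel P (vs u)) (LSFTS.longRunKernel P (ws u)))) j)
    -- the eigenvalues of the estimated operator
    (ηhat : ℕ → Ω → ℕ → ℝ)
    (hηhat : ∀ n ω j, ηhat n ω j = LSFTS.eigenvalue (LSFTS.integralOperator (LSFTS.pooledKernel
      ((T₁ n : ℝ) / ((T₁ n : ℝ) + (T₂ n : ℝ)))
      (LSFTS.longRunEstimator K₁ K₂ (h₁ n) (b₁ n) u (T₁ n) (fun t => X (T₁ n) t ω))
      (LSFTS.longRunEstimator K₁ K₂ (h₂ n) (b₂ n) u (T₂ n) (fun t => Y (T₂ n) t ω)))) j)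
    (q₀ qbar : ℕ) (hq₀ : 1 ≤ q₀) (hpos : η (q₀ + 1) < η q₀) (hzero : η (q₀ + 1) = 0)
    (hqbar : q₀ ≤ qbar)
    (ε₀ : ℝ) (hε₀ : 0 < ε₀) (hε₀η : ε₀ < η q₀ / η 1)
    -- an arbitrary selection of a minimizer
    (qhat : ℕ → Ω → ℕ) (hqhat : ∀ n ω, LSFTS.IsRatioEstimate ε₀ qbar (ηhat n ω) (qhat n ω)) :
    TendstoInMeasure P (fun n ω => (qhat n ω : ℝ)) atTop (fun _ => (q₀ : ℝ)) := by
  have hv' := hv.approximable u (Set.Ioo_subset_Icc_self hu)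
  have hvY := hv.mean_zero u (Set.Ioo_subset_Icc_self hu)
  have hw' := hw.approximable u (Set.Ioo_subset_Icc_self hu)
  have hwY := hw.mean_zero u (Set.Ioo_subset_Icc_self hu)
  obtain ⟨φ, hφ⟩ : ∃ φ, φ = LSFTS.pooledKernel θ (LSFTS.longRunKernel P (vs u))
    (LSFTS.longRunKernel P (ws u)) := ⟨_, rfl⟩
  have hθn : ∀ n, (T₁ n : ℝ) / ((T₁ n : ℝ) + (T₂ n : ℝ)) ∈ Set.Icc (0 : ℝ) 1 := fun n =>
    ⟨by positivity, div_le_one_of_le₀ (le_add_of_nonneg_right (Nat.cast_nonneg _)) (by positivity)⟩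
  have hconv := LSFTS.tendstoInMeasure_pooledKernel
    (LSFTS.tendstoInMeasure_longRunEstimator hm₁ hv hX hu hK₁ hK₂ hb₁)
    (LSFTS.tendstoInMeasure_longRunEstimator hm₂ hw hY hu hK₁ hK₂ hb₂) hθn hTθ
  rw [← hφ] at hconv hη
  have hcompact : IsCompactOperator (LSFTS.integralOperatorL _ φ) :=
    hφ ▸ LSFTS.mem_compactKernels.1 (LSFTS.pooledKernel_mem hv'.longRunKernel_mem_compactKernels
      hw'.longRunKernel_mem_compactKernels)
  have hsymm : (LSFTS.integralOperator φ).IsSymmetric :=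
    hφ ▸ LSFTS.isSymmetric_integralOperator (LSFTS.transposeKernel_pooledKernel
      (hv'.transposeKernel_longRunKernel hvY) (hw'.transposeKernel_longRunKernel hwY))
  obtain ⟨δ, hδ, hstable⟩ := LSFTS.exists_perturbation_radius
    (LSFTS.not_finiteDimensional_or_rank_le_one hD) (A := LSFTS.integralOperatorL _ φ) hcompact
    hsymm hη hq₀ hpos hzero hqbar hε₀ hε₀η
  rw [tendstoInMeasure_iff_norm] at hconv ⊢
  intro r hr
  -- The event that `qhat` misses `q₀` lies inside the event that the kernel error is at least `δ`.
  -- Monotonicity of the measure suffices, so arbitrary tie-breaking raises no measurability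
  -- question.
  refine tendsto_of_tendsto_of_tendsto_of_le_of_le tendsto_const_nhds (hconv δ hδ)
    (fun _ => zero_le) fun n => measure_mono fun ω hω => ?_
  by_contra hlt
  rw [Set.mem_ofPred_eq, not_le] at hlt
  have heq := hstable (LSFTS.integralOperatorL _ _)
    (LSFTS.isSymmetric_integralOperator (LSFTS.transposeKernel_pooledKernel
      (LSFTS.transposeKernel_longRunEstimator _ _ _ _ _ _ _)
      (LSFTS.transposeKernel_longRunEstimator _ _ _ _ _ _ _)))
    (LSFTS.pooledKernel_mem (M := LSFTS.finiteRankKernels _)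
      (LSFTS.longRunEstimator_mem_finiteRankKernels _ _ _ _ _ _ _)
      (LSFTS.longRunEstimator_mem_finiteRankKernels _ _ _ _ _ _ _))
    ((LSFTS.norm_integralOperatorL_sub_le _ _).trans_lt hlt) (ηhat n ω) (hηhat n ω) (qhat n ω)
    (hqhat n ω)
  rw [Set.mem_ofPred_eq, heq, sub_self, norm_zero] at hω
  exact absurd hω (not_le.2 hr)
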